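/- Let $M$ be a two-dimensional smooth manifold without boundary (Hausdorff, second countable), and let $g$ be a smooth complete Riemannian metric on $M$. For a Riemannian metric $g'$ on $M$ let $R_{g'}$ be its scalar curvature, $dV_{g'}$ its volume measure, and $\mathfrak{S}^2(g')=\int_M R_{g'}^2\,dV_{g'}\in[0,\infty]$. Suppose that $g$ is critical for $\mathfrak{S}^2$ under compactly supported variations, that is, for every compact set $K\subset M$ and every smooth symmetric $2$-tensor field $h$ vanishing outside $K$, $$\frac{d}{dt}\Big|_{t=0}\int_K R_{g+th}^2\,dV_{g+th}=0 .$$ Then $g$ is flat, i.e. its Riemann curvature tensor vanishes identically; in particular $g$ is a global minimum of $\mathfrak{S}^2$: $\mathfrak{S}^2(g)\le\mathfrak{S}^2(g')$ for every smooth Riemannian metric $g'$ on $M$. -/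

import Mathlib

open scoped Manifold ContDiff ENNReal Topology
open Bundle MeasureTheory

namespace QuadraticCurvature

noncomputable section

/-! ### Curvature of a matrix-valued function on a coordinate domain -/

/-- The `i`-th partial derivative of a function on `ℝⁿ`. -/
def partialDeriv {n : ℕ} (i : Fin n) (f : EuclideanSpace ℝ (Fin n) → ℝ)
    (y : EuclideanSpace ℝ (Fin n)) : ℝ :=
  fderiv ℝ f y (EuclideanSpace.single i 1)

/-- Christoffel symbols
`Γᵏᵢⱼ = ½ ∑ₗ gᵏˡ (∂ᵢ gⱼₗ + ∂ⱼ gᵢₗ - ∂ₗ gᵢⱼ)` of a metric given in coordinates. -/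
def christoffel {n : ℕ} (G : EuclideanSpace ℝ (Fin n) → Matrix (Fin n) (Fin n) ℝ)
    (k i j : Fin n) (y : EuclideanSpace ℝ (Fin n)) : ℝ :=
  (1 / 2) * ∑ l, (G y)⁻¹ k l *
    (partialDeriv i (fun z => G z j l) y + partialDeriv j (fun z => G z i l) y
      - partialDeriv l (fun z => G z i j) y)

/-- Components `Rˡₖᵢⱼ` of the Riemann tensor, i.e. `R(∂ᵢ, ∂ⱼ) ∂ₖ = ∑ₗ Rˡₖᵢⱼ ∂ₗ` with
`R(X, Y) = ∇_X ∇_Y - ∇_Y ∇_X - ∇_[X, Y]`. -/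
def riemann {n : ℕ} (G : EuclideanSpace ℝ (Fin n) → Matrix (Fin n) (Fin n) ℝ)
    (l k i j : Fin n) (y : EuclideanSpace ℝ (Fin n)) : ℝ :=
  partialDeriv i (christoffel G l j k) y - partialDeriv j (christoffel G l i k) y
    + ∑ m, (christoffel G l i m y * christoffel G m j k y
      - christoffel G l j m y * christoffel G m i k y)

/-- Components `Ricⱼₖ = ∑ᵢ Rⁱₖᵢⱼ` of the Ricci tensor. -/
def ricci {n : ℕ} (G : EuclideanSpace ℝ (Fin n) → Matrix (Fin n) (Fin n) ℝ)
    (j k : Fin n) (y : EuclideanSpace ℝ (Fin n)) : ℝ :=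
  ∑ i, riemann G i k i j y

/-- Scalar curvature `∑ⱼₖ gʲᵏ Ricⱼₖ` of a metric given in coordinates. -/
def scalar {n : ℕ} (G : EuclideanSpace ℝ (Fin n) → Matrix (Fin n) (Fin n) ℝ)
    (y : EuclideanSpace ℝ (Fin n)) : ℝ :=
  ∑ j, ∑ k, (G y)⁻¹ j k * ricci G j k y

/-! ### Metrics, curvature and volume on a manifold without boundary -/

/-- Fields of bilinear forms on the tangent spaces of an `n`-dimensional manifold. -/
abbrev BilinField (n : ℕ) (M : Type*) [TopologicalSpace M]
    [ChartedSpace (EuclideanSpace ℝ (Fin n)) M] : Type _ :=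
  (x : M) → TangentSpace (𝓡 n) x →L[ℝ] TangentSpace (𝓡 n) x →L[ℝ] ℝ

/-- Smooth Riemannian metrics on an `n`-dimensional manifold without boundary. -/
abbrev SmoothMetric (n : ℕ) (M : Type*) [TopologicalSpace M]
    [ChartedSpace (EuclideanSpace ℝ (Fin n)) M] [IsManifold (𝓡 n) ∞ M] : Type _ :=
  ContMDiffRiemannianMetric (𝓡 n) ∞ (EuclideanSpace ℝ (Fin n))
    (fun x : M => TangentSpace (𝓡 n) x)

variable {n : ℕ} {M : Type*} [TopologicalSpace M] [ChartedSpace (EuclideanSpace ℝ (Fin n)) M]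

/-- The matrix `b(∂ᵢ, ∂ⱼ)` of a field of bilinear forms in the preferred chart at `p`, as a function
on the target of that chart. -/
def inChart (b : BilinField n M) (p : M) (y : EuclideanSpace ℝ (Fin n)) :
    Matrix (Fin n) (Fin n) ℝ :=
  Matrix.of fun i j =>
    b ((extChartAt (𝓡 n) p).symm y)
      (mfderiv 𝓘(ℝ, EuclideanSpace ℝ (Fin n)) (𝓡 n) (extChartAt (𝓡 n) p).symm y
        (EuclideanSpace.single i (1 : ℝ) : EuclideanSpace ℝ (Fin n)))
      (mfderiv 𝓘(ℝ, EuclideanSpace ℝ (Fin n)) (𝓡 n) (extChartAt (𝓡 n) p).symm y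
        (EuclideanSpace.single j (1 : ℝ) : EuclideanSpace ℝ (Fin n)))

/-- The scalar curvature `R` at `p`, computed in the preferred chart at `p`. -/
def scalarCurvature (b : BilinField n M) (p : M) : ℝ :=
  scalar (inChart b p) (extChartAt (𝓡 n) p p)

/-- A metric is flat if all components of its Riemann tensor vanish identically in every preferred
chart. -/
def IsFlat (b : BilinField n M) : Prop :=
  ∀ p : M, ∀ y ∈ (extChartAt (𝓡 n) p).target, ∀ l k i j : Fin n, riemann (inChart b p) l k i j y = 0

/-- The measure `√(det gᵢⱼ) dy` of the preferred chart at `p`, transported to `M`. -/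
def chartVolume [MeasurableSpace M] (b : BilinField n M) (p : M) : Measure M :=
  ((volume.restrict (extChartAt (𝓡 n) p).target).withDensity fun y =>
    ENNReal.ofReal (Real.sqrt (inChart b p y).det)).map (extChartAt (𝓡 n) p).symm

/-- The Riemannian volume measure. By the change of variables formula the chart measures agree on
overlaps of charts; their least upper bound is the measure that restricts to each of them. -/
def riemannianVolume [MeasurableSpace M] (b : BilinField n M) : Measure M :=
  ⨆ p : M, chartVolume b p

/-- The integral `∫_K R² dV`, with values in `[0, ∞]`. -/
def scalarEnergyOn [MeasurableSpace M] (b : BilinField n M) (K : Set M) : ℝ≥0∞ :=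
  ∫⁻ x in K, ENNReal.ofReal (scalarCurvature b x ^ 2) ∂(riemannianVolume b)

/-- The functional `𝔖² = ∫_M R² dV`, with values in `[0, ∞]`. -/
def scalarEnergy [MeasurableSpace M] (b : BilinField n M) : ℝ≥0∞ :=
  scalarEnergyOn b Set.univ

variable [IsManifold (𝓡 n) ∞ M]

/-- Smooth fields of symmetric bilinear forms. -/
def IsSmoothSymmetric (h : BilinField n M) : Prop :=
  (∀ x v w, h x v w = h x w v) ∧
  ContMDiff (𝓡 n)
    ((𝓡 n).prod 𝓘(ℝ, EuclideanSpace ℝ (Fin n) →L[ℝ] EuclideanSpace ℝ (Fin n) →L[ℝ] ℝ)) ∞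
    (fun x => TotalSpace.mk' (EuclideanSpace ℝ (Fin n) →L[ℝ] EuclideanSpace ℝ (Fin n) →L[ℝ] ℝ)
      (E := fun x : M => TangentSpace (𝓡 n) x →L[ℝ] TangentSpace (𝓡 n) x →L[ℝ] ℝ) x (h x))

/-- `g` is critical for `𝔖²`: for every smooth symmetric `h` that vanishes outside a compact set
`K`, the first variation of `∫_K R² dV` in the direction `h` is zero. For small `t` the field
`g + t h` is again a Riemannian metric, and only such `t` matter for the derivative at `0`. -/
def IsCritical [MeasurableSpace M] (g : SmoothMetric n M) : Prop :=
  ∀ h : BilinField n M, IsSmoothSymmetric h → ∀ K : Set M, IsCompact K → (∀ x, x ∉ K → h x = 0) →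
    HasDerivAt (fun t : ℝ => (scalarEnergyOn (fun x => g.inner x + t • h x) K).toReal) 0 0

/-- The distance of `g`: the infimum of the lengths of `C¹` curves (`∞` between different connected
components). -/
def riemannianDistance (g : SmoothMetric n M) (x y : M) : ℝ≥0∞ :=
  letI : RiemannianBundle (fun x : M => TangentSpace (𝓡 n) x) := ⟨g.toRiemannianMetric⟩
  Manifold.riemannianEDist (𝓡 n) x y

/-- `g` is complete: sequences that are Cauchy for the distance of `g` converge. -/
def IsComplete (g : SmoothMetric n M) : Prop :=
  ∀ u : ℕ → M,
    (∀ ε : ℝ≥0∞, 0 < ε → ∃ N, ∀ i ≥ N, ∀ j ≥ N, riemannianDistance g (u i) (u j) < ε) →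
    ∃ x, Filter.Tendsto u Filter.atTop (𝓝 x)

end

end QuadraticCurvature

/-! Let `u` be minus the Gauss curvature, so `R = -2u`. Criticality for `∫ R² dV` is equivalent to
`Hess u = (u²/2) g`; only the implication from criticality is needed. The differential of `|∇u|²` is
then `2 Hess u(∇u, ·) = u² du`, so `|∇u|² - u³/3` is locally constant. Suppose `∇u ≠ 0` at a point
where `u = a`. Following the gradient from there keeps `|∇u|² = C + u³/3` with the same `C`, a
quantity that stays positive and grows like `u³`. Per unit length `u` increases at rate `|∇u| ≥ √δ
(u - a + 1)^{3/2}`, so it would become infinite within finite length, against completeness. Hence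
`∇u = 0` everywhere, the Hessian vanishes, and `u² = 0`. In dimension two this gives flatness, and
the energy is zero.

The local computation uses an orthonormal coframe `e`. Its connection form `ω` comes from the first
structure equations, and `u` is `dω` divided by the determinant of `e`. `scalar_eq_frameCurv`
identifies this with the coordinate definition, and `scalar_pullback` gives independence of the
chart. The Cholesky coframe is triangular, so its three nonzero entries parametrize metrics without
rotational redundancy. `dirDeriv_energyDensity` splits the variation of the density into a
divergence and a pairing with the variation of the coframe; `eulerLagrange_of_planeCritical`
concludes by integration by parts and arbitrary test functions. `planeCritical_inChart` carries
criticality from the surface to each chart.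

The global step avoids integral curves and the Hopf-Rinow theorem. `not_forall_exists_descent` is a
Caristi-Ekeland principle: in a complete space a nonnegative continuous potential on a closed set
cannot be lowered from every point at a cost in distance bounded by the drop. In `gradSq_eq_zero`
the potential is `κ / √(u - a + 1)` and the set is the part `u ≥ a` of a level set of the first
integral; a short coordinate segment in the gradient direction provides the forbidden descent. -/

namespace QuadraticCurvature

noncomputable section

/-! ### Directional derivatives of smooth functions on open sets -/

section Calculus

variable {W : Type*} [NormedAddCommGroup W] [NormedSpace ℝ W]

/-- The derivative of `f` in the direction `v`. -/
def dirDeriv (v : W) (f : W → ℝ) (z : W) : ℝ := fderiv ℝ f z v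

variable {V : Set W} {f g : W → ℝ} {v w z : W}

theorem differentiableAt_of_contDiffOn (hf : ContDiffOn ℝ ∞ f V) (hV : IsOpen V) (hz : z ∈ V) :
    DifferentiableAt ℝ f z :=
  (hf.contDiffAt (hV.mem_nhds hz)).differentiableAt (by simp)

theorem contDiffOn_dirDeriv (hf : ContDiffOn ℝ ∞ f V) (hV : IsOpen V) (v : W) :
    ContDiffOn ℝ ∞ (dirDeriv v f) V :=
  (hf.fderiv_of_isOpen hV (m := ∞) (by simp)).clm_apply contDiffOn_const

theorem dirDeriv_congr (hV : IsOpen V) (h : Set.EqOn f g V) (hz : z ∈ V) :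
    dirDeriv v f z = dirDeriv v g z := by
  unfold dirDeriv
  rw [(h.eventuallyEq_of_mem (hV.mem_nhds hz)).fderiv_eq]

theorem dirDeriv_comm (hf : ContDiffOn ℝ ∞ f V) (hV : IsOpen V) (hz : z ∈ V) (v w : W) :
    dirDeriv v (dirDeriv w f) z = dirDeriv w (dirDeriv v f) z := by
  have hs : IsSymmSndFDerivAt ℝ f z :=
    (hf.contDiffAt (hV.mem_nhds hz)).isSymmSndFDerivAt (by simpa using ENat.LEInfty.out)
  have hd : DifferentiableAt ℝ (fderiv ℝ f) z :=
    ((hf.fderiv_of_isOpen hV (m := ∞) (by simp)).contDiffAt (hV.mem_nhds hz)).differentiableAt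
      (by simp)
  have key : ∀ v w : W, dirDeriv v (dirDeriv w f) z = fderiv ℝ (fderiv ℝ f) z v w := by
    intro v w
    unfold dirDeriv
    rw [fderiv_clm_apply hd (differentiableAt_const w)]
    simp
  rw [key, key, hs.eq]

theorem dirDeriv_const (c : ℝ) : dirDeriv v (fun _ => c) z = 0 := by simp [dirDeriv]

theorem dirDeriv_add (hf : DifferentiableAt ℝ f z) (hg : DifferentiableAt ℝ g z) :
    dirDeriv v (fun x => f x + g x) z = dirDeriv v f z + dirDeriv v g z := by
  simp [dirDeriv, fderiv_fun_add hf hg]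

theorem dirDeriv_sub (hf : DifferentiableAt ℝ f z) (hg : DifferentiableAt ℝ g z) :
    dirDeriv v (fun x => f x - g x) z = dirDeriv v f z - dirDeriv v g z := by
  simp [dirDeriv, fderiv_fun_sub hf hg]

theorem dirDeriv_neg : dirDeriv v (fun x => - f x) z = - dirDeriv v f z := by
  simp [dirDeriv, fderiv_fun_neg]

theorem dirDeriv_mul (hf : DifferentiableAt ℝ f z) (hg : DifferentiableAt ℝ g z) :
    dirDeriv v (fun x => f x * g x) z = dirDeriv v f z * g z + f z * dirDeriv v g z := by
  simp [dirDeriv, fderiv_fun_mul hf hg]; ring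

theorem dirDeriv_const_mul (c : ℝ) (hf : DifferentiableAt ℝ f z) :
    dirDeriv v (fun x => c * f x) z = c * dirDeriv v f z := by
  simp [dirDeriv, fderiv_const_mul hf]

theorem dirDeriv_pow (n : ℕ) (hf : DifferentiableAt ℝ f z) :
    dirDeriv v (fun x => f x ^ (n + 1)) z = (n + 1) * f z ^ n * dirDeriv v f z := by
  have h : HasFDerivAt (fun x => f x ^ (n + 1)) _ z := hf.hasFDerivAt.pow (n + 1)
  simp [dirDeriv, h.fderiv]

/-! ### Curvature of a coframe along two commuting directions -/

/-- The exterior derivative of a `1`-form along the directions `v 0`, `v 1`. -/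
def curl (v : Fin 2 → W) (η : Fin 2 → W → ℝ) (z : W) : ℝ :=
  dirDeriv (v 0) (η 1) z - dirDeriv (v 1) (η 0) z

/-- The determinant of a coframe. -/
def frameDet (e : Fin 2 → Fin 2 → W → ℝ) (z : W) : ℝ :=
  e 0 0 z * e 1 1 z - e 0 1 z * e 1 0 z

/-- The connection form of a coframe, as determined by the first structure equation. -/
def frameConn (v : Fin 2 → W) (e : Fin 2 → Fin 2 → W → ℝ) (i : Fin 2) (z : W) : ℝ :=
  (curl v (e 0) z * e 0 i z + curl v (e 1) z * e 1 i z) / frameDet e z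

/-- Minus the Gauss curvature of the metric for which a coframe is orthonormal. -/
def frameCurv (v : Fin 2 → W) (e : Fin 2 → Fin 2 → W → ℝ) (z : W) : ℝ :=
  curl v (frameConn v e) z / frameDet e z

variable {v : Fin 2 → W} {η ζ : Fin 2 → W → ℝ} {e : Fin 2 → Fin 2 → W → ℝ}

theorem contDiffOn_curl (hV : IsOpen V) (hη : ∀ i, ContDiffOn ℝ ∞ (η i) V) :
    ContDiffOn ℝ ∞ (curl v η) V :=
  (contDiffOn_dirDeriv (hη 1) hV _).sub (contDiffOn_dirDeriv (hη 0) hV _)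

theorem curl_congr (hV : IsOpen V) (h : ∀ i, Set.EqOn (η i) (ζ i) V) (hz : z ∈ V) :
    curl v η z = curl v ζ z := by
  unfold curl
  rw [dirDeriv_congr hV (h 1) hz, dirDeriv_congr hV (h 0) hz]

theorem contDiffOn_frameDet (he : ∀ k i, ContDiffOn ℝ ∞ (e k i) V) :
    ContDiffOn ℝ ∞ (frameDet e) V :=
  ((he 0 0).mul (he 1 1)).sub ((he 0 1).mul (he 1 0))

theorem contDiffOn_frameConn (hV : IsOpen V) (he : ∀ k i, ContDiffOn ℝ ∞ (e k i) V)
    (hd : ∀ z ∈ V, frameDet e z ≠ 0) (i : Fin 2) :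
    ContDiffOn ℝ ∞ (frameConn v e i) V :=
  (((contDiffOn_curl hV (he 0)).mul (he 0 i)).add
    ((contDiffOn_curl hV (he 1)).mul (he 1 i))).div (contDiffOn_frameDet he) hd

theorem contDiffOn_frameCurv (hV : IsOpen V) (he : ∀ k i, ContDiffOn ℝ ∞ (e k i) V)
    (hd : ∀ z ∈ V, frameDet e z ≠ 0) :
    ContDiffOn ℝ ∞ (frameCurv v e) V :=
  (contDiffOn_curl hV (contDiffOn_frameConn hV he hd)).div (contDiffOn_frameDet he) hd

end Calculus

/-! ### The curvature of a metric on a plane domain in terms of an orthonormal coframe -/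

/-- The standard basis of the plane. -/
def stdVec (i : Fin 2) : EuclideanSpace ℝ (Fin 2) := EuclideanSpace.single i 1

theorem partialDeriv_eq_dirDeriv (i : Fin 2) (f : EuclideanSpace ℝ (Fin 2) → ℝ) :
    partialDeriv i f = dirDeriv (stdVec i) f := rfl

theorem inv_fin_two_apply (A : Matrix (Fin 2) (Fin 2) ℝ) :
    A⁻¹ 0 0 = A 1 1 / A.det ∧ A⁻¹ 0 1 = - A 0 1 / A.det ∧
      A⁻¹ 1 0 = - A 1 0 / A.det ∧ A⁻¹ 1 1 = A 0 0 / A.det := by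
  simp [Matrix.inv_def, Matrix.adjugate_fin_two, Ring.inverse_eq_inv']
  refine ⟨?_, ?_, ?_, ?_⟩ <;> ring

/-- A coframe rotated by a right angle. -/
def rotFrame {W : Type*} (e : Fin 2 → Fin 2 → W → ℝ) (l j : Fin 2) (z : W) : ℝ :=
  if l = 0 then - e 1 j z else e 0 j z

section Frame

variable {V : Set (EuclideanSpace ℝ (Fin 2))} {z : EuclideanSpace ℝ (Fin 2)}
  {e : Fin 2 → Fin 2 → EuclideanSpace ℝ (Fin 2) → ℝ}
  {G : EuclideanSpace ℝ (Fin 2) → Matrix (Fin 2) (Fin 2) ℝ}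

theorem det_eq_frameDet_sq
    (hG : ∀ z ∈ V, ∀ i j, G z i j = e 0 i z * e 0 j z + e 1 i z * e 1 j z) (hz : z ∈ V) :
    (G z).det = frameDet e z ^ 2 := by
  rw [Matrix.det_fin_two, hG z hz, hG z hz, hG z hz, hG z hz, frameDet]; ring

theorem partialDeriv_metric_frame (hV : IsOpen V) (he : ∀ k i, ContDiffOn ℝ ∞ (e k i) V)
    (hG : ∀ z ∈ V, ∀ i j, G z i j = e 0 i z * e 0 j z + e 1 i z * e 1 j z) (hz : z ∈ V)
    (m i j : Fin 2) :
    partialDeriv m (fun z => G z i j) z =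
      dirDeriv (stdVec m) (e 0 i) z * e 0 j z + e 0 i z * dirDeriv (stdVec m) (e 0 j) z
      + (dirDeriv (stdVec m) (e 1 i) z * e 1 j z + e 1 i z * dirDeriv (stdVec m) (e 1 j) z) := by
  have hd : ∀ k i, DifferentiableAt ℝ (e k i) z :=
    fun k i => differentiableAt_of_contDiffOn (he k i) hV hz
  rw [partialDeriv_eq_dirDeriv, dirDeriv_congr hV (fun z hz => hG z hz i j) hz,
    dirDeriv_add ((hd 0 i).fun_mul (hd 0 j)) ((hd 1 i).fun_mul (hd 1 j)), dirDeriv_mul (hd 0 i) (hd 0 j),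
    dirDeriv_mul (hd 1 i) (hd 1 j)]

/-- The Christoffel symbols of a metric in terms of an orthonormal coframe. -/
theorem frame_mul_christoffel (hV : IsOpen V) (he : ∀ k i, ContDiffOn ℝ ∞ (e k i) V)
    (hd : ∀ z ∈ V, frameDet e z ≠ 0)
    (hG : ∀ z ∈ V, ∀ i j, G z i j = e 0 i z * e 0 j z + e 1 i z * e 1 j z) (hz : z ∈ V)
    (l i j : Fin 2) :
    e l 0 z * christoffel G 0 i j z + e l 1 z * christoffel G 1 i j z
      = dirDeriv (stdVec i) (e l j) z + frameConn stdVec e i z * rotFrame e l j z := by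
  obtain ⟨h00, h01, h10, h11⟩ := inv_fin_two_apply (G z)
  have hdz := hd z hz
  simp only [christoffel, Fin.sum_univ_two, h00, h01, h10, h11, det_eq_frameDet_sq hG hz,
    partialDeriv_metric_frame hV he hG hz, hG z hz, frameConn, curl, rotFrame]
  have hD : frameDet e z = e 0 0 z * e 1 1 z - e 0 1 z * e 1 0 z := rfl
  -- The determinant is kept as a single nonzero symbol while denominators are cleared, and expanded
  -- only for the final polynomial identity.
  generalize frameDet e z = D at *
  fin_cases l <;> fin_cases i <;> fin_cases j <;> simp <;> field_simp <;> subst hD <;> ring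

theorem contDiffOn_rotFrame (he : ∀ k i, ContDiffOn ℝ ∞ (e k i) V) (l j : Fin 2) :
    ContDiffOn ℝ ∞ (rotFrame e l j) V := by
  fin_cases l
  · exact (he 1 j).neg.congr fun z _ => by simp [rotFrame]
  · exact (he 0 j).congr fun z _ => by simp [rotFrame]

/-- `frame_mul_christoffel` is a linear system for the two symbols with matrix the coframe; Cramer's
rule writes them as quotients of visibly smooth functions. -/
theorem contDiffOn_christoffel (hV : IsOpen V) (he : ∀ k i, ContDiffOn ℝ ∞ (e k i) V)
    (hd : ∀ z ∈ V, frameDet e z ≠ 0)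
    (hG : ∀ z ∈ V, ∀ i j, G z i j = e 0 i z * e 0 j z + e 1 i z * e 1 j z) (k i j : Fin 2) :
    ContDiffOn ℝ ∞ (christoffel G k i j) V := by
  have hT : ∀ l, ContDiffOn ℝ ∞ (fun z => dirDeriv (stdVec i) (e l j) z
      + frameConn stdVec e i z * rotFrame e l j z) V := by
    intro l
    refine (contDiffOn_dirDeriv (he l j) hV _).add ((contDiffOn_frameConn hV he hd i).mul ?_)
    exact contDiffOn_rotFrame he l j
  have h0 : ContDiffOn ℝ ∞ (christoffel G 0 i j) V := by
    refine ((((he 1 1).mul (hT 0)).sub ((he 0 1).mul (hT 1))).div (contDiffOn_frameDet he)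
      hd).congr fun z hz => ?_
    have hdz := hd z hz
    rw [Pi.div_apply, eq_div_iff hdz]
    rw [← frame_mul_christoffel hV he hd hG hz, ← frame_mul_christoffel hV he hd hG hz, frameDet]
    ring
  have h1 : ContDiffOn ℝ ∞ (christoffel G 1 i j) V := by
    refine ((((he 0 0).mul (hT 1)).sub ((he 1 0).mul (hT 0))).div (contDiffOn_frameDet he)
      hd).congr fun z hz => ?_
    have hdz := hd z hz
    rw [Pi.div_apply, eq_div_iff hdz]
    rw [← frame_mul_christoffel hV he hd hG hz, ← frame_mul_christoffel hV he hd hG hz, frameDet]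
    ring
  fin_cases k
  · exact h0
  · exact h1

/-- Differentiated form of `frame_mul_christoffel`. -/
theorem frame_mul_partialDeriv_christoffel (hV : IsOpen V)
    (he : ∀ k i, ContDiffOn ℝ ∞ (e k i) V) (hd : ∀ z ∈ V, frameDet e z ≠ 0)
    (hG : ∀ z ∈ V, ∀ i j, G z i j = e 0 i z * e 0 j z + e 1 i z * e 1 j z) (hz : z ∈ V)
    (m l i j : Fin 2) :
    dirDeriv (stdVec m) (e l 0) z * christoffel G 0 i j z
        + e l 0 z * partialDeriv m (christoffel G 0 i j) z
        + (dirDeriv (stdVec m) (e l 1) z * christoffel G 1 i j z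
        + e l 1 z * partialDeriv m (christoffel G 1 i j) z)
      = dirDeriv (stdVec m) (dirDeriv (stdVec i) (e l j)) z
        + (dirDeriv (stdVec m) (frameConn stdVec e i) z * rotFrame e l j z
        + frameConn stdVec e i z * rotFrame (fun k j => dirDeriv (stdVec m) (e k j)) l j z) := by
  have hrot' : dirDeriv (stdVec m) (rotFrame e l j) z
      = rotFrame (fun k j => dirDeriv (stdVec m) (e k j)) l j z := by
    fin_cases l
    · simpa [rotFrame] using
        (dirDeriv_congr (v := stdVec m) hV (fun z _ => by simp [rotFrame]) hz).trans dirDeriv_neg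
    · exact dirDeriv_congr hV (fun z _ => by simp [rotFrame]) hz
  have key := dirDeriv_congr (v := stdVec m) hV
    (fun z hz => frame_mul_christoffel hV he hd hG hz l i j) hz
  have hc := fun k => differentiableAt_of_contDiffOn (contDiffOn_christoffel hV he hd hG k i j) hV hz
  have hde := fun i => differentiableAt_of_contDiffOn (he l i) hV hz
  have hω := differentiableAt_of_contDiffOn (contDiffOn_frameConn (v := stdVec) hV he hd i) hV hz
  have hr := differentiableAt_of_contDiffOn (contDiffOn_rotFrame he l j) hV hz
  rw [dirDeriv_add ((hde 0).fun_mul (hc 0)) ((hde 1).fun_mul (hc 1)), dirDeriv_mul (hde 0) (hc 0),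
    dirDeriv_mul (hde 1) (hc 1), dirDeriv_add
      (differentiableAt_of_contDiffOn (contDiffOn_dirDeriv (he l j) hV _) hV hz) (hω.fun_mul hr),
    dirDeriv_mul hω hr, hrot'] at key
  exact key

/-- The curvature of a metric in terms of an orthonormal coframe. -/
theorem frame_mul_riemann (hV : IsOpen V)
    (he : ∀ k i, ContDiffOn ℝ ∞ (e k i) V) (hd : ∀ z ∈ V, frameDet e z ≠ 0)
    (hG : ∀ z ∈ V, ∀ i j, G z i j = e 0 i z * e 0 j z + e 1 i z * e 1 j z) (hz : z ∈ V)
    (l k : Fin 2) :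
    e l 0 z * riemann G 0 k 0 1 z + e l 1 z * riemann G 1 k 0 1 z
      = curl stdVec (frameConn stdVec e) z * rotFrame e l k z := by
  -- Cartan's second structure equation: after antisymmetrizing in the two directions, second
  -- derivatives of the coframe cancel, the quadratic Christoffel terms are absorbed by the
  -- undifferentiated equations `c`, and the `ω₀ω₁` terms cancel because plane rotations commute.
  -- Only `dω` remains.
  have h1 := frame_mul_partialDeriv_christoffel hV he hd hG hz 0 l 1 k
  have h2 := frame_mul_partialDeriv_christoffel hV he hd hG hz 1 l 0 k
  have h3 := dirDeriv_comm (he l k) hV hz (stdVec 0) (stdVec 1)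
  have c := fun l i j => frame_mul_christoffel hV he hd hG hz l i j
  simp only [riemann, Fin.sum_univ_two, curl]
  fin_cases l <;> simp [rotFrame] at h1 h2 h3 ⊢
  · have c1 := c 0 0 0
    have c2 := c 0 0 1
    have c3 := c 0 1 0
    have c4 := c 0 1 1
    have c5 := c 1 0 k
    have c6 := c 1 1 k
    simp [rotFrame] at c1 c2 c3 c4 c5 c6
    linear_combination h1 - h2 + h3 + c1 * christoffel G 0 1 k z + c2 * christoffel G 1 1 k z
      - c3 * christoffel G 0 0 k z - c4 * christoffel G 1 0 k z
      - frameConn stdVec e 0 z * c6 + frameConn stdVec e 1 z * c5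
  · have c1 := c 1 0 0
    have c2 := c 1 0 1
    have c3 := c 1 1 0
    have c4 := c 1 1 1
    have c5 := c 0 0 k
    have c6 := c 0 1 k
    simp [rotFrame] at c1 c2 c3 c4 c5 c6
    linear_combination h1 - h2 + h3 + c1 * christoffel G 0 1 k z + c2 * christoffel G 1 1 k z
      - c3 * christoffel G 0 0 k z - c4 * christoffel G 1 0 k z
      + frameConn stdVec e 0 z * c6 - frameConn stdVec e 1 z * c5

/-- Multiplying `frame_mul_riemann` by the adjugate of the coframe isolates each component. All of
the curvature is thus a multiple of the one function `frameCurv`. -/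
theorem riemann_zero_one_eq (hV : IsOpen V)
    (he : ∀ k i, ContDiffOn ℝ ∞ (e k i) V) (hd : ∀ z ∈ V, frameDet e z ≠ 0)
    (hG : ∀ z ∈ V, ∀ i j, G z i j = e 0 i z * e 0 j z + e 1 i z * e 1 j z) (hz : z ∈ V)
    (k : Fin 2) :
    riemann G 0 k 0 1 z = frameCurv stdVec e z *
        (e 1 1 z * rotFrame e 0 k z - e 0 1 z * rotFrame e 1 k z) ∧
      riemann G 1 k 0 1 z = frameCurv stdVec e z *
        (e 0 0 z * rotFrame e 1 k z - e 1 0 z * rotFrame e 0 k z) := by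
  have h0 := frame_mul_riemann hV he hd hG hz 0 k
  have h1 := frame_mul_riemann hV he hd hG hz 1 k
  have hdz := hd z hz
  have hc : frameDet e z * frameCurv stdVec e z = curl stdVec (frameConn stdVec e) z := by
    rw [frameCurv]; field_simp
  rw [← hc] at h0 h1
  refine ⟨mul_left_cancel₀ hdz ?_, mul_left_cancel₀ hdz ?_⟩
  · conv_lhs => rw [frameDet]
    linear_combination e 1 1 z * h0 - e 0 1 z * h1
  · conv_lhs => rw [frameDet]
    linear_combination e 0 0 z * h1 - e 1 0 z * h0

theorem riemann_self (G : EuclideanSpace ℝ (Fin 2) → Matrix (Fin 2) (Fin 2) ℝ) (l k i : Fin 2)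
    (z : EuclideanSpace ℝ (Fin 2)) : riemann G l k i i z = 0 := by
  simp [riemann]

theorem riemann_swap (G : EuclideanSpace ℝ (Fin 2) → Matrix (Fin 2) (Fin 2) ℝ) (l k i j : Fin 2)
    (z : EuclideanSpace ℝ (Fin 2)) : riemann G l k i j z = - riemann G l k j i z := by
  simp only [riemann, Fin.sum_univ_two]; ring

/-- The bridge from the coordinate definition to Cartan's formalism. Any orthonormal coframe is
allowed, triangular or not, as needed for coframes pulled back between charts. -/
theorem scalar_eq_frameCurv (hV : IsOpen V)
    (he : ∀ k i, ContDiffOn ℝ ∞ (e k i) V) (hd : ∀ z ∈ V, frameDet e z ≠ 0)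
    (hG : ∀ z ∈ V, ∀ i j, G z i j = e 0 i z * e 0 j z + e 1 i z * e 1 j z) (hz : z ∈ V) :
    scalar G z = -2 * frameCurv stdVec e z := by
  obtain ⟨h00, h01, h10, h11⟩ := inv_fin_two_apply (G z)
  have hdz := hd z hz
  simp only [scalar, ricci, Fin.sum_univ_two, h00, h01, h10, h11, det_eq_frameDet_sq hG hz,
    hG z hz, riemann_self, riemann_swap G _ _ 1 0, (riemann_zero_one_eq hV he hd hG hz _).1,
    (riemann_zero_one_eq hV he hd hG hz _).2, rotFrame]
  have hD : frameDet e z = e 0 0 z * e 1 1 z - e 0 1 z * e 1 0 z := rfl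
  generalize frameDet e z = D at *
  simp
  field_simp
  subst hD
  ring

theorem riemann_eq_zero (hV : IsOpen V)
    (he : ∀ k i, ContDiffOn ℝ ∞ (e k i) V) (hd : ∀ z ∈ V, frameDet e z ≠ 0)
    (hG : ∀ z ∈ V, ∀ i j, G z i j = e 0 i z * e 0 j z + e 1 i z * e 1 j z) (hz : z ∈ V)
    (h0 : scalar G z = 0) (l k i j : Fin 2) : riemann G l k i j z = 0 := by
  have hu : frameCurv stdVec e z = 0 := by
    rw [scalar_eq_frameCurv hV he hd hG hz] at h0; linarith
  have h01 : ∀ l k, riemann G l k 0 1 z = 0 := by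
    intro l k
    fin_cases l
    · simpa [hu] using (riemann_zero_one_eq hV he hd hG hz k).1
    · simpa [hu] using (riemann_zero_one_eq hV he hd hG hz k).2
  fin_cases i <;> fin_cases j
  · exact riemann_self G l k 0 z
  · exact h01 l k
  · simpa [h01] using riemann_swap G l k 1 0 z
  · exact riemann_self G l k 1 z

end Frame

/-! ### Invariance of the scalar curvature under changes of coordinates -/

/-- The entry `∂ᵢ ψᵏ` of the Jacobian matrix of a map of the plane. -/
def jac (ψ : EuclideanSpace ℝ (Fin 2) → EuclideanSpace ℝ (Fin 2)) (k i : Fin 2)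
    (z : EuclideanSpace ℝ (Fin 2)) : ℝ :=
  dirDeriv (stdVec i) (fun y => ψ y k) z

theorem eq_sum_stdVec (w : EuclideanSpace ℝ (Fin 2)) : w = w 0 • stdVec 0 + w 1 • stdVec 1 := by
  ext i
  fin_cases i <;> simp [stdVec]

/-- The pullback of a `1`-form. -/
def pullForm (ψ : EuclideanSpace ℝ (Fin 2) → EuclideanSpace ℝ (Fin 2))
    (η : Fin 2 → EuclideanSpace ℝ (Fin 2) → ℝ) (i : Fin 2) (z : EuclideanSpace ℝ (Fin 2)) : ℝ :=
  η 0 (ψ z) * jac ψ 0 i z + η 1 (ψ z) * jac ψ 1 i z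

section Pullback

variable {U V : Set (EuclideanSpace ℝ (Fin 2))} {z : EuclideanSpace ℝ (Fin 2)}
  {ψ : EuclideanSpace ℝ (Fin 2) → EuclideanSpace ℝ (Fin 2)}
  {η : Fin 2 → EuclideanSpace ℝ (Fin 2) → ℝ}
  {e : Fin 2 → Fin 2 → EuclideanSpace ℝ (Fin 2) → ℝ}

theorem contDiffOn_coord (hψ : ContDiffOn ℝ ∞ ψ V) (k : Fin 2) :
    ContDiffOn ℝ ∞ (fun y => ψ y k) V :=
  contDiffOn_euclidean.1 hψ k

theorem contDiffOn_jac (hV : IsOpen V) (hψ : ContDiffOn ℝ ∞ ψ V) (k i : Fin 2) :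
    ContDiffOn ℝ ∞ (jac ψ k i) V :=
  contDiffOn_dirDeriv (contDiffOn_coord hψ k) hV _

theorem fderiv_apply_coord (hψ : DifferentiableAt ℝ ψ z) (v : EuclideanSpace ℝ (Fin 2))
    (k : Fin 2) : (fderiv ℝ ψ z v) k = dirDeriv v (fun y => ψ y k) z := by
  have h : HasFDerivAt (fun y => ψ y k) ((EuclideanSpace.proj k).comp (fderiv ℝ ψ z)) z :=
    (EuclideanSpace.proj (𝕜 := ℝ) k).hasFDerivAt.comp z hψ.hasFDerivAt
  simp [dirDeriv, h.fderiv]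

theorem dirDeriv_comp {f : EuclideanSpace ℝ (Fin 2) → ℝ} (hψ : DifferentiableAt ℝ ψ z)
    (hf : DifferentiableAt ℝ f (ψ z)) (i : Fin 2) :
    dirDeriv (stdVec i) (fun y => f (ψ y)) z =
      dirDeriv (stdVec 0) f (ψ z) * jac ψ 0 i z + dirDeriv (stdVec 1) f (ψ z) * jac ψ 1 i z := by
  have h : fderiv ℝ (fun y => f (ψ y)) z = (fderiv ℝ f (ψ z)).comp (fderiv ℝ ψ z) :=
    fderiv_comp z hf hψ
  rw [dirDeriv, h, ContinuousLinearMap.comp_apply, eq_sum_stdVec (fderiv ℝ ψ z (stdVec i)),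
    map_add, map_smul, map_smul, fderiv_apply_coord hψ, fderiv_apply_coord hψ]
  simp [dirDeriv, jac]
  ring

/-- The exterior derivative commutes with pullback: the second derivatives of `ψ` cancel by
symmetry, and the remaining terms assemble into the Jacobian determinant. -/
theorem curl_pullForm (hU : IsOpen U) (hV : IsOpen V) (hψ : ContDiffOn ℝ ∞ ψ V)
    (hm : Set.MapsTo ψ V U) (hη : ∀ i, ContDiffOn ℝ ∞ (η i) U) (hz : z ∈ V) :
    curl stdVec (pullForm ψ η) z = curl stdVec η (ψ z) * frameDet (jac ψ) z := by
  have dψ := (hψ.contDiffAt (hV.mem_nhds hz)).differentiableAt (by simp)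
  have dη := fun k => differentiableAt_of_contDiffOn (hη k) hU (hm hz)
  have dJ := fun k i => differentiableAt_of_contDiffOn (contDiffOn_jac hV hψ k i) hV hz
  have dηψ : ∀ k, DifferentiableAt ℝ (fun y => η k (ψ y)) z := fun k => (dη k).comp z dψ
  have hs : ∀ k, dirDeriv (stdVec 0) (jac ψ k 1) z = dirDeriv (stdVec 1) (jac ψ k 0) z :=
    fun k => dirDeriv_comm (contDiffOn_coord hψ k) hV hz _ _
  have key : ∀ m i, dirDeriv (stdVec m) (pullForm ψ η i) z = _ := fun m i =>
    (dirDeriv_add ((dηψ 0).fun_mul (dJ 0 i)) ((dηψ 1).fun_mul (dJ 1 i))).trans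
      (congrArg₂ _ (dirDeriv_mul (dηψ 0) (dJ 0 i)) (dirDeriv_mul (dηψ 1) (dJ 1 i)))
  simp only [curl, key, dirDeriv_comp dψ (dη _), hs, frameDet]
  ring

theorem contDiffOn_pullForm (hV : IsOpen V) (hψ : ContDiffOn ℝ ∞ ψ V)
    (hm : Set.MapsTo ψ V U) (hη : ∀ i, ContDiffOn ℝ ∞ (η i) U) (i : Fin 2) :
    ContDiffOn ℝ ∞ (pullForm ψ η i) V :=
  (((hη 0).comp hψ hm).mul (contDiffOn_jac hV hψ 0 i)).add
    (((hη 1).comp hψ hm).mul (contDiffOn_jac hV hψ 1 i))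

theorem frameDet_pullForm :
    frameDet (fun k => pullForm ψ (e k)) z = frameDet e (ψ z) * frameDet (jac ψ) z := by
  simp only [frameDet, pullForm]; ring

/-- The connection form is natural because its numerator and denominator acquire the same Jacobian
factor; the same happens once more for `dω` over the determinant. The sign of the Jacobian cancels,
so no orientation is required. -/
theorem frameCurv_pullForm (hU : IsOpen U) (hV : IsOpen V) (hψ : ContDiffOn ℝ ∞ ψ V)
    (hm : Set.MapsTo ψ V U) (he : ∀ k i, ContDiffOn ℝ ∞ (e k i) U)
    (hd : ∀ z ∈ U, frameDet e z ≠ 0) (hJ : ∀ z ∈ V, frameDet (jac ψ) z ≠ 0) (hz : z ∈ V) :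
    frameCurv stdVec (fun k => pullForm ψ (e k)) z = frameCurv stdVec e (ψ z) := by
  have hω : ∀ i, Set.EqOn (frameConn stdVec (fun k => pullForm ψ (e k)) i)
      (pullForm ψ (frameConn stdVec e) i) V := by
    intro i y hy
    have h1 := hd _ (hm hy)
    have h2 := hJ _ hy
    simp only [frameConn, curl_pullForm hU hV hψ hm (he _) hy, frameDet_pullForm]
    simp only [pullForm, frameConn]
    field_simp
    ring
  rw [frameCurv, curl_congr hV hω hz, curl_pullForm hU hV hψ hm
    (contDiffOn_frameConn hU he hd) hz, frameDet_pullForm, frameCurv,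
    mul_div_mul_right _ _ (hJ z hz)]

/-- The scalar curvature is invariant under changes of coordinates. -/
theorem scalar_pullback {G G' : EuclideanSpace ℝ (Fin 2) → Matrix (Fin 2) (Fin 2) ℝ}
    (hU : IsOpen U) (hV : IsOpen V) (hψ : ContDiffOn ℝ ∞ ψ V)
    (hm : Set.MapsTo ψ V U) (he : ∀ k i, ContDiffOn ℝ ∞ (e k i) U)
    (hd : ∀ z ∈ U, frameDet e z ≠ 0) (hJ : ∀ z ∈ V, frameDet (jac ψ) z ≠ 0)
    (hG : ∀ z ∈ U, ∀ i j, G z i j = e 0 i z * e 0 j z + e 1 i z * e 1 j z)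
    (hG' : ∀ z ∈ V, ∀ i j, G' z i j = ∑ k, ∑ l, jac ψ k i z * G (ψ z) k l * jac ψ l j z)
    (hz : z ∈ V) : scalar G' z = scalar G (ψ z) := by
  rw [scalar_eq_frameCurv hU he hd hG (hm hz), ← frameCurv_pullForm hU hV hψ hm he hd hJ hz]
  -- The pulled-back coframe is orthonormal for `G'`, though in general no longer triangular.
  refine scalar_eq_frameCurv hV (fun k i => contDiffOn_pullForm hV hψ hm (he k) i) ?_ ?_ hz
  · intro y hy
    rw [frameDet_pullForm]
    exact mul_ne_zero (hd _ (hm hy)) (hJ _ hy)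
  · intro y hy i j
    simp only [hG' y hy, Fin.sum_univ_two, hG _ (hm hy), pullForm]
    ring

end Pullback

/-! ### First variation of the energy density of a triangular coframe -/

section Triangular

theorem frameDet_triangular {W : Type*} {e : Fin 2 → Fin 2 → W → ℝ} (h10 : ∀ z, e 1 0 z = 0)
    (z : W) : frameDet e z = e 0 0 z * e 1 1 z := by
  simp [frameDet, h10]

variable {W : Type*} [NormedAddCommGroup W] [NormedSpace ℝ W]

/-- First component, in a triangular coframe, of the gradient of the curvature. -/
def curvGradP (v : Fin 2 → W) (e : Fin 2 → Fin 2 → W → ℝ) (z : W) : ℝ :=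
  dirDeriv (v 0) (frameCurv v e) z / e 0 0 z

/-- Second component, in a triangular coframe, of the gradient of the curvature. -/
def curvGradQ (v : Fin 2 → W) (e : Fin 2 → Fin 2 → W → ℝ) (z : W) : ℝ :=
  (dirDeriv (v 1) (frameCurv v e) z - e 0 1 z * curvGradP v e z) / e 1 1 z

/-- The density of `∫ R² dV`. -/
def energyDensity (v : Fin 2 → W) (e : Fin 2 → Fin 2 → W → ℝ) (z : W) : ℝ :=
  4 * frameCurv v e z ^ 2 * frameDet e z

variable {V : Set W} {z : W} {v : Fin 2 → W} {e : Fin 2 → Fin 2 → W → ℝ}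

theorem contDiffOn_curvGradP (hV : IsOpen V) (he : ∀ k i, ContDiffOn ℝ ∞ (e k i) V)
    (hd : ∀ z ∈ V, frameDet e z ≠ 0) (ha : ∀ z ∈ V, e 0 0 z ≠ 0) :
    ContDiffOn ℝ ∞ (curvGradP v e) V :=
  (contDiffOn_dirDeriv (contDiffOn_frameCurv hV he hd) hV _).div (he 0 0) ha

theorem contDiffOn_curvGradQ (hV : IsOpen V) (he : ∀ k i, ContDiffOn ℝ ∞ (e k i) V)
    (hd : ∀ z ∈ V, frameDet e z ≠ 0) (ha : ∀ z ∈ V, e 0 0 z ≠ 0) (hc : ∀ z ∈ V, e 1 1 z ≠ 0) :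
    ContDiffOn ℝ ∞ (curvGradQ v e) V :=
  ((contDiffOn_dirDeriv (contDiffOn_frameCurv hV he hd) hV _).sub
    ((he 0 1).mul (contDiffOn_curvGradP hV he hd ha))).div (he 1 1) hc

theorem contDiffOn_energyDensity (hV : IsOpen V) (he : ∀ k i, ContDiffOn ℝ ∞ (e k i) V)
    (hd : ∀ z ∈ V, frameDet e z ≠ 0) :
    ContDiffOn ℝ ∞ (energyDensity v e) V :=
  (contDiffOn_const.mul ((contDiffOn_frameCurv hV he hd).pow 2)).mul (contDiffOn_frameDet he)

theorem dirDeriv_frameCurv_zero (ha : e 0 0 z ≠ 0) :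
    dirDeriv (v 0) (frameCurv v e) z = e 0 0 z * curvGradP v e z := by
  rw [curvGradP]; field_simp

theorem dirDeriv_frameCurv_one (hc : e 1 1 z ≠ 0) :
    dirDeriv (v 1) (frameCurv v e) z = e 0 1 z * curvGradP v e z + e 1 1 z * curvGradQ v e z := by
  rw [curvGradQ]; field_simp; ring

/-- The structure equation for the second form of a triangular coframe. -/
theorem frameConn_zero_mul (h10 : ∀ z, e 1 0 z = 0) (ha : e 0 0 z ≠ 0) (hc : e 1 1 z ≠ 0) :
    frameConn v e 0 z * e 1 1 z = dirDeriv (v 0) (e 0 1) z - dirDeriv (v 1) (e 0 0) z := by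
  simp only [frameConn, frameDet_triangular h10, h10, curl]
  field_simp
  ring

/-- The structure equation for the first form of a triangular coframe. -/
theorem mul_frameConn_one (h10 : ∀ z, e 1 0 z = 0) (ha : e 0 0 z ≠ 0) (hc : e 1 1 z ≠ 0) :
    e 0 0 z * frameConn v e 1 z = e 0 1 z * frameConn v e 0 z + dirDeriv (v 0) (e 1 1) z := by
  have h : e 1 0 = fun _ => 0 := funext h10
  simp only [frameConn, frameDet_triangular h10, h10, curl]
  rw [h, dirDeriv_const]
  field_simp
  ring

/-- The first variation of the energy density: a divergence plus the Euler-Lagrange expressions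
paired with the variation of the coframe. -/
theorem dirDeriv_energyDensity (hV : IsOpen V) (he : ∀ k i, ContDiffOn ℝ ∞ (e k i) V)
    (h10 : ∀ z, e 1 0 z = 0) (ha : ∀ z ∈ V, e 0 0 z ≠ 0) (hc : ∀ z ∈ V, e 1 1 z ≠ 0)
    (hz : z ∈ V) (τ : W) :
    dirDeriv τ (energyDensity v e) z =
      dirDeriv (v 0) (fun z => 8 * (frameCurv v e z * dirDeriv τ (frameConn v e 1) z
          + curvGradQ v e z * dirDeriv τ (e 0 1) z - curvGradP v e z * dirDeriv τ (e 1 1) z)) z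
      - dirDeriv (v 1) (fun z => 8 * (frameCurv v e z * dirDeriv τ (frameConn v e 0) z
          + curvGradQ v e z * dirDeriv τ (e 0 0) z)) z
      + 8 * (dirDeriv (v 1) (curvGradQ v e) z + frameConn v e 1 z * curvGradP v e z
          - frameCurv v e z ^ 2 / 2 * e 1 1 z) * dirDeriv τ (e 0 0) z
      - 8 * (dirDeriv (v 0) (curvGradQ v e) z + frameConn v e 0 z * curvGradP v e z)
          * dirDeriv τ (e 0 1) z
      + 8 * (dirDeriv (v 0) (curvGradP v e) z - frameConn v e 0 z * curvGradQ v e z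
          - frameCurv v e z ^ 2 / 2 * e 0 0 z) * dirDeriv τ (e 1 1) z := by
  have hd : ∀ z ∈ V, frameDet e z ≠ 0 := fun z hz => by
    rw [frameDet_triangular h10]; exact mul_ne_zero (ha z hz) (hc z hz)
  have sω := contDiffOn_frameConn (v := v) hV he hd
  have su := contDiffOn_frameCurv (v := v) hV he hd
  have sp := contDiffOn_curvGradP (v := v) hV he hd ha
  have sq := contDiffOn_curvGradQ (v := v) hV he hd ha hc
  have D : ∀ {f : W → ℝ}, ContDiffOn ℝ ∞ f V → DifferentiableAt ℝ f z :=
    fun hf => differentiableAt_of_contDiffOn hf hV hz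
  have DD : ∀ {f : W → ℝ} (w : W), ContDiffOn ℝ ∞ f V → DifferentiableAt ℝ (dirDeriv w f) z :=
    fun w hf => differentiableAt_of_contDiffOn (contDiffOn_dirDeriv hf hV w) hV hz
  -- Since `u · det e = dω`, the density is `4u dω`. This relation and the two structure equations
  -- are differentiated along `τ`; commuting `τ` past the space derivatives turns them into
  -- equations for the variations of `u` and `ω`.
  have hρ : Set.EqOn (energyDensity v e) (fun z => 4 * (frameCurv v e z *
      (dirDeriv (v 0) (frameConn v e 1) z - dirDeriv (v 1) (frameConn v e 0) z))) V := by
    intro y hy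
    have := hd y hy
    simp only [energyDensity, frameCurv, curl]
    field_simp
  have hS : Set.EqOn (fun z => frameCurv v e z * (e 0 0 z * e 1 1 z))
      (fun z => dirDeriv (v 0) (frameConn v e 1) z - dirDeriv (v 1) (frameConn v e 0) z) V := by
    intro y hy
    have := hd y hy
    rw [frameDet_triangular h10] at this
    simp only [frameCurv, curl, frameDet_triangular h10]
    rw [div_mul_cancel₀ _ this]
  have hP : Set.EqOn (fun z => frameConn v e 0 z * e 1 1 z)
      (fun z => dirDeriv (v 0) (e 0 1) z - dirDeriv (v 1) (e 0 0) z) V :=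
    fun y hy => frameConn_zero_mul h10 (ha y hy) (hc y hy)
  have hQ : Set.EqOn (fun z => e 0 0 z * frameConn v e 1 z)
      (fun z => e 0 1 z * frameConn v e 0 z + dirDeriv (v 0) (e 1 1) z) V :=
    fun y hy => mul_frameConn_one h10 (ha y hy) (hc y hy)
  have tρ := dirDeriv_congr (v := τ) hV hρ hz
  have tS := dirDeriv_congr (v := τ) hV hS hz
  have tP := dirDeriv_congr (v := τ) hV hP hz
  have tQ := dirDeriv_congr (v := τ) hV hQ hz
  have hSz := hS hz
  rw [dirDeriv_const_mul _ ((D su).fun_mul ((DD _ (sω 1)).fun_sub (DD _ (sω 0)))),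
    dirDeriv_mul (D su) ((DD _ (sω 1)).fun_sub (DD _ (sω 0))),
    dirDeriv_sub (DD _ (sω 1)) (DD _ (sω 0)), dirDeriv_comm (sω 1) hV hz τ,
    dirDeriv_comm (sω 0) hV hz τ] at tρ
  rw [dirDeriv_mul (D su) ((D (he 0 0)).fun_mul (D (he 1 1))), dirDeriv_mul (D (he 0 0))
    (D (he 1 1)), dirDeriv_sub (DD _ (sω 1)) (DD _ (sω 0)), dirDeriv_comm (sω 1) hV hz τ,
    dirDeriv_comm (sω 0) hV hz τ] at tS
  rw [dirDeriv_mul (D (sω 0)) (D (he 1 1)), dirDeriv_sub (DD _ (he 0 1)) (DD _ (he 0 0)),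
    dirDeriv_comm (he 0 1) hV hz τ, dirDeriv_comm (he 0 0) hV hz τ] at tP
  rw [dirDeriv_mul (D (he 0 0)) (D (sω 1)), dirDeriv_add ((D (he 0 1)).fun_mul (D (sω 0)))
    (DD _ (he 1 1)), dirDeriv_mul (D (he 0 1)) (D (sω 0)), dirDeriv_comm (he 1 1) hV hz τ] at tQ
  have X1 := (D su).fun_mul (DD τ (sω 1))
  have X2 := (D sq).fun_mul (DD τ (he 0 1))
  have X3 := (D sp).fun_mul (DD τ (he 1 1))
  have Y1 := (D su).fun_mul (DD τ (sω 0))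
  have Y2 := (D sq).fun_mul (DD τ (he 0 0))
  rw [dirDeriv_const_mul _ ((X1.fun_add X2).fun_sub X3), dirDeriv_sub (X1.fun_add X2) X3,
    dirDeriv_add X1 X2, dirDeriv_mul (D su) (DD τ (sω 1)), dirDeriv_mul (D sq) (DD τ (he 0 1)),
    dirDeriv_mul (D sp) (DD τ (he 1 1)), dirDeriv_const_mul _ (Y1.fun_add Y2),
    dirDeriv_add Y1 Y2, dirDeriv_mul (D su) (DD τ (sω 0)), dirDeriv_mul (D sq) (DD τ (he 0 0)),
    dirDeriv_frameCurv_zero (ha z hz), dirDeriv_frameCurv_one (hc z hz), tρ]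
  dsimp only at hSz
  -- `hSz` and `tS` eliminate the variation of `u`, giving `8u dω̇ - 4u² (det e)˙`. Moving `d` off
  -- `ω̇` leaves `-8 du ∧ ω̇`; with `du = p e⁰ + q e¹`, the combinations of `ω̇` that occur are
  -- exactly those expressed through `ė` by `tP` and `tQ`.
  linear_combination (-4 * dirDeriv τ (frameCurv v e) z) * hSz + 4 * frameCurv v e z * tS
    + 8 * curvGradQ v e z * tP - 8 * curvGradP v e z * tQ

end Triangular

/-! ### The Cholesky coframe of a family of positive definite matrices -/

/-- The triangular coframe of a metric. -/
def cholesky {W : Type*} (G : W → Matrix (Fin 2) (Fin 2) ℝ) (k i : Fin 2) (w : W) : ℝ :=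
  !![√(G w 0 0), G w 0 1 / √(G w 0 0); 0, √(G w).det / √(G w 0 0)] k i

section Cholesky

variable {W : Type*} {G : W → Matrix (Fin 2) (Fin 2) ℝ} {w : W}

theorem cholesky_one_zero (w : W) : cholesky G 1 0 w = 0 := rfl

theorem cholesky_zero_zero_pos (h0 : 0 < G w 0 0) : 0 < cholesky G 0 0 w :=
  Real.sqrt_pos.2 h0

theorem cholesky_one_one_pos (h0 : 0 < G w 0 0) (h1 : 0 < (G w).det) : 0 < cholesky G 1 1 w :=
  div_pos (Real.sqrt_pos.2 h1) (Real.sqrt_pos.2 h0)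

theorem frameDet_cholesky (h0 : 0 < G w 0 0) : frameDet (cholesky G) w = √(G w).det := by
  have := (Real.sqrt_pos.2 h0).ne'
  simp [frameDet, cholesky]
  field_simp

theorem cholesky_mul_self (hs : G w 1 0 = G w 0 1) (h0 : 0 < G w 0 0) (h1 : 0 < (G w).det)
    (i j : Fin 2) : G w i j =
      cholesky G 0 i w * cholesky G 0 j w + cholesky G 1 i w * cholesky G 1 j w := by
  have h := (Real.sqrt_pos.2 h0).ne'
  have h2 : √(G w 0 0) ^ 2 = G w 0 0 := Real.sq_sqrt h0.le
  have h3 : √(G w).det ^ 2 = (G w).det := Real.sq_sqrt h1.le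
  fin_cases i <;> fin_cases j <;> simp [cholesky, hs]
  · rw [← h2]
    simp only [Real.sqrt_sq_eq_abs, abs_of_nonneg (Real.sqrt_nonneg _)]
    ring
  · field_simp
  · field_simp
  · field_simp
    rw [h2, h3, Matrix.det_fin_two, hs]; ring

theorem contDiffOn_cholesky [NormedAddCommGroup W] [NormedSpace ℝ W] {V : Set W}
    (hG : ∀ i j, ContDiffOn ℝ ∞ (fun w => G w i j) V) (h0 : ∀ w ∈ V, 0 < G w 0 0)
    (h1 : ∀ w ∈ V, 0 < (G w).det) (k i : Fin 2) : ContDiffOn ℝ ∞ (cholesky G k i) V := by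
  have hd : ContDiffOn ℝ ∞ (fun w => (G w).det) V := by
    simp only [Matrix.det_fin_two]
    exact ((hG 0 0).mul (hG 1 1)).sub ((hG 0 1).mul (hG 1 0))
  have ha := (hG 0 0).sqrt fun w hw => (h0 w hw).ne'
  have hD := hd.sqrt fun w hw => (h1 w hw).ne'
  have ha0 : ∀ w ∈ V, √(G w 0 0) ≠ 0 := fun w hw => (Real.sqrt_pos.2 (h0 w hw)).ne'
  fin_cases k <;> fin_cases i
  · exact ha
  · exact (hG 0 1).div ha ha0
  · exact contDiffOn_const (c := (0 : ℝ))
  · exact hD.div ha ha0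

end Cholesky

/-! ### Restriction of functions of time and space to time slices -/

section Slices

theorem isOpen_slice {Y : Type*} [TopologicalSpace Y] {Ω : Set (ℝ × Y)}
    (hΩ : IsOpen Ω) (t : ℝ) : IsOpen {y | (t, y) ∈ Ω} :=
  hΩ.preimage (by fun_prop)

/-- A neighbourhood of a compact set in the time slice `0` contains a cylinder. -/
theorem exists_cylinder {Y : Type*} [TopologicalSpace Y] {Ω : Set (ℝ × Y)}
    (hΩ : IsOpen Ω) {K : Set Y} (hK : IsCompact K)
    (h : ∀ y ∈ K, ((0 : ℝ), y) ∈ Ω) : ∃ ε > 0, ∀ t ∈ Set.Icc (-ε) ε, ∀ y ∈ K, (t, y) ∈ Ω := by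
  obtain ⟨u, v, hu, hv, h0, hKv, huv⟩ := generalized_tube_lemma (isCompact_singleton (x := (0 : ℝ)))
    hK hΩ (fun w hw => by
      obtain ⟨h1, h2⟩ := hw
      rw [Set.mem_singleton_iff] at h1
      rw [← Prod.mk.eta (p := w), h1]
      exact h _ h2)
  obtain ⟨ε, hε, hb⟩ := Metric.nhds_basis_closedBall.mem_iff.1 (hu.mem_nhds (h0 rfl))
  refine ⟨ε, hε, fun t ht y hy => huv ⟨hb ?_, hKv hy⟩⟩
  rwa [Real.closedBall_eq_Icc, zero_sub, zero_add]

variable {Y : Type*} [NormedAddCommGroup Y] [NormedSpace ℝ Y] {Ω : Set (ℝ × Y)} {t : ℝ} {y : Y}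
  {F : ℝ × Y → ℝ} {v : Fin 2 → Y} {η : Fin 2 → ℝ × Y → ℝ} {e : Fin 2 → Fin 2 → ℝ × Y → ℝ}

/-- A vector of space as a vector of space-time. -/
def spaceVec (v : Fin 2 → Y) (i : Fin 2) : ℝ × Y := (0, v i)

theorem dirDeriv_slice (hF : DifferentiableAt ℝ F (t, y)) (v : Y) :
    dirDeriv v (fun y => F (t, y)) y = dirDeriv (0, v) F (t, y) := by
  have h : HasFDerivAt (fun y => F (t, y)) _ y :=
    hF.hasFDerivAt.comp y (hasFDerivAt_prodMk_right t y)
  simp [dirDeriv, h.fderiv]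

theorem hasDerivAt_slice (hF : DifferentiableAt ℝ F (t, y)) :
    HasDerivAt (fun s => F (s, y)) (dirDeriv (1, 0) F (t, y)) t := by
  have h : HasFDerivAt (fun s => F (s, y)) _ t :=
    hF.hasFDerivAt.comp t (hasFDerivAt_prodMk_left t y)
  simpa [dirDeriv] using h.hasDerivAt

theorem contDiffOn_slice (hF : ContDiffOn ℝ ∞ F Ω) (t : ℝ) :
    ContDiffOn ℝ ∞ (fun y => F (t, y)) {y | (t, y) ∈ Ω} :=
  hF.comp (contDiff_const.prodMk contDiff_id).contDiffOn fun _ h => h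

/-- Time is treated as one more coordinate, so that `dirDeriv_energyDensity` applies with `τ` the
time direction. This lemma and the next ones identify space-time quantities at fixed time with those
of the frozen coframe. -/
theorem curl_slice (hΩ : IsOpen Ω) (hη : ∀ i, ContDiffOn ℝ ∞ (η i) Ω) (h : (t, y) ∈ Ω) :
    curl v (fun i y => η i (t, y)) y = curl (spaceVec v) η (t, y) := by
  simp only [curl, spaceVec]
  rw [dirDeriv_slice (differentiableAt_of_contDiffOn (hη 1) hΩ h),
    dirDeriv_slice (differentiableAt_of_contDiffOn (hη 0) hΩ h)]

theorem frameConn_slice (hΩ : IsOpen Ω) (he : ∀ k i, ContDiffOn ℝ ∞ (e k i) Ω) (h : (t, y) ∈ Ω)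
    (i : Fin 2) :
    frameConn v (fun k i y => e k i (t, y)) i y = frameConn (spaceVec v) e i (t, y) := by
  simp only [frameConn, curl_slice hΩ (he _) h]
  rfl

theorem frameCurv_slice (hΩ : IsOpen Ω) (he : ∀ k i, ContDiffOn ℝ ∞ (e k i) Ω)
    (hd : ∀ z ∈ Ω, frameDet e z ≠ 0) (h : (t, y) ∈ Ω) :
    frameCurv v (fun k i y => e k i (t, y)) y = frameCurv (spaceVec v) e (t, y) := by
  have : curl v (frameConn v (fun k i y => e k i (t, y))) y =
      curl v (fun i y => frameConn (spaceVec v) e i (t, y)) y :=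
    curl_congr (isOpen_slice hΩ t) (fun i y hy => frameConn_slice hΩ he hy i) h
  rw [frameCurv, this, curl_slice hΩ (contDiffOn_frameConn hΩ he hd) h]
  rfl

theorem curvGradP_slice (hΩ : IsOpen Ω) (he : ∀ k i, ContDiffOn ℝ ∞ (e k i) Ω)
    (hd : ∀ z ∈ Ω, frameDet e z ≠ 0) (h : (t, y) ∈ Ω) :
    curvGradP v (fun k i y => e k i (t, y)) y = curvGradP (spaceVec v) e (t, y) := by
  rw [curvGradP, dirDeriv_congr (isOpen_slice hΩ t) (fun y hy => frameCurv_slice hΩ he hd hy) h,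
    dirDeriv_slice (differentiableAt_of_contDiffOn (contDiffOn_frameCurv hΩ he hd) hΩ h)]
  rfl

theorem curvGradQ_slice (hΩ : IsOpen Ω) (he : ∀ k i, ContDiffOn ℝ ∞ (e k i) Ω)
    (hd : ∀ z ∈ Ω, frameDet e z ≠ 0) (h : (t, y) ∈ Ω) :
    curvGradQ v (fun k i y => e k i (t, y)) y = curvGradQ (spaceVec v) e (t, y) := by
  rw [curvGradQ, dirDeriv_congr (isOpen_slice hΩ t) (fun y hy => frameCurv_slice hΩ he hd hy) h,
    dirDeriv_slice (differentiableAt_of_contDiffOn (contDiffOn_frameCurv hΩ he hd) hΩ h),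
    curvGradP_slice hΩ he hd h]
  rfl

/-- Differentiation under the integral sign: the time derivative is bounded on a compact cylinder
around `K`, which gives a constant dominating function. -/
theorem hasDerivAt_integral_slice [MeasurableSpace Y] [BorelSpace Y] [SecondCountableTopology Y]
    {μ : Measure Y} [IsFiniteMeasureOnCompacts μ] (hΩ : IsOpen Ω) (hF : ContDiffOn ℝ ∞ F Ω)
    {K : Set Y} (hK : IsCompact K) (h : ∀ y ∈ K, ((0 : ℝ), y) ∈ Ω) :
    HasDerivAt (fun t => ∫ y in K, F (t, y) ∂μ) (∫ y in K, dirDeriv (1, 0) F (0, y) ∂μ) 0 := by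
  obtain ⟨ε, hε, hcyl⟩ := exists_cylinder hΩ hK h
  have hcont : ∀ {F : ℝ × Y → ℝ} {t : ℝ}, ContDiffOn ℝ ∞ F Ω → t ∈ Set.Icc (-ε) ε →
      ContinuousOn (fun y => F (t, y)) K := fun hF ht =>
    hF.continuousOn.comp (by fun_prop) fun y hy => hcyl _ ht y hy
  have h0 : (0 : ℝ) ∈ Set.Icc (-ε) ε := ⟨by linarith, hε.le⟩
  have hF' := contDiffOn_dirDeriv hF hΩ (1, 0)
  obtain ⟨C, hC⟩ := ((isCompact_Icc (a := -ε) (b := ε)).prod hK).exists_bound_of_continuousOn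
    (hF'.continuousOn.mono fun w hw => hcyl w.1 hw.1 w.2 hw.2)
  refine (hasDerivAt_integral_of_dominated_loc_of_deriv_le (bound := fun _ => C)
    (s := Set.Icc (-ε) ε) (F' := fun t y => dirDeriv (1, 0) F (t, y))
    (Icc_mem_nhds (by linarith) hε) ?_ ?_ ?_ ?_ ?_ ?_).2
  · filter_upwards [Icc_mem_nhds (show -ε < 0 by linarith) hε] with t ht
    exact (hcont hF ht).aestronglyMeasurable_of_isCompact hK hK.measurableSet
  · exact (hcont hF h0).integrableOn_compact hK
  · exact (hcont hF' h0).aestronglyMeasurable_of_isCompact hK hK.measurableSet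
  · filter_upwards [ae_restrict_mem hK.measurableSet] with y hy t ht
    exact hC (t, y) ⟨ht, hy⟩
  · exact integrableOn_const hK.measure_lt_top.ne
  · filter_upwards [ae_restrict_mem hK.measurableSet] with y hy t ht
    exact hasDerivAt_slice (differentiableAt_of_contDiffOn hF hΩ (hcyl t ht y hy))

end Slices

/-! ### Integration by parts -/

section Parts

variable {Y : Type*} [NormedAddCommGroup Y] [NormedSpace ℝ Y] {U K : Set Y} {f : Y → ℝ}

/-- Extension by zero stays smooth because the open sets `U` and the complement of `K` cover the
space, and on the latter the extension is zero. -/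
theorem contDiff_indicator (hU : IsOpen U) (hf : ContDiffOn ℝ ∞ f U)
    (hK : IsClosed K) (hKU : K ⊆ U) (h0 : ∀ y ∈ U, y ∉ K → f y = 0) :
    ContDiff ℝ ∞ (U.indicator f) := by
  rw [contDiff_iff_contDiffAt]
  intro y
  by_cases hy : y ∈ K
  · refine (hf.contDiffAt (hU.mem_nhds (hKU hy))).congr_of_eventuallyEq ?_
    filter_upwards [hU.mem_nhds (hKU hy)] with x hx using Set.indicator_of_mem hx f
  · refine (contDiffAt_const (c := (0 : ℝ))).congr_of_eventuallyEq ?_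
    filter_upwards [hK.isOpen_compl.mem_nhds hy] with x hx
    by_cases hxU : x ∈ U
    · rw [Set.indicator_of_mem hxU, h0 x hxU hx]
    · exact Set.indicator_of_notMem hxU f

/-- The integral of a derivative of a compactly supported function vanishes. -/
theorem setIntegral_dirDeriv_eq_zero [MeasurableSpace Y] [BorelSpace Y] [FiniteDimensional ℝ Y]
    {μ : Measure Y} [μ.IsAddHaarMeasure] (hU : IsOpen U) (hf : ContDiffOn ℝ ∞ f U)
    (hK : IsCompact K) (hKU : K ⊆ U) (h0 : ∀ y ∈ U, y ∉ K → f y = 0) (v : Y) :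
    ∫ y in K, dirDeriv v f y ∂μ = 0 := by
  have hs := contDiff_indicator hU hf hK.isClosed hKU h0
  have hz : ∀ y ∉ K, U.indicator f y = 0 := fun y hy => by
    by_cases hyU : y ∈ U
    · rw [Set.indicator_of_mem hyU, h0 y hyU hy]
    · exact Set.indicator_of_notMem hyU f
  have hd0 : ∀ y ∉ K, dirDeriv v (U.indicator f) y = 0 := fun y hy =>
    (dirDeriv_congr (g := fun _ => 0) hK.isClosed.isOpen_compl (fun x hx => hz x hx) hy).trans
      (dirDeriv_const 0)
  have hcs : HasCompactSupport (U.indicator f) := HasCompactSupport.intro hK hz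
  have hcs' : HasCompactSupport (dirDeriv v (U.indicator f)) := HasCompactSupport.intro hK hd0
  have hd : Continuous (dirDeriv v (U.indicator f)) :=
    continuousOn_univ.1 (contDiffOn_dirDeriv (contDiffOn_univ.2 hs) isOpen_univ v).continuousOn
  have e1 : ∫ y in K, dirDeriv v f y ∂μ = ∫ y in K, dirDeriv v (U.indicator f) y ∂μ :=
    setIntegral_congr_fun hK.measurableSet fun y hy =>
      (dirDeriv_congr hU (fun x hx => (Set.indicator_of_mem hx f).symm) (hKU hy))
  rw [e1, setIntegral_eq_integral_of_forall_compl_eq_zero hd0]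
  have hdint : Integrable (dirDeriv v (U.indicator f)) μ := hd.integrable_of_hasCompactSupport hcs'
  -- Integration by parts against the constant function `1`.
  have := integral_mul_fderiv_eq_neg_fderiv_mul_of_integrable (μ := μ) (f := fun _ : Y => (1 : ℝ))
    (g := U.indicator f) (v := v) (by simp) (by simp only [one_mul]; exact hdint)
    (by simpa using hs.continuous.integrable_of_hasCompactSupport hcs)
    (fun x _ => differentiableAt_const _) (fun x _ => hs.differentiable (by simp) x)
  simpa [dirDeriv] using this

/-- A continuous function that is orthogonal to all test functions vanishes. -/
theorem eq_zero_of_setIntegral_mul_eq_zero [MeasurableSpace Y] [BorelSpace Y]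
    [FiniteDimensional ℝ Y] {μ : Measure Y} [μ.IsAddHaarMeasure] (hU : IsOpen U)
    (hf : ContinuousOn f U)
    (h : ∀ g : Y → ℝ, ContDiff ℝ ∞ g → ∀ K, IsCompact K → K ⊆ U → (∀ y ∉ K, g y = 0) →
      ∫ y in K, f y * g y ∂μ = 0) : ∀ y ∈ U, f y = 0 := by
  have hae : ∀ᵐ y ∂μ, y ∈ U → f y = 0 := by
    refine hU.ae_eq_zero_of_integral_contDiff_smul_eq_zero
      (hf.locallyIntegrableOn hU.measurableSet) fun g hg hc hs => ?_
    have := h g hg (tsupport g) hc hs fun y hy => image_eq_zero_of_notMem_tsupport hy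
    rw [setIntegral_eq_integral_of_forall_compl_eq_zero
      fun y hy => by simp [image_eq_zero_of_notMem_tsupport hy]] at this
    simpa [mul_comm] using this
  exact Measure.eqOn_open_of_ae_eq (g := fun _ => (0 : ℝ))
    ((ae_restrict_iff' hU.measurableSet).2 hae) hU hf continuousOn_const

end Parts

/-! ### The Euler-Lagrange equations on a plane domain -/

/-- The Euler-Lagrange equations of `∫ R² dV` in a triangular coframe: with `u` minus the Gauss
curvature, they say that the Hessian of `u` is `u² / 2` times the metric. -/
structure EulerLagrange {W : Type*} [NormedAddCommGroup W] [NormedSpace ℝ W] (v : Fin 2 → W)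
    (e : Fin 2 → Fin 2 → W → ℝ) (z : W) : Prop where
  q_one : dirDeriv (v 1) (curvGradQ v e) z + frameConn v e 1 z * curvGradP v e z
    - frameCurv v e z ^ 2 / 2 * e 1 1 z = 0
  q_zero : dirDeriv (v 0) (curvGradQ v e) z + frameConn v e 0 z * curvGradP v e z = 0
  p_zero : dirDeriv (v 0) (curvGradP v e) z - frameConn v e 0 z * curvGradQ v e z
    - frameCurv v e z ^ 2 / 2 * e 0 0 z = 0

/-- A metric on the plane domain `U` is critical for `∫ R² dV` under compactly supported
variations. -/
def PlaneCritical (U : Set (EuclideanSpace ℝ (Fin 2)))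
    (G : EuclideanSpace ℝ (Fin 2) → Matrix (Fin 2) (Fin 2) ℝ) : Prop :=
  ∀ H : EuclideanSpace ℝ (Fin 2) → Matrix (Fin 2) (Fin 2) ℝ,
    (∀ i j, ContDiffOn ℝ ∞ (fun z => H z i j) U) → (∀ z i j, H z i j = H z j i) →
    ∀ K, IsCompact K → K ⊆ U → (∀ z ∉ K, H z = 0) →
    HasDerivAt (fun t : ℝ => ∫ y in K,
      scalar (fun z => G z + t • H z) y ^ 2 * √(G y + t • H y).det) 0 0

section Plane

variable {U : Set (EuclideanSpace ℝ (Fin 2))}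
  {G H : EuclideanSpace ℝ (Fin 2) → Matrix (Fin 2) (Fin 2) ℝ}

/-- The linear variation of a metric, as a function of time and space. -/
def linearVariation (G H : EuclideanSpace ℝ (Fin 2) → Matrix (Fin 2) (Fin 2) ℝ)
    (w : ℝ × EuclideanSpace ℝ (Fin 2)) : Matrix (Fin 2) (Fin 2) ℝ :=
  G w.2 + w.1 • H w.2

/-- The set of times and points where the linear variation is positive definite. -/
def positiveSet (U : Set (EuclideanSpace ℝ (Fin 2)))
    (G H : EuclideanSpace ℝ (Fin 2) → Matrix (Fin 2) (Fin 2) ℝ) :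
    Set (ℝ × EuclideanSpace ℝ (Fin 2)) :=
  {w | w.2 ∈ U ∧ 0 < linearVariation G H w 0 0 ∧ 0 < (linearVariation G H w).det}

theorem contDiffOn_linearVariation (hG : ∀ i j, ContDiffOn ℝ ∞ (fun z => G z i j) U)
    (hH : ∀ i j, ContDiffOn ℝ ∞ (fun z => H z i j) U) (i j : Fin 2) :
    ContDiffOn ℝ ∞ (fun w => linearVariation G H w i j) {w | w.2 ∈ U} := by
  have h1 : ContDiffOn ℝ ∞ (fun w : ℝ × EuclideanSpace ℝ (Fin 2) => G w.2 i j) {w | w.2 ∈ U} :=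
    (hG i j).comp contDiff_snd.contDiffOn fun _ h => h
  have h2 : ContDiffOn ℝ ∞ (fun w : ℝ × EuclideanSpace ℝ (Fin 2) => H w.2 i j) {w | w.2 ∈ U} :=
    (hH i j).comp contDiff_snd.contDiffOn fun _ h => h
  exact h1.add (contDiff_fst.contDiffOn.mul h2)

theorem isOpen_positiveSet (hU : IsOpen U) (hG : ∀ i j, ContDiffOn ℝ ∞ (fun z => G z i j) U)
    (hH : ∀ i j, ContDiffOn ℝ ∞ (fun z => H z i j) U) : IsOpen (positiveSet U G H) := by
  have hL := contDiffOn_linearVariation hG hH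
  have ho : IsOpen {w : ℝ × EuclideanSpace ℝ (Fin 2) | w.2 ∈ U} := hU.preimage continuous_snd
  have hd : ContinuousOn (fun w => (linearVariation G H w).det) {w | w.2 ∈ U} := by
    simp only [Matrix.det_fin_two]
    exact (((hL 0 0).mul (hL 1 1)).sub ((hL 0 1).mul (hL 1 0))).continuousOn
  have h := ((hL 0 0).continuousOn.prodMk hd).isOpen_inter_preimage ho
    ((isOpen_Ioi (a := (0 : ℝ))).prod (isOpen_Ioi (a := (0 : ℝ))))
  exact h

theorem mem_positiveSet_zero {y : EuclideanSpace ℝ (Fin 2)} (hy : y ∈ U) (h0 : 0 < G y 0 0)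
    (h1 : 0 < (G y).det) : ((0 : ℝ), y) ∈ positiveSet U G H := by
  simp [positiveSet, linearVariation, hy, h0, h1]

/-- The density of the energy of the varied metric. -/
theorem energyDensity_linearVariation (hU : IsOpen U)
    (hG : ∀ i j, ContDiffOn ℝ ∞ (fun z => G z i j) U) (hGs : ∀ z ∈ U, ∀ i j, G z i j = G z j i)
    (hH : ∀ i j, ContDiffOn ℝ ∞ (fun z => H z i j) U) (hHs : ∀ z i j, H z i j = H z j i)
    {t : ℝ} {y : EuclideanSpace ℝ (Fin 2)} (hw : (t, y) ∈ positiveSet U G H) :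
    scalar (fun z => G z + t • H z) y ^ 2 * √(G y + t • H y).det =
      energyDensity (spaceVec stdVec) (cholesky (linearVariation G H)) (t, y) := by
  have hΩ := isOpen_positiveSet hU hG hH
  have he : ∀ k i, ContDiffOn ℝ ∞ (cholesky (linearVariation G H) k i) (positiveSet U G H) :=
    contDiffOn_cholesky (fun i j => (contDiffOn_linearVariation hG hH i j).mono fun w hw => hw.1)
      (fun w hw => hw.2.1) (fun w hw => hw.2.2)
  have hd : ∀ w ∈ positiveSet U G H, frameDet (cholesky (linearVariation G H)) w ≠ 0 := by
    intro w hw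
    rw [frameDet_cholesky hw.2.1]
    exact (Real.sqrt_pos.2 hw.2.2).ne'
  have hs := scalar_eq_frameCurv (G := fun z => G z + t • H z)
    (e := fun k i y => cholesky (linearVariation G H) k i (t, y))
    (isOpen_slice hΩ t) (fun k i => contDiffOn_slice (he k i) t)
    (fun z hz => hd (t, z) hz) (fun z hz i j => cholesky_mul_self (G := linearVariation G H)
      (w := (t, z)) (by simp [linearVariation, hGs z hz.1 1 0, hHs z 1 0]) hz.2.1 hz.2.2 i j) hw
  rw [hs, frameCurv_slice hΩ he hd hw, energyDensity, frameDet_cholesky hw.2.1]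
  simp only [linearVariation]
  ring

theorem dirDeriv_time_linearVariation (hU : IsOpen U)
    (hG : ∀ i j, ContDiffOn ℝ ∞ (fun z => G z i j) U)
    (hH : ∀ i j, ContDiffOn ℝ ∞ (fun z => H z i j) U)
    {t : ℝ} {y : EuclideanSpace ℝ (Fin 2)} (hy : y ∈ U) (i j : Fin 2) :
    dirDeriv (1, 0) (fun w => linearVariation G H w i j) (t, y) = H y i j := by
  have hd := hasDerivAt_slice (differentiableAt_of_contDiffOn (contDiffOn_linearVariation hG hH i j)
    (hU.preimage continuous_snd) (z := (t, y)) hy)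
  refine hd.unique ?_
  simpa [linearVariation] using ((hasDerivAt_id t).mul_const (H y i j)).const_add (G y i j)

/-- The variation of the metric that induces a given variation of its triangular coframe. -/
def frameVariation (G : EuclideanSpace ℝ (Fin 2) → Matrix (Fin 2) (Fin 2) ℝ)
    (f : Fin 3 → EuclideanSpace ℝ (Fin 2) → ℝ) (y : EuclideanSpace ℝ (Fin 2)) :
    Matrix (Fin 2) (Fin 2) ℝ :=
  !![2 * cholesky G 0 0 y * f 0 y, cholesky G 0 1 y * f 0 y + cholesky G 0 0 y * f 1 y;
    cholesky G 0 1 y * f 0 y + cholesky G 0 0 y * f 1 y,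
    2 * cholesky G 0 1 y * f 1 y + 2 * cholesky G 1 1 y * f 2 y]

/-- Differentiating `G + tH = eᵀe` at time zero gives a system that is solved entry by entry, since
the lower left entry of `e` stays zero. `frameVariation` is the right-hand side whose solution is
`f`, so every infinitesimal triangular variation is realized by a linear variation of the metric. -/
theorem dirDeriv_time_cholesky (hU : IsOpen U)
    (hG : ∀ i j, ContDiffOn ℝ ∞ (fun z => G z i j) U) (hGs : ∀ z ∈ U, ∀ i j, G z i j = G z j i)
    (hG0 : ∀ z ∈ U, 0 < G z 0 0) (hG1 : ∀ z ∈ U, 0 < (G z).det)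
    {f : Fin 3 → EuclideanSpace ℝ (Fin 2) → ℝ}
    (hH : ∀ i j, ContDiffOn ℝ ∞ (fun z => frameVariation G f z i j) U)
    {y : EuclideanSpace ℝ (Fin 2)} (hy : y ∈ U) :
    dirDeriv (1, 0) (cholesky (linearVariation G (frameVariation G f)) 0 0) (0, y) = f 0 y ∧
    dirDeriv (1, 0) (cholesky (linearVariation G (frameVariation G f)) 0 1) (0, y) = f 1 y ∧
    dirDeriv (1, 0) (cholesky (linearVariation G (frameVariation G f)) 1 1) (0, y) = f 2 y := by
  set H := frameVariation G f with hHdef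
  set e := cholesky (linearVariation G H) with hedef
  have hΩ := isOpen_positiveSet hU hG hH
  have he : ∀ k i, ContDiffOn ℝ ∞ (e k i) (positiveSet U G H) :=
    contDiffOn_cholesky (fun i j => (contDiffOn_linearVariation hG hH i j).mono fun w hw => hw.1)
      (fun w hw => hw.2.1) (fun w hw => hw.2.2)
  have hw : ((0 : ℝ), y) ∈ positiveSet U G H := mem_positiveSet_zero hy (hG0 y hy) (hG1 y hy)
  have D : ∀ k i, DifferentiableAt ℝ (e k i) (0, y) :=
    fun k i => differentiableAt_of_contDiffOn (he k i) hΩ hw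
  have key : ∀ i j, H y i j = dirDeriv (1, 0) (e 0 i) (0, y) * e 0 j (0, y)
      + e 0 i (0, y) * dirDeriv (1, 0) (e 0 j) (0, y)
      + (dirDeriv (1, 0) (e 1 i) (0, y) * e 1 j (0, y)
      + e 1 i (0, y) * dirDeriv (1, 0) (e 1 j) (0, y)) := by
    intro i j
    rw [← dirDeriv_time_linearVariation hU hG hH (t := 0) hy i j, dirDeriv_congr hΩ
      (fun w hw => cholesky_mul_self (G := linearVariation G H)
        (by simp [linearVariation, hGs _ hw.1 1 0]; left; rfl) hw.2.1 hw.2.2 i j) hw]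
    rw [← hedef, dirDeriv_add ((D 0 i).fun_mul (D 0 j)) ((D 1 i).fun_mul (D 1 j)),
      dirDeriv_mul (D 0 i) (D 0 j), dirDeriv_mul (D 1 i) (D 1 j)]
  have h0 : ∀ k i, e k i (0, y) = cholesky G k i y := by
    intro k i
    simp [hedef, cholesky, linearVariation]
  have hz : dirDeriv (1, 0) (e 1 0) (0, y) = 0 := dirDeriv_const 0
  have ha := (cholesky_zero_zero_pos (hG0 y hy)).ne'
  have hc := (cholesky_one_one_pos (hG0 y hy) (hG1 y hy)).ne'
  have k00 := key 0 0
  have k01 := key 0 1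
  have k11 := key 1 1
  simp only [h0, hz, cholesky_one_zero] at k00 k01 k11
  simp only [hHdef, frameVariation, Matrix.of_apply, Matrix.cons_val', Matrix.cons_val_zero,
    Matrix.cons_val_one, Matrix.cons_val_fin_one] at k00 k01 k11
  have r0 : dirDeriv (1, 0) (e 0 0) (0, y) = f 0 y :=
    mul_left_cancel₀ ha (by linear_combination (-1 / 2) * k00)
  rw [r0] at k01
  have r1 : dirDeriv (1, 0) (e 0 1) (0, y) = f 1 y :=
    mul_left_cancel₀ ha (by linear_combination -k01)
  rw [r1] at k11
  exact ⟨r0, r1, mul_left_cancel₀ hc (by linear_combination (-1 / 2) * k11)⟩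

/-- Outside the support of the variation the connection form does not change. -/
theorem frameConn_linearVariation_of_notMem (hU : IsOpen U)
    (hG : ∀ i j, ContDiffOn ℝ ∞ (fun z => G z i j) U)
    (hG0 : ∀ z ∈ U, 0 < G z 0 0) (hG1 : ∀ z ∈ U, 0 < (G z).det)
    (hH : ∀ i j, ContDiffOn ℝ ∞ (fun z => H z i j) U) {K : Set (EuclideanSpace ℝ (Fin 2))}
    (hK : IsClosed K) (hHK : ∀ z ∉ K, H z = 0)
    {y : EuclideanSpace ℝ (Fin 2)} (hy : y ∈ U) (hyK : y ∉ K) (i : Fin 2) :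
    dirDeriv (1, 0) (frameConn (spaceVec stdVec) (cholesky (linearVariation G H)) i) (0, y) = 0 := by
  have hΩ := isOpen_positiveSet hU hG hH
  have he : ∀ k i, ContDiffOn ℝ ∞ (cholesky (linearVariation G H) k i) (positiveSet U G H) :=
    contDiffOn_cholesky (fun i j => (contDiffOn_linearVariation hG hH i j).mono fun w hw => hw.1)
      (fun w hw => hw.2.1) (fun w hw => hw.2.2)
  have hd : ∀ w ∈ positiveSet U G H, frameDet (cholesky (linearVariation G H)) w ≠ 0 := by
    intro w hw
    rw [frameDet_cholesky hw.2.1]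
    exact (Real.sqrt_pos.2 hw.2.2).ne'
  have hlin : ∀ t, ∀ x ∉ K, linearVariation G H (t, x) = G x := by
    intro t x hx
    simp [linearVariation, hHK x hx]
  have hmem : ∀ t : ℝ, ∀ x ∈ U \ K, (t, x) ∈ positiveSet U G H := by
    intro t x hx
    refine ⟨hx.1, ?_, ?_⟩
    · rw [hlin t x hx.2]; exact hG0 x hx.1
    · rw [hlin t x hx.2]; exact hG1 x hx.1
  have ho : IsOpen (U \ K) := hU.sdiff hK
  have hyd : y ∈ U \ K := ⟨hy, hyK⟩
  have hconst : ∀ t, frameConn (spaceVec stdVec) (cholesky (linearVariation G H)) i (t, y)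
      = frameConn stdVec (cholesky G) i y := by
    intro t
    have hch : ∀ k i, Set.EqOn (fun y => cholesky (linearVariation G H) k i (t, y))
        (cholesky G k i) (U \ K) := by
      intro k i x hx
      simp only [cholesky, hlin t x hx.2]
    rw [← frameConn_slice hΩ he (hmem t y hyd)]
    simp only [frameConn, frameDet]
    have hc := fun k => curl_congr (v := stdVec) ho (hch k) hyd
    rw [hc 0, hc 1]
    simp only [hch _ _ hyd]
  refine (hasDerivAt_slice (differentiableAt_of_contDiffOn
    (contDiffOn_frameConn hΩ he hd i) hΩ (hmem 0 y hyd))).unique ?_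
  simp only [hconst]
  exact hasDerivAt_const _ _

theorem contDiffOn_frameVariation (hG : ∀ i j, ContDiffOn ℝ ∞ (fun z => G z i j) U)
    (hG0 : ∀ z ∈ U, 0 < G z 0 0) (hG1 : ∀ z ∈ U, 0 < (G z).det)
    {f : Fin 3 → EuclideanSpace ℝ (Fin 2) → ℝ} (hf : ∀ i, ContDiff ℝ ∞ (f i)) (i j : Fin 2) :
    ContDiffOn ℝ ∞ (fun z => frameVariation G f z i j) U := by
  have hc := contDiffOn_cholesky hG hG0 hG1
  have hf' := fun i => (hf i).contDiffOn (s := U)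
  have h01 := ((hc 0 1).mul (hf' 0)).add ((hc 0 0).mul (hf' 1))
  fin_cases i <;> fin_cases j
  · exact (contDiffOn_const.mul (hc 0 0)).mul (hf' 0)
  · exact h01
  · exact h01
  · exact ((contDiffOn_const.mul (hc 0 1)).mul (hf' 1)).add
      ((contDiffOn_const.mul (hc 1 1)).mul (hf' 2))

end Plane

/-! ### The first variation formula and the Euler-Lagrange equations -/

section Plane

variable {U : Set (EuclideanSpace ℝ (Fin 2))}
  {G H : EuclideanSpace ℝ (Fin 2) → Matrix (Fin 2) (Fin 2) ℝ}

/-- The first variation formula: the Euler-Lagrange expressions of a critical metric are orthogonal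
to all compactly supported variations of its triangular coframe. -/
theorem setIntegral_eulerLagrange_eq_zero (hU : IsOpen U)
    (hG : ∀ i j, ContDiffOn ℝ ∞ (fun z => G z i j) U) (hGs : ∀ z ∈ U, ∀ i j, G z i j = G z j i)
    (hG0 : ∀ z ∈ U, 0 < G z 0 0) (hG1 : ∀ z ∈ U, 0 < (G z).det) (hcrit : PlaneCritical U G)
    {f : Fin 3 → EuclideanSpace ℝ (Fin 2) → ℝ} (hf : ∀ i, ContDiff ℝ ∞ (f i))
    {K : Set (EuclideanSpace ℝ (Fin 2))} (hK : IsCompact K) (hKU : K ⊆ U)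
    (hfK : ∀ i, ∀ y ∉ K, f i y = 0) :
    ∫ y in K,
      (8 * (dirDeriv (stdVec 1) (curvGradQ stdVec (cholesky G)) y
          + frameConn stdVec (cholesky G) 1 y * curvGradP stdVec (cholesky G) y
          - frameCurv stdVec (cholesky G) y ^ 2 / 2 * cholesky G 1 1 y) * f 0 y
      - 8 * (dirDeriv (stdVec 0) (curvGradQ stdVec (cholesky G)) y
          + frameConn stdVec (cholesky G) 0 y * curvGradP stdVec (cholesky G) y) * f 1 y
      + 8 * (dirDeriv (stdVec 0) (curvGradP stdVec (cholesky G)) y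
          - frameConn stdVec (cholesky G) 0 y * curvGradQ stdVec (cholesky G) y
          - frameCurv stdVec (cholesky G) y ^ 2 / 2 * cholesky G 0 0 y) * f 2 y) = 0 := by
  set H := frameVariation G f with hHdef
  have hH : ∀ i j, ContDiffOn ℝ ∞ (fun z => H z i j) U := contDiffOn_frameVariation hG hG0 hG1 hf
  have hHs : ∀ z i j, H z i j = H z j i := by
    intro z i j
    fin_cases i <;> fin_cases j <;> rfl
  have hHK : ∀ z ∉ K, H z = 0 := by
    intro z hz
    ext i j
    fin_cases i <;> fin_cases j <;> simp [hHdef, frameVariation, hfK _ z hz]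
  set e := cholesky (linearVariation G H) with hedef
  set Ω := positiveSet U G H with hΩdef
  have hΩ : IsOpen Ω := isOpen_positiveSet hU hG hH
  have he : ∀ k i, ContDiffOn ℝ ∞ (e k i) Ω :=
    contDiffOn_cholesky (fun i j => (contDiffOn_linearVariation hG hH i j).mono fun w hw => hw.1)
      (fun w hw => hw.2.1) (fun w hw => hw.2.2)
  have ha : ∀ w ∈ Ω, e 0 0 w ≠ 0 := fun w hw => (cholesky_zero_zero_pos hw.2.1).ne'
  have hc : ∀ w ∈ Ω, e 1 1 w ≠ 0 := fun w hw => (cholesky_one_one_pos hw.2.1 hw.2.2).ne'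
  have hd : ∀ w ∈ Ω, frameDet e w ≠ 0 := by
    intro w hw
    rw [hedef, frameDet_cholesky hw.2.1]
    exact (Real.sqrt_pos.2 hw.2.2).ne'
  have hmem : ∀ y ∈ U, ((0 : ℝ), y) ∈ Ω :=
    fun y hy => mem_positiveSet_zero hy (hG0 y hy) (hG1 y hy)
  have hρ := contDiffOn_energyDensity (v := spaceVec stdVec) hΩ he hd
  have hder := hasDerivAt_integral_slice (μ := volume) hΩ hρ hK fun y hy => hmem y (hKU hy)
  obtain ⟨ε, hε, hcyl⟩ := exists_cylinder hΩ hK fun y hy => hmem y (hKU hy)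
  have hder0 : HasDerivAt (fun t => ∫ y in K, energyDensity (spaceVec stdVec) e (t, y)) 0 0 := by
    refine (hcrit H hH hHs K hK hKU hHK).congr_of_eventuallyEq ?_
    filter_upwards [Icc_mem_nhds (show -ε < 0 by linarith) hε] with t ht
    exact setIntegral_congr_fun hK.measurableSet fun y hy =>
      (energyDensity_linearVariation hU hG hGs hH hHs (hcyl t ht y hy)).symm
  -- The same integral has been differentiated twice: under the integral sign, and by criticality.
  have hzero : ∫ y in K, dirDeriv (1, 0) (energyDensity (spaceVec stdVec) e) (0, y) = 0 :=
    hder.unique hder0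
  have hT := fun y (hy : y ∈ U) => dirDeriv_time_cholesky hU hG hGs hG0 hG1 hH hy
  rw [← hHdef, ← hedef] at hT
  have hslice : (fun k i y => e k i ((0 : ℝ), y)) = cholesky G := by
    funext k i y
    simp [hedef, cholesky, linearVariation]
  have sω := contDiffOn_frameConn (v := spaceVec stdVec) hΩ he hd
  have su := contDiffOn_frameCurv (v := spaceVec stdVec) hΩ he hd
  have sp := contDiffOn_curvGradP (v := spaceVec stdVec) hΩ he hd ha
  have sq := contDiffOn_curvGradQ (v := spaceVec stdVec) hΩ he hd ha hc
  set A : ℝ × EuclideanSpace ℝ (Fin 2) → ℝ := fun z =>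
    8 * (frameCurv (spaceVec stdVec) e z * dirDeriv (1, 0) (frameConn (spaceVec stdVec) e 1) z
      + curvGradQ (spaceVec stdVec) e z * dirDeriv (1, 0) (e 0 1) z
      - curvGradP (spaceVec stdVec) e z * dirDeriv (1, 0) (e 1 1) z) with hA
  set B : ℝ × EuclideanSpace ℝ (Fin 2) → ℝ := fun z =>
    8 * (frameCurv (spaceVec stdVec) e z * dirDeriv (1, 0) (frameConn (spaceVec stdVec) e 0) z
      + curvGradQ (spaceVec stdVec) e z * dirDeriv (1, 0) (e 0 0) z) with hB
  have sA : ContDiffOn ℝ ∞ A Ω := contDiffOn_const.mul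
    (((su.mul (contDiffOn_dirDeriv (sω 1) hΩ _)).add
      (sq.mul (contDiffOn_dirDeriv (he 0 1) hΩ _))).sub
      (sp.mul (contDiffOn_dirDeriv (he 1 1) hΩ _)))
  have sB : ContDiffOn ℝ ∞ B Ω := contDiffOn_const.mul
    ((su.mul (contDiffOn_dirDeriv (sω 0) hΩ _)).add (sq.mul (contDiffOn_dirDeriv (he 0 0) hΩ _)))
  have sA0 : ContDiffOn ℝ ∞ (fun y => A (0, y)) U := (contDiffOn_slice sA 0).mono hmem
  have sB0 : ContDiffOn ℝ ∞ (fun y => B (0, y)) U := (contDiffOn_slice sB 0).mono hmem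
  -- The divergence terms involve `ω̇`, which depends on derivatives of the variation. It too
  -- vanishes off `K`, so `A` and `B` are supported in `K` and their divergences integrate to zero.
  have hω0 := fun y (hy : y ∈ U) (hyK : y ∉ K) (i : Fin 2) =>
    frameConn_linearVariation_of_notMem hU hG hG0 hG1 hH hK.isClosed hHK hy hyK i
  rw [← hedef] at hω0
  have A0 : ∀ y ∈ U, y ∉ K → A (0, y) = 0 := by
    intro y hy hyK
    simp [hA, (hT y hy).2.1, (hT y hy).2.2, hω0 y hy hyK, hfK _ y hyK]
  have B0 : ∀ y ∈ U, y ∉ K → B (0, y) = 0 := by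
    intro y hy hyK
    simp [hB, (hT y hy).1, hω0 y hy hyK, hfK _ y hyK]
  have iA := setIntegral_dirDeriv_eq_zero (μ := volume) hU sA0 hK hKU A0 (stdVec 0)
  have iB := setIntegral_dirDeriv_eq_zero (μ := volume) hU sB0 hK hKU B0 (stdVec 1)
  have cont : ∀ {g : EuclideanSpace ℝ (Fin 2) → ℝ}, ContDiffOn ℝ ∞ g U → IntegrableOn g K :=
    fun hg => (hg.continuousOn.mono hKU).integrableOn_compact hK
  have IA := cont (contDiffOn_dirDeriv sA0 hU (stdVec 0))
  have IB := cont (contDiffOn_dirDeriv sB0 hU (stdVec 1))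
  have IT := cont ((contDiffOn_slice (contDiffOn_dirDeriv hρ hΩ (1, 0)) 0).mono hmem)
  have hQ : Set.EqOn (curvGradQ stdVec (cholesky G))
      (fun y => curvGradQ (spaceVec stdVec) e (0, y)) U := fun y hy => by
    rw [← hslice]; exact curvGradQ_slice hΩ he hd (hmem y hy)
  have hP : Set.EqOn (curvGradP stdVec (cholesky G))
      (fun y => curvGradP (spaceVec stdVec) e (0, y)) U := fun y hy => by
    rw [← hslice]; exact curvGradP_slice hΩ he hd (hmem y hy)
  have hsum : ∫ y in K, (dirDeriv (1, 0) (energyDensity (spaceVec stdVec) e) (0, y)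
      - dirDeriv (stdVec 0) (fun y => A (0, y)) y
      + dirDeriv (stdVec 1) (fun y => B (0, y)) y) = 0 := by
    have h1 := integral_sub IT IA
    have h2 := integral_add (IT.sub IA) IB
    rw [hzero, iA, sub_zero] at h1
    simp only [Pi.sub_apply] at h2
    rw [h2, h1, iB, add_zero]
  rw [← hsum]
  refine setIntegral_congr_fun hK.measurableSet fun y hyK => ?_
  have hy := hKU hyK
  have hw := hmem y hy
  have D : ∀ {F : ℝ × EuclideanSpace ℝ (Fin 2) → ℝ}, ContDiffOn ℝ ∞ F Ω →
    DifferentiableAt ℝ F (0, y) := fun hF => differentiableAt_of_contDiffOn hF hΩ hw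
  have hcong : ∀ k i, cholesky G k i y = e k i (0, y) := fun k i => by rw [← hslice]
  have hω : ∀ i, frameConn stdVec (cholesky G) i y = frameConn (spaceVec stdVec) e i (0, y) :=
    fun i => by rw [← hslice]; exact frameConn_slice hΩ he hw i
  have hu : frameCurv stdVec (cholesky G) y = frameCurv (spaceVec stdVec) e (0, y) := by
    rw [← hslice]; exact frameCurv_slice hΩ he hd hw
  have key := dirDeriv_energyDensity (v := spaceVec stdVec) hΩ he
    (fun w => cholesky_one_zero w) ha hc hw (1, 0)
  rw [(hT y hy).1, (hT y hy).2.1, (hT y hy).2.2] at key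
  rw [key, dirDeriv_slice (D sA), dirDeriv_slice (D sB)]
  change _ = dirDeriv (0, stdVec 0) A (0, y) - dirDeriv (0, stdVec 1) B (0, y)
    + 8 * (dirDeriv (0, stdVec 1) _ (0, y) + _ - _) * f 0 y
    - 8 * (dirDeriv (0, stdVec 0) _ (0, y) + _) * f 1 y
    + 8 * (dirDeriv (0, stdVec 0) _ (0, y) - _ - _) * f 2 y - _ + _
  rw [← dirDeriv_slice (D sp), ← dirDeriv_slice (D sq), ← dirDeriv_slice (D sq),
    ← dirDeriv_congr hU hQ hy, ← dirDeriv_congr hU hQ hy, ← dirDeriv_congr hU hP hy,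
    ← hω 0, ← hω 1, ← hu, ← hcong, ← hcong,
    show curvGradQ (spaceVec stdVec) e (0, y) = _ from (hQ hy).symm,
    show curvGradP (spaceVec stdVec) e (0, y) = _ from (hP hy).symm]
  ring

/-- A critical metric on a plane domain satisfies the Euler-Lagrange equations. -/
theorem eulerLagrange_of_planeCritical (hU : IsOpen U)
    (hG : ∀ i j, ContDiffOn ℝ ∞ (fun z => G z i j) U) (hGs : ∀ z ∈ U, ∀ i j, G z i j = G z j i)
    (hG0 : ∀ z ∈ U, 0 < G z 0 0) (hG1 : ∀ z ∈ U, 0 < (G z).det) (hcrit : PlaneCritical U G) :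
    ∀ y ∈ U, EulerLagrange stdVec (cholesky G) y := by
  have he := contDiffOn_cholesky hG hG0 hG1
  have ha : ∀ w ∈ U, cholesky G 0 0 w ≠ 0 := fun w hw => (cholesky_zero_zero_pos (hG0 w hw)).ne'
  have hc : ∀ w ∈ U, cholesky G 1 1 w ≠ 0 :=
    fun w hw => (cholesky_one_one_pos (hG0 w hw) (hG1 w hw)).ne'
  have hd : ∀ w ∈ U, frameDet (cholesky G) w ≠ 0 := by
    intro w hw
    rw [frameDet_cholesky (hG0 w hw)]
    exact (Real.sqrt_pos.2 (hG1 w hw)).ne'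
  have sω := contDiffOn_frameConn (v := stdVec) hU he hd
  have su := contDiffOn_frameCurv (v := stdVec) hU he hd
  have sp := contDiffOn_curvGradP (v := stdVec) hU he hd ha
  have sq := contDiffOn_curvGradQ (v := stdVec) hU he hd ha hc
  -- Varying one entry of the coframe at a time separates the three equations.
  have test := fun (i : Fin 3) (g : EuclideanSpace ℝ (Fin 2) → ℝ) (hg : ContDiff ℝ ∞ g)
    (K : Set (EuclideanSpace ℝ (Fin 2))) (hK : IsCompact K) (hKU : K ⊆ U)
    (hgK : ∀ y ∉ K, g y = 0) => setIntegral_eulerLagrange_eq_zero hU hG hGs hG0 hG1 hcrit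
      (f := fun j => if j = i then g else 0)
      (fun j => by by_cases h : j = i <;> simp [h, hg]; exact contDiff_const) hK hKU
      (fun j y hy => by by_cases h : j = i <;> simp [h, hgK y hy])
  have h1 := eq_zero_of_setIntegral_mul_eq_zero (μ := volume) hU
    (f := fun y => 8 * (dirDeriv (stdVec 1) (curvGradQ stdVec (cholesky G)) y
          + frameConn stdVec (cholesky G) 1 y * curvGradP stdVec (cholesky G) y
          - frameCurv stdVec (cholesky G) y ^ 2 / 2 * cholesky G 1 1 y))
    (contDiffOn_const.mul (((contDiffOn_dirDeriv sq hU _).add ((sω 1).mul sp)).sub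
      (((su.pow 2).div_const 2).mul (he 1 1)))).continuousOn
    (fun g hg K hK hKU hgK => by simpa using test 0 g hg K hK hKU hgK)
  have h2 := eq_zero_of_setIntegral_mul_eq_zero (μ := volume) hU
    (f := fun y => -(8 * (dirDeriv (stdVec 0) (curvGradQ stdVec (cholesky G)) y
          + frameConn stdVec (cholesky G) 0 y * curvGradP stdVec (cholesky G) y)))
    (contDiffOn_const.mul ((contDiffOn_dirDeriv sq hU _).add ((sω 0).mul sp))).neg.continuousOn
    (fun g hg K hK hKU hgK => by simpa using test 1 g hg K hK hKU hgK)
  have h3 := eq_zero_of_setIntegral_mul_eq_zero (μ := volume) hU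
    (f := fun y => 8 * (dirDeriv (stdVec 0) (curvGradP stdVec (cholesky G)) y
          - frameConn stdVec (cholesky G) 0 y * curvGradQ stdVec (cholesky G) y
          - frameCurv stdVec (cholesky G) y ^ 2 / 2 * cholesky G 0 0 y))
    (contDiffOn_const.mul (((contDiffOn_dirDeriv sp hU _).sub ((sω 0).mul sq)).sub
      (((su.pow 2).div_const 2).mul (he 0 0)))).continuousOn
    (fun g hg K hK hKU hgK => by simpa using test 2 g hg K hK hKU hgK)
  intro y hy
  exact ⟨by linarith [h1 y hy], by linarith [h2 y hy], by linarith [h3 y hy]⟩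

end Plane

/-! ### Consequences of the Euler-Lagrange equations -/

section Consequences

variable {W : Type*} [NormedAddCommGroup W] [NormedSpace ℝ W]
  {V : Set W} {z : W} {v : Fin 2 → W} {e : Fin 2 → Fin 2 → W → ℝ}

/-- The squared norm of the gradient of the curvature. -/
def curvGradSq (v : Fin 2 → W) (e : Fin 2 → Fin 2 → W → ℝ) (z : W) : ℝ :=
  curvGradP v e z ^ 2 + curvGradQ v e z ^ 2

/-- The remaining component of the Hessian, from the symmetry of second derivatives. -/
theorem EulerLagrange.p_one (hV : IsOpen V) (he : ∀ k i, ContDiffOn ℝ ∞ (e k i) V)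
    (h10 : ∀ z, e 1 0 z = 0) (ha : ∀ z ∈ V, e 0 0 z ≠ 0) (hc : ∀ z ∈ V, e 1 1 z ≠ 0)
    (hz : z ∈ V) (h : EulerLagrange v e z) :
    dirDeriv (v 1) (curvGradP v e) z = frameConn v e 1 z * curvGradQ v e z
      + frameCurv v e z ^ 2 / 2 * e 0 1 z := by
  have hd : ∀ z ∈ V, frameDet e z ≠ 0 := fun z hz => by
    rw [frameDet_triangular h10]; exact mul_ne_zero (ha z hz) (hc z hz)
  have su := contDiffOn_frameCurv (v := v) hV he hd
  have sp := contDiffOn_curvGradP (v := v) hV he hd ha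
  have sq := contDiffOn_curvGradQ (v := v) hV he hd ha hc
  have D : ∀ {f : W → ℝ}, ContDiffOn ℝ ∞ f V → DifferentiableAt ℝ f z :=
    fun hf => differentiableAt_of_contDiffOn hf hV hz
  have hx : Set.EqOn (dirDeriv (v 0) (frameCurv v e)) (fun z => e 0 0 z * curvGradP v e z) V :=
    fun y hy => dirDeriv_frameCurv_zero (ha y hy)
  have hy : Set.EqOn (dirDeriv (v 1) (frameCurv v e))
      (fun z => e 0 1 z * curvGradP v e z + e 1 1 z * curvGradQ v e z) V :=
    fun y hy => dirDeriv_frameCurv_one (hc y hy)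
  -- A triangular coframe has only three entries to vary, so the variational principle gives three
  -- Hessian components; the fourth comes from equating the mixed derivatives of `u`, written
  -- through `du = p e⁰ + q e¹`.
  have hcomm := dirDeriv_comm su hV hz (v 0) (v 1)
  rw [dirDeriv_congr hV hx hz, dirDeriv_congr hV hy hz, dirDeriv_mul (D (he 0 0)) (D sp),
    dirDeriv_add ((D (he 0 1)).fun_mul (D sp)) ((D (he 1 1)).fun_mul (D sq)),
    dirDeriv_mul (D (he 0 1)) (D sp), dirDeriv_mul (D (he 1 1)) (D sq)] at hcomm
  have h1 := frameConn_zero_mul (v := v) h10 (ha z hz) (hc z hz)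
  have h2 := mul_frameConn_one (v := v) h10 (ha z hz) (hc z hz)
  refine mul_left_cancel₀ (ha z hz) ?_
  linear_combination -hcomm - curvGradP v e z * h1 - curvGradQ v e z * h2
    + e 0 1 z * h.p_zero + e 1 1 z * h.q_zero

/-- The first integral `|∇u|² - u³ / 3` of the Euler-Lagrange equations. -/
theorem EulerLagrange.dirDeriv_firstIntegral (hV : IsOpen V)
    (he : ∀ k i, ContDiffOn ℝ ∞ (e k i) V)
    (h10 : ∀ z, e 1 0 z = 0) (ha : ∀ z ∈ V, e 0 0 z ≠ 0) (hc : ∀ z ∈ V, e 1 1 z ≠ 0)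
    (hz : z ∈ V) (h : EulerLagrange v e z) (i : Fin 2) :
    dirDeriv (v i) (fun z => curvGradSq v e z - frameCurv v e z ^ 3 / 3) z = 0 := by
  have hd : ∀ z ∈ V, frameDet e z ≠ 0 := fun z hz => by
    rw [frameDet_triangular h10]; exact mul_ne_zero (ha z hz) (hc z hz)
  have D : ∀ {f : W → ℝ}, ContDiffOn ℝ ∞ f V → DifferentiableAt ℝ f z :=
    fun hf => differentiableAt_of_contDiffOn hf hV hz
  have du := D (contDiffOn_frameCurv (v := v) hV he hd)
  have dp := D (contDiffOn_curvGradP (v := v) hV he hd ha)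
  have dq := D (contDiffOn_curvGradQ (v := v) hV he hd ha hc)
  have key : ∀ i, dirDeriv (v i) (fun z => curvGradSq v e z - frameCurv v e z ^ 3 / 3) z
      = 2 * curvGradP v e z * dirDeriv (v i) (curvGradP v e) z
        + 2 * curvGradQ v e z * dirDeriv (v i) (curvGradQ v e) z
        - frameCurv v e z ^ 2 * dirDeriv (v i) (frameCurv v e) z := by
    intro i
    simp only [curvGradSq, div_eq_inv_mul]
    rw [dirDeriv_sub ((dp.fun_pow 2).fun_add (dq.fun_pow 2)) ((du.fun_pow 3).const_mul _),
      dirDeriv_add (dp.fun_pow 2) (dq.fun_pow 2), dirDeriv_const_mul _ (du.fun_pow 3),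
      dirDeriv_pow 1 dp, dirDeriv_pow 1 dq, dirDeriv_pow 2 du]
    push_cast
    ring
  rw [key]
  fin_cases i
  · have h0 := dirDeriv_frameCurv_zero (v := v) (ha z hz)
    simp only [Fin.zero_eta] at h0 ⊢
    linear_combination 2 * curvGradP v e z * h.p_zero + 2 * curvGradQ v e z * h.q_zero
      - frameCurv v e z ^ 2 * h0
  · have h0 := dirDeriv_frameCurv_one (v := v) (hc z hz)
    have h1 := h.p_one hV he h10 ha hc hz
    simp only [Fin.mk_one] at h0 h1 ⊢
    linear_combination 2 * curvGradP v e z * h1 + 2 * curvGradQ v e z * h.q_one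
      - frameCurv v e z ^ 2 * h0

/-- If the gradient vanishes on an open set, so does the Hessian, and the equation `Hess u = (u²/2)
g` forces `u² = 0`. Constant nonzero curvature is thereby excluded. -/
theorem frameCurv_eq_zero_of_curvGradSq_eq_zero (hV : IsOpen V) (ha : e 0 0 z ≠ 0)
    (h : EulerLagrange v e z) (h0 : ∀ z ∈ V, curvGradSq v e z = 0) (hz : z ∈ V) :
    frameCurv v e z = 0 := by
  have hp : ∀ y ∈ V, curvGradP v e y = 0 := fun y hy => by
    have := h0 y hy
    rw [curvGradSq] at this
    nlinarith [sq_nonneg (curvGradP v e y), sq_nonneg (curvGradQ v e y)]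
  have hq : ∀ y ∈ V, curvGradQ v e y = 0 := fun y hy => by
    have := h0 y hy
    rw [curvGradSq] at this
    nlinarith [sq_nonneg (curvGradP v e y), sq_nonneg (curvGradQ v e y)]
  have hd : dirDeriv (v 0) (curvGradP v e) z = 0 :=
    (dirDeriv_congr (g := fun _ => 0) hV hp hz).trans (dirDeriv_const 0)
  have := h.p_zero
  rw [hd, hq z hz] at this
  have h2 : frameCurv v e z ^ 2 * e 0 0 z = 0 := by linarith
  simpa [ha] using h2

/-- Cauchy-Schwarz inequality for the differential of the curvature. -/
theorem dirDeriv_frameCurv_sq_le (ha : e 0 0 z ≠ 0) (hc : e 1 1 z ≠ 0) (x y : ℝ) :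
    (x * dirDeriv (v 0) (frameCurv v e) z + y * dirDeriv (v 1) (frameCurv v e) z) ^ 2 ≤
      curvGradSq v e z * ((e 0 0 z * x + e 0 1 z * y) ^ 2 + (e 1 1 z * y) ^ 2) := by
  rw [dirDeriv_frameCurv_zero ha, dirDeriv_frameCurv_one hc, curvGradSq]
  nlinarith [sq_nonneg (curvGradP v e z * (e 1 1 z * y)
    - curvGradQ v e z * (e 0 0 z * x + e 0 1 z * y))]

/-- There is a vector of prescribed derivative in the direction of the gradient. -/
theorem exists_gradient (ha : e 0 0 z ≠ 0) (hc : e 1 1 z ≠ 0) : ∃ x y : ℝ,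
    x * dirDeriv (v 0) (frameCurv v e) z + y * dirDeriv (v 1) (frameCurv v e) z
      = curvGradSq v e z ∧
    (e 0 0 z * x + e 0 1 z * y) ^ 2 + (e 1 1 z * y) ^ 2 = curvGradSq v e z := by
  refine ⟨(curvGradP v e z - e 0 1 z * (curvGradQ v e z / e 1 1 z)) / e 0 0 z,
    curvGradQ v e z / e 1 1 z, ?_, ?_⟩
  · rw [dirDeriv_frameCurv_zero ha, dirDeriv_frameCurv_one hc, curvGradSq]
    field_simp
    ring
  · rw [curvGradSq]
    field_simp
    ring

end Consequences

/-! ### Bilinear forms in charts -/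

section Charts

variable {M : Type*} [TopologicalSpace M] [ChartedSpace (EuclideanSpace ℝ (Fin 2)) M]

/-- A field of bilinear forms evaluated on vectors of the model space. -/
def evalField (b : BilinField 2 M) (x : M) (v w : EuclideanSpace ℝ (Fin 2)) : ℝ := b x v w

/-- The differential of the inverse of a chart, as an endomorphism of the model space. -/
def chartVec (p : M) (y : EuclideanSpace ℝ (Fin 2)) :
    EuclideanSpace ℝ (Fin 2) →L[ℝ] EuclideanSpace ℝ (Fin 2) :=
  mfderiv 𝓘(ℝ, EuclideanSpace ℝ (Fin 2)) (𝓡 2) (extChartAt (𝓡 2) p).symm y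

/-- The transition map between two charts. -/
def transition (p q : M) (y : EuclideanSpace ℝ (Fin 2)) : EuclideanSpace ℝ (Fin 2) :=
  extChartAt (𝓡 2) p ((extChartAt (𝓡 2) q).symm y)

/-- The domain of the transition map between two charts. -/
def transitionDomain (p q : M) : Set (EuclideanSpace ℝ (Fin 2)) :=
  (extChartAt (𝓡 2) q).target ∩ (extChartAt (𝓡 2) q).symm ⁻¹' (extChartAt (𝓡 2) p).source

theorem inChart_apply (b : BilinField 2 M) (p : M) (y : EuclideanSpace ℝ (Fin 2)) (i j : Fin 2) :
    inChart b p y i j = evalField b ((extChartAt (𝓡 2) p).symm y) (chartVec p y (stdVec i))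
      (chartVec p y (stdVec j)) := rfl

theorem isOpen_transitionDomain (p q : M) : IsOpen (transitionDomain p q) :=
  (continuousOn_extChartAt_symm q).isOpen_inter_preimage (isOpen_extChartAt_target q)
    (isOpen_extChartAt_source p)

theorem mapsTo_transition (p q : M) :
    Set.MapsTo (transition p q) (transitionDomain p q) (extChartAt (𝓡 2) p).target :=
  fun _ hy => (extChartAt (𝓡 2) p).map_source hy.2

theorem evalField_comb (b : BilinField 2 M) (x : M) (r s r' s' : ℝ)
    (v v' w w' : EuclideanSpace ℝ (Fin 2)) :
    evalField b x (r • v + r' • v') (s • w + s' • w') =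
      r * s * evalField b x v w + r * s' * evalField b x v w'
      + r' * s * evalField b x v' w + r' * s' * evalField b x v' w' := by
  have h1 : ∀ v w w', evalField b x v (s • w + s' • w')
      = s * evalField b x v w + s' * evalField b x v w' := fun v w w' =>
    ((b x v).map_add _ _).trans (congrArg₂ _ ((b x v).map_smul s w) ((b x v).map_smul s' w'))
  have h2 : ∀ w, evalField b x (r • v + r' • v') w
      = r * evalField b x v w + r' * evalField b x v' w := fun w =>
    (congrArg (fun f => f w) ((b x).map_add (r • v) (r' • v'))).trans
      (congrArg₂ _ (congrArg (fun f => f w) ((b x).map_smul r v))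
        (congrArg (fun f => f w) ((b x).map_smul r' v')))
  rw [h1, h2, h2]
  ring

theorem evalField_expand (b : BilinField 2 M) (x : M)
    (A : EuclideanSpace ℝ (Fin 2) →L[ℝ] EuclideanSpace ℝ (Fin 2))
    (v w : EuclideanSpace ℝ (Fin 2)) :
    evalField b x (A v) (A w) =
      ∑ k, ∑ l, v k * evalField b x (A (stdVec k)) (A (stdVec l)) * w l := by
  conv_lhs => rw [eq_sum_stdVec v, eq_sum_stdVec w]
  simp only [map_add, map_smul, Fin.sum_univ_two, evalField_comb]
  ring

theorem chartVec_eq_mfderivWithin (p : M) (y : EuclideanSpace ℝ (Fin 2)) :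
    chartVec p y = mfderivWithin 𝓘(ℝ, EuclideanSpace ℝ (Fin 2)) (𝓡 2) (extChartAt (𝓡 2) p).symm
      (Set.range (𝓡 2)) y := by
  rw [(𝓡 2).range_eq_univ, mfderivWithin_univ]
  rfl

variable [IsManifold (𝓡 2) ∞ M]

theorem contMDiffAt_extChartAt_symm {p : M} {y : EuclideanSpace ℝ (Fin 2)}
    (hy : y ∈ (extChartAt (𝓡 2) p).target) :
    ContMDiffAt 𝓘(ℝ, EuclideanSpace ℝ (Fin 2)) (𝓡 2) ∞ (extChartAt (𝓡 2) p).symm y :=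
  (contMDiffOn_extChartAt_symm p).contMDiffAt ((isOpen_extChartAt_target p).mem_nhds hy)

theorem contDiffOn_transition (p q : M) :
    ContDiffOn ℝ ∞ (transition p q) (transitionDomain p q) := by
  rw [← contMDiffOn_iff_contDiffOn]
  have h1 := contMDiffOn_extChartAt (I := 𝓡 2) (n := ∞) (x := p)
  have h2 := contMDiffOn_extChartAt_symm (I := 𝓡 2) (n := ∞) q
  refine h1.comp (h2.mono Set.inter_subset_left) fun y hy => ?_
  simpa [extChartAt_source] using hy.2

theorem chartVec_injective {p : M} {y : EuclideanSpace ℝ (Fin 2)}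
    (hy : y ∈ (extChartAt (𝓡 2) p).target) : Function.Injective (chartVec p y) := by
  rw [chartVec_eq_mfderivWithin]
  exact (isInvertible_mfderivWithin_extChartAt_symm hy).injective

/-- The chain rule for the change of charts. -/
theorem chartVec_transition {p q : M} {y : EuclideanSpace ℝ (Fin 2)}
    (hy : y ∈ transitionDomain p q) (v : EuclideanSpace ℝ (Fin 2)) :
    chartVec q y v = chartVec p (transition p q y) (fderiv ℝ (transition p q) y v) := by
  have hev : (extChartAt (𝓡 2) q).symm =ᶠ[𝓝 y]
      (extChartAt (𝓡 2) p).symm ∘ transition p q := by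
    filter_upwards [(isOpen_transitionDomain p q).mem_nhds hy] with z hz
    exact ((extChartAt (𝓡 2) p).left_inv hz.2).symm
  have h1 : MDifferentiableAt 𝓘(ℝ, EuclideanSpace ℝ (Fin 2)) (𝓡 2) (extChartAt (𝓡 2) p).symm
      (transition p q y) :=
    (contMDiffAt_extChartAt_symm (mapsTo_transition p q hy)).mdifferentiableAt (by simp)
  have h2 : DifferentiableAt ℝ (transition p q) y :=
    ((contDiffOn_transition p q).contDiffAt
      ((isOpen_transitionDomain p q).mem_nhds hy)).differentiableAt (by simp)
  unfold chartVec
  rw [hev.mfderiv_eq, mfderiv_comp y h1 h2.mdifferentiableAt, mfderiv_eq_fderiv]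
  rfl

theorem frameDet_jac_eq_det {ψ : EuclideanSpace ℝ (Fin 2) → EuclideanSpace ℝ (Fin 2)}
    {y : EuclideanSpace ℝ (Fin 2)} (hψ : DifferentiableAt ℝ ψ y) :
    frameDet (jac ψ) y = (fderiv ℝ ψ y).det := by
  rw [ContinuousLinearMap.det, ← LinearMap.det_toMatrix (EuclideanSpace.basisFun (Fin 2) ℝ).toBasis,
    Matrix.det_fin_two]
  have h : ∀ i j, LinearMap.toMatrix (EuclideanSpace.basisFun (Fin 2) ℝ).toBasis
      (EuclideanSpace.basisFun (Fin 2) ℝ).toBasis (fderiv ℝ ψ y).toLinearMap i j = jac ψ i j y := by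
    intro i j
    rw [LinearMap.toMatrix_apply, jac, ← fderiv_apply_coord hψ]
    simp [stdVec]
  simp only [h, frameDet]

/-- By the chain rule the injective differential of one inverse chart factors through the
differential of the transition map, which is therefore injective as well. -/
theorem frameDet_jac_transition_ne_zero {p q : M} {y : EuclideanSpace ℝ (Fin 2)}
    (hy : y ∈ transitionDomain p q) : frameDet (jac (transition p q)) y ≠ 0 := by
  have h2 : DifferentiableAt ℝ (transition p q) y :=
    ((contDiffOn_transition p q).contDiffAt
      ((isOpen_transitionDomain p q).mem_nhds hy)).differentiableAt (by simp)
  rw [frameDet_jac_eq_det h2]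
  intro h0
  have hinj : Function.Injective (fderiv ℝ (transition p q) y) := by
    intro v w hvw
    apply chartVec_injective hy.1
    rw [chartVec_transition hy, chartVec_transition hy, hvw]
  have hk : LinearMap.ker (fderiv ℝ (transition p q) y).toLinearMap ≠ ⊥ :=
    ((LinearMap.det_eq_zero_iff_ker_ne_bot).1 h0)
  exact hk (LinearMap.ker_eq_bot.2 hinj)

/-- The transformation law of the components of a field of bilinear forms. -/
theorem inChart_transition (b : BilinField 2 M) {p q : M} {y : EuclideanSpace ℝ (Fin 2)}
    (hy : y ∈ transitionDomain p q) (i j : Fin 2) :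
    inChart b q y i j = ∑ k, ∑ l, jac (transition p q) k i y *
      inChart b p (transition p q y) k l * jac (transition p q) l j y := by
  have h2 : DifferentiableAt ℝ (transition p q) y :=
    ((contDiffOn_transition p q).contDiffAt
      ((isOpen_transitionDomain p q).mem_nhds hy)).differentiableAt (by simp)
  have hx : (extChartAt (𝓡 2) p).symm (transition p q y) = (extChartAt (𝓡 2) q).symm y :=
    (extChartAt (𝓡 2) p).left_inv hy.2
  rw [inChart_apply, chartVec_transition hy, chartVec_transition hy, evalField_expand]
  simp only [inChart_apply, hx, jac, fderiv_apply_coord h2]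

/-- The components of a field of bilinear forms in the trivialization over a chart. -/
theorem trivialization_apply (b : BilinField 2 M) {p x : M}
    (hx : x ∈ (extChartAt (𝓡 2) p).source) (v w : EuclideanSpace ℝ (Fin 2)) :
    (trivializationAt (EuclideanSpace ℝ (Fin 2) →L[ℝ] EuclideanSpace ℝ (Fin 2) →L[ℝ] ℝ)
      (fun x : M => TangentSpace (𝓡 2) x →L[ℝ] TangentSpace (𝓡 2) x →L[ℝ] ℝ) p ⟨x, b x⟩).2 v w
      = evalField b x (chartVec p (extChartAt (𝓡 2) p x) v)
        (chartVec p (extChartAt (𝓡 2) p x) w) := by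
  rw [extChartAt_source] at hx
  have hs := TangentBundle.symmL_trivializationAt (I := 𝓡 2) hx
  have e1 : ∀ v, chartVec p (extChartAt (𝓡 2) p x) v =
      (trivializationAt (EuclideanSpace ℝ (Fin 2)) (TangentSpace (𝓡 2)) p).symm x v := by
    intro v
    rw [chartVec_eq_mfderivWithin, ← Trivialization.symmL_apply (R := ℝ)]
    · exact congrArg (fun f => f v) hs.symm
    · simpa using hx
  rw [hom_trivializationAt_apply, inCoordinates_apply_eq₂ (by simpa using hx) (by simpa using hx)
    (by simp), e1, e1]
  simp [evalField]

end Charts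

/-! ### Passing between matrix functions on a chart and smooth tensor fields on the surface -/

section Fields

variable {M : Type*} [TopologicalSpace M] [ChartedSpace (EuclideanSpace ℝ (Fin 2)) M]

/-- The bilinear form with a given matrix. -/
def formOfMatrix (A : Matrix (Fin 2) (Fin 2) ℝ) :
    EuclideanSpace ℝ (Fin 2) →L[ℝ] EuclideanSpace ℝ (Fin 2) →L[ℝ] ℝ :=
  ∑ i, ∑ j, A i j • (EuclideanSpace.proj (𝕜 := ℝ) i).smulRight (EuclideanSpace.proj (𝕜 := ℝ) j)

theorem formOfMatrix_apply (A : Matrix (Fin 2) (Fin 2) ℝ) (v w : EuclideanSpace ℝ (Fin 2)) :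
    formOfMatrix A v w = ∑ i, ∑ j, A i j * (v i * w j) := by
  simp [formOfMatrix]

/-- The differential of a chart, as an endomorphism of the model space. -/
def chartCovec (p x : M) : EuclideanSpace ℝ (Fin 2) →L[ℝ] EuclideanSpace ℝ (Fin 2) :=
  mfderiv (𝓡 2) 𝓘(ℝ, EuclideanSpace ℝ (Fin 2)) (extChartAt (𝓡 2) p) x

open Classical in
/-- The bilinear form on the model space with given components in a chart, or zero outside the
chart. -/
def formAt (p : M) (H : EuclideanSpace ℝ (Fin 2) → Matrix (Fin 2) (Fin 2) ℝ) (x : M) :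
    EuclideanSpace ℝ (Fin 2) →L[ℝ] EuclideanSpace ℝ (Fin 2) →L[ℝ] ℝ :=
  if x ∈ (extChartAt (𝓡 2) p).source then
    (formOfMatrix (H (extChartAt (𝓡 2) p x))).bilinearComp (chartCovec p x) (chartCovec p x)
  else 0

/-- The field of bilinear forms with given components in a chart, extended by zero. -/
def fieldOfMatrix (p : M) (H : EuclideanSpace ℝ (Fin 2) → Matrix (Fin 2) (Fin 2) ℝ) :
    BilinField 2 M := fun x => formAt p H x

theorem formAt_eq_zero {p x : M} {H : EuclideanSpace ℝ (Fin 2) → Matrix (Fin 2) (Fin 2) ℝ}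
    (hx : x ∈ (extChartAt (𝓡 2) p).source → H (extChartAt (𝓡 2) p x) = 0)
    (v w : EuclideanSpace ℝ (Fin 2)) : formAt p H x v w = 0 := by
  unfold formAt
  split_ifs with h
  · rw [ContinuousLinearMap.bilinearComp_apply, formOfMatrix_apply, hx h]
    simp
  · rfl

theorem formAt_symm {p : M} {H : EuclideanSpace ℝ (Fin 2) → Matrix (Fin 2) (Fin 2) ℝ}
    (hHs : ∀ z i j, H z i j = H z j i) (x : M) (v w : EuclideanSpace ℝ (Fin 2)) :
    formAt p H x v w = formAt p H x w v := by
  unfold formAt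
  split_ifs with h
  · rw [ContinuousLinearMap.bilinearComp_apply, ContinuousLinearMap.bilinearComp_apply,
      formOfMatrix_apply, formOfMatrix_apply]
    simp only [Fin.sum_univ_two, hHs _ 1 0]
    ring
  · rfl

theorem fieldOfMatrix_eq_zero {p x : M} {H : EuclideanSpace ℝ (Fin 2) → Matrix (Fin 2) (Fin 2) ℝ}
    (hx : x ∈ (extChartAt (𝓡 2) p).source → H (extChartAt (𝓡 2) p x) = 0) :
    fieldOfMatrix p H x = 0 :=
  ContinuousLinearMap.ext fun v => ContinuousLinearMap.ext fun w => formAt_eq_zero hx v w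

variable [IsManifold (𝓡 2) ∞ M]

/-- Smoothness of a field of bilinear forms, as a section. -/
def IsSmoothField (b : BilinField 2 M) : Prop :=
  ContMDiff (𝓡 2)
    ((𝓡 2).prod 𝓘(ℝ, EuclideanSpace ℝ (Fin 2) →L[ℝ] EuclideanSpace ℝ (Fin 2) →L[ℝ] ℝ)) ∞
    (fun x => TotalSpace.mk' (EuclideanSpace ℝ (Fin 2) →L[ℝ] EuclideanSpace ℝ (Fin 2) →L[ℝ] ℝ)
      (E := fun x : M => TangentSpace (𝓡 2) x →L[ℝ] TangentSpace (𝓡 2) x →L[ℝ] ℝ) x (b x))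

set_option synthInstance.maxHeartbeats 400000 in
/-- The components of a smooth field of bilinear forms are smooth. -/
theorem contDiffOn_inChart {b : BilinField 2 M} (hb : IsSmoothField b) (p : M) (i j : Fin 2) :
    ContDiffOn ℝ ∞ (fun y => inChart b p y i j) (extChartAt (𝓡 2) p).target := by
  set e := trivializationAt (EuclideanSpace ℝ (Fin 2) →L[ℝ] EuclideanSpace ℝ (Fin 2) →L[ℝ] ℝ)
      (fun x : M => TangentSpace (𝓡 2) x →L[ℝ] TangentSpace (𝓡 2) x →L[ℝ] ℝ) p with he
  have hsub : (extChartAt (𝓡 2) p).source ⊆ e.baseSet := by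
    intro x hx
    rw [extChartAt_source] at hx
    simpa [he] using hx
  have h1 := (e.contMDiffOn_section_iff (IB := 𝓡 2) (n := ∞) (s := b) (isOpen_extChartAt_source p)
    hsub).1 hb.contMDiffOn
  have h2 := h1.comp (contMDiffOn_extChartAt_symm (I := 𝓡 2) (n := ∞) p)
    fun y hy => (extChartAt (𝓡 2) p).map_target hy
  rw [contMDiffOn_iff_contDiffOn] at h2
  refine ((h2.clm_apply (contDiffOn_const (c := stdVec i))).clm_apply
    (contDiffOn_const (c := stdVec j))).congr fun y hy => ?_
  have h3 := trivialization_apply b ((extChartAt (𝓡 2) p).map_target hy) (stdVec i) (stdVec j)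
  rw [(extChartAt (𝓡 2) p).right_inv hy] at h3
  exact h3.symm

/-- The differentials of the chart and of its inverse cancel, which leaves the prescribed matrix. -/
theorem evalField_fieldOfMatrix {p x : M} {H : EuclideanSpace ℝ (Fin 2) → Matrix (Fin 2) (Fin 2) ℝ}
    (hx : x ∈ (extChartAt (𝓡 2) p).source) (v w : EuclideanSpace ℝ (Fin 2)) :
    evalField (fieldOfMatrix p H) x (chartVec p (extChartAt (𝓡 2) p x) v)
      (chartVec p (extChartAt (𝓡 2) p x) w) = formOfMatrix (H (extChartAt (𝓡 2) p x)) v w := by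
  have hinv := mfderiv_extChartAt_comp_mfderivWithin_extChartAt_symm' (I := 𝓡 2) hx
  have hv : ∀ v, chartCovec p x (chartVec p (extChartAt (𝓡 2) p x) v) = v := by
    intro v
    rw [chartVec_eq_mfderivWithin]
    exact congrArg (fun f => f v) hinv
  change formAt p H x _ _ = _
  rw [formAt, if_pos hx, ContinuousLinearMap.bilinearComp_apply, hv, hv]

theorem inChart_fieldOfMatrix {p : M} {H : EuclideanSpace ℝ (Fin 2) → Matrix (Fin 2) (Fin 2) ℝ}
    {y : EuclideanSpace ℝ (Fin 2)} (hy : y ∈ (extChartAt (𝓡 2) p).target) :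
    inChart (fieldOfMatrix p H) p y = H y := by
  ext i j
  have h := evalField_fieldOfMatrix (H := H) ((extChartAt (𝓡 2) p).map_target hy)
    (stdVec i) (stdVec j)
  rw [(extChartAt (𝓡 2) p).right_inv hy] at h
  rw [inChart_apply, h, formOfMatrix_apply]
  fin_cases i <;> fin_cases j <;> simp [stdVec]

theorem contDiffOn_formOfMatrix {H : EuclideanSpace ℝ (Fin 2) → Matrix (Fin 2) (Fin 2) ℝ}
    {U : Set (EuclideanSpace ℝ (Fin 2))} (hH : ∀ i j, ContDiffOn ℝ ∞ (fun z => H z i j) U) :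
    ContDiffOn ℝ ∞ (fun y => formOfMatrix (H y)) U := by
  refine contDiffOn_clm_apply.2 fun v => contDiffOn_clm_apply.2 fun w => ?_
  simp only [formOfMatrix_apply]
  exact ContDiffOn.sum fun i _ => ContDiffOn.sum fun j _ => (hH i j).mul contDiffOn_const

set_option synthInstance.maxHeartbeats 400000 in
set_option maxHeartbeats 1000000 in
theorem isSmoothSymmetric_fieldOfMatrix [T2Space M] {p : M}
    {H : EuclideanSpace ℝ (Fin 2) → Matrix (Fin 2) (Fin 2) ℝ}
    (hH : ∀ i j, ContDiffOn ℝ ∞ (fun z => H z i j) (extChartAt (𝓡 2) p).target)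
    (hHs : ∀ z i j, H z i j = H z j i) {K : Set (EuclideanSpace ℝ (Fin 2))} (hK : IsCompact K)
    (hKU : K ⊆ (extChartAt (𝓡 2) p).target) (hHK : ∀ z ∉ K, H z = 0) :
    IsSmoothSymmetric (fieldOfMatrix p H) := by
  refine ⟨fun x v w => ?_, fun x => ?_⟩
  · exact formAt_symm hHs x v w
  · by_cases hx : x ∈ (extChartAt (𝓡 2) p).source
    · set e := trivializationAt (EuclideanSpace ℝ (Fin 2) →L[ℝ] EuclideanSpace ℝ (Fin 2) →L[ℝ] ℝ)
        (fun x : M => TangentSpace (𝓡 2) x →L[ℝ] TangentSpace (𝓡 2) x →L[ℝ] ℝ) p with he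
      have hxe : x ∈ e.baseSet := by
        rw [extChartAt_source] at hx
        simpa [he] using hx
      rw [e.contMDiffAt_section_iff (IB := 𝓡 2) (n := ∞) hxe]
      have hform := contDiffOn_formOfMatrix hH
      have hc : ContMDiffAt (𝓡 2) 𝓘(ℝ, EuclideanSpace ℝ (Fin 2)) ∞ (extChartAt (𝓡 2) p) x :=
        contMDiffAt_extChartAt' (by rwa [extChartAt_source] at hx)
      have hcomp := ((hform.contDiffAt ((isOpen_extChartAt_target p).mem_nhds
        ((extChartAt (𝓡 2) p).map_source hx))).contMDiffAt).comp x hc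
      refine hcomp.congr_of_eventuallyEq ?_
      filter_upwards [(isOpen_extChartAt_source (I := 𝓡 2) p).mem_nhds hx] with x' hx'
      ext1 v
      ext1 w
      rw [trivialization_apply _ hx', evalField_fieldOfMatrix hx']
      rfl
    -- The image of `K` is compact, hence closed because `M` is Hausdorff. A point outside the chart
    -- domain thus has a neighbourhood where the field vanishes, even though the chart says nothing
    -- there.
    · have hclosed : IsClosed ((extChartAt (𝓡 2) p).symm '' K) :=
        (hK.image_of_continuousOn ((continuousOn_extChartAt_symm p).mono hKU)).isClosed
      have hxK : x ∉ (extChartAt (𝓡 2) p).symm '' K := by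
        rintro ⟨y, hy, rfl⟩
        exact hx ((extChartAt (𝓡 2) p).map_target (hKU hy))
      have hz := contMDiff_zeroSection ℝ (IB := 𝓡 2) (n := ∞)
        (F := EuclideanSpace ℝ (Fin 2) →L[ℝ] EuclideanSpace ℝ (Fin 2) →L[ℝ] ℝ)
        (fun x : M => TangentSpace (𝓡 2) x →L[ℝ] TangentSpace (𝓡 2) x →L[ℝ] ℝ)
      refine (hz x).congr_of_eventuallyEq ?_
      filter_upwards [hclosed.isOpen_compl.mem_nhds hxK] with x' hx'
      have h0 : fieldOfMatrix p H x' = 0 := fieldOfMatrix_eq_zero fun hs => hHK _ fun hk =>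
        hx' ⟨_, hk, (extChartAt (𝓡 2) p).left_inv hs⟩
      rw [h0]
      rfl

theorem inChart_metric_symm (g : SmoothMetric 2 M) (p : M) (y : EuclideanSpace ℝ (Fin 2))
    (i j : Fin 2) : inChart g.inner p y i j = inChart g.inner p y j i :=
  g.symm _ _ _

theorem evalField_metric_pos (g : SmoothMetric 2 M) {p : M} {y : EuclideanSpace ℝ (Fin 2)}
    (hy : y ∈ (extChartAt (𝓡 2) p).target) {v : EuclideanSpace ℝ (Fin 2)} (hv : v ≠ 0) :
    0 < evalField g.inner ((extChartAt (𝓡 2) p).symm y) (chartVec p y v) (chartVec p y v) :=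
  g.pos _ _ fun h => hv (chartVec_injective hy (h.trans (map_zero _).symm))

theorem inChart_metric_pos (g : SmoothMetric 2 M) {p : M} {y : EuclideanSpace ℝ (Fin 2)}
    (hy : y ∈ (extChartAt (𝓡 2) p).target) :
    0 < inChart g.inner p y 0 0 ∧ 0 < (inChart g.inner p y).det := by
  have h0 : 0 < inChart g.inner p y 0 0 := by
    rw [inChart_apply]
    refine evalField_metric_pos g hy fun h => ?_
    have := congrArg (fun v : EuclideanSpace ℝ (Fin 2) => v 0) h
    simp [stdVec] at this
  refine ⟨h0, ?_⟩
  set a := inChart g.inner p y 0 0 with ha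
  set b := inChart g.inner p y 0 1 with hb
  -- With `d` the lower right entry, the metric takes the value `a (a d - b²)` on this vector; as `a
  -- > 0`, its positivity is that of the determinant.
  have hv : (-b) • stdVec 0 + a • stdVec 1 ≠ 0 := fun h => by
    have := congrArg (fun v : EuclideanSpace ℝ (Fin 2) => v 1) h
    simp [stdVec] at this
    exact h0.ne' this
  have hpos := evalField_metric_pos g hy hv
  rw [map_add, map_smul, map_smul, evalField_comb, ← inChart_apply, ← inChart_apply,
    ← inChart_apply, ← inChart_apply, inChart_metric_symm g p y 1 0, ← ha, ← hb] at hpos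
  rw [Matrix.det_fin_two, inChart_metric_symm g p y 1 0, ← ha, ← hb]
  nlinarith

end Fields

/-! ### Volume and energy in a chart -/

section Volume

variable {M : Type*} [TopologicalSpace M] [ChartedSpace (EuclideanSpace ℝ (Fin 2)) M]

theorem measurableSet_chart_preimage [MeasurableSpace M] [BorelSpace M] (p : M) {E : Set M}
    (hE : MeasurableSet E) :
    MeasurableSet ((extChartAt (𝓡 2) p).target ∩ (extChartAt (𝓡 2) p).symm ⁻¹' E) := by
  have hT := (isOpen_extChartAt_target (I := 𝓡 2) p).measurableSet
  have hc : Measurable ((extChartAt (𝓡 2) p).target.domRestrict (extChartAt (𝓡 2) p).symm) :=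
    (continuousOn_iff_continuous_domRestrict.1 (continuousOn_extChartAt_symm p)).measurable
  have := hT.subtype_image (hc hE)
  convert this using 1
  ext y
  constructor
  · rintro ⟨h1, h2⟩
    exact ⟨⟨y, h1⟩, h2, rfl⟩
  · rintro ⟨⟨z, hz⟩, h2, rfl⟩
    exact ⟨hz, h2⟩

theorem aemeasurable_chart_symm [MeasurableSpace M] [BorelSpace M] (p : M)
    (f : EuclideanSpace ℝ (Fin 2) → ℝ≥0∞) :
    AEMeasurable (extChartAt (𝓡 2) p).symm
      ((volume.restrict (extChartAt (𝓡 2) p).target).withDensity f) :=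
  ((continuousOn_extChartAt_symm (I := 𝓡 2) p).aemeasurable
    (isOpen_extChartAt_target p).measurableSet).mono_ac (withDensity_absolutelyContinuous _ _)

theorem chartVolume_apply [MeasurableSpace M] [BorelSpace M] (b : BilinField 2 M) (p : M)
    {E : Set M} (hE : MeasurableSet E) :
    chartVolume b p E = ∫⁻ y in (extChartAt (𝓡 2) p).target ∩ (extChartAt (𝓡 2) p).symm ⁻¹' E,
      ENNReal.ofReal (√(inChart b p y).det) := by
  have hT := (isOpen_extChartAt_target (I := 𝓡 2) p).measurableSet
  rw [chartVolume, Measure.map_apply_of_aemeasurable (aemeasurable_chart_symm p _) hE,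
    ← restrict_withDensity hT, Measure.restrict_apply' hT, Set.inter_comm,
    withDensity_apply _ (measurableSet_chart_preimage p hE)]

variable [IsManifold (𝓡 2) ∞ M]

theorem det_inChart_transition (b : BilinField 2 M) {p q : M} {y : EuclideanSpace ℝ (Fin 2)}
    (hy : y ∈ transitionDomain p q) :
    (inChart b q y).det = frameDet (jac (transition p q)) y ^ 2
      * (inChart b p (transition p q y)).det := by
  simp only [Matrix.det_fin_two, inChart_transition b hy, Fin.sum_univ_two, frameDet]
  ring

/-- The scalar curvature can be computed in any chart. -/
theorem scalarCurvature_eq (b : BilinField 2 M) {p x : M}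
    {G : EuclideanSpace ℝ (Fin 2) → Matrix (Fin 2) (Fin 2) ℝ}
    (hbG : ∀ y ∈ (extChartAt (𝓡 2) p).target, inChart b p y = G y)
    (hG : ∀ i j, ContDiffOn ℝ ∞ (fun z => G z i j) (extChartAt (𝓡 2) p).target)
    (hGs : ∀ z ∈ (extChartAt (𝓡 2) p).target, ∀ i j, G z i j = G z j i)
    (hG0 : ∀ z ∈ (extChartAt (𝓡 2) p).target, 0 < G z 0 0)
    (hG1 : ∀ z ∈ (extChartAt (𝓡 2) p).target, 0 < (G z).det)
    (hx : x ∈ (extChartAt (𝓡 2) p).source) :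
    scalarCurvature b x = scalar G (extChartAt (𝓡 2) p x) := by
  have hmem : extChartAt (𝓡 2) x x ∈ transitionDomain p x := by
    refine ⟨mem_extChartAt_target x, ?_⟩
    rw [Set.mem_preimage, extChartAt_to_inv]
    exact hx
  have htr : transition p x (extChartAt (𝓡 2) x x) = extChartAt (𝓡 2) p x := by
    rw [transition, extChartAt_to_inv]
  -- The definition uses the preferred chart of the point itself, so a transition to the fixed chart
  -- at `p` is needed for each `x`.
  rw [scalarCurvature, ← htr]
  refine scalar_pullback (isOpen_extChartAt_target p) (isOpen_transitionDomain p x)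
    (contDiffOn_transition p x) (mapsTo_transition p x) (contDiffOn_cholesky hG hG0 hG1) ?_
    (fun z hz => frameDet_jac_transition_ne_zero hz)
    (fun z hz => cholesky_mul_self (hGs z hz 1 0) (hG0 z hz) (hG1 z hz)) ?_ hmem
  · intro z hz
    rw [frameDet_cholesky (hG0 z hz)]
    exact (Real.sqrt_pos.2 (hG1 z hz)).ne'
  · intro z hz i j
    rw [inChart_transition b hz]
    simp only [hbG _ (mapsTo_transition p x hz)]

variable [MeasurableSpace M] [BorelSpace M]

/-- The measures of two charts agree on their overlap. -/
theorem chartVolume_eq_of_subset (b : BilinField 2 M) (p q : M) {E : Set M}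
    (hE : MeasurableSet E) (hp : E ⊆ (extChartAt (𝓡 2) p).source)
    (hq : E ⊆ (extChartAt (𝓡 2) q).source) : chartVolume b q E = chartVolume b p E := by
  rw [chartVolume_apply b q hE, chartVolume_apply b p hE]
  set A := (extChartAt (𝓡 2) q).target ∩ (extChartAt (𝓡 2) q).symm ⁻¹' E with hA
  have hAsub : A ⊆ transitionDomain p q := fun y hy => ⟨hy.1, hp hy.2⟩
  have himg : transition p q '' A =
      (extChartAt (𝓡 2) p).target ∩ (extChartAt (𝓡 2) p).symm ⁻¹' E := by
    ext z
    constructor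
    · rintro ⟨y, hy, rfl⟩
      refine ⟨mapsTo_transition p q (hAsub hy), ?_⟩
      have : (extChartAt (𝓡 2) p).symm (transition p q y) = (extChartAt (𝓡 2) q).symm y :=
        (extChartAt (𝓡 2) p).left_inv (hp hy.2)
      rw [Set.mem_preimage, this]
      exact hy.2
    · rintro ⟨hz, hzE⟩
      have hl := (extChartAt (𝓡 2) q).left_inv (hq hzE)
      refine ⟨extChartAt (𝓡 2) q ((extChartAt (𝓡 2) p).symm z),
        ⟨(extChartAt (𝓡 2) q).map_source (hq hzE), ?_⟩, ?_⟩
      · rw [Set.mem_preimage, hl]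
        exact hzE
      · rw [transition, hl, (extChartAt (𝓡 2) p).right_inv hz]
  have hinj : Set.InjOn (transition p q) A := by
    intro y hy z hz hyz
    have h1 := (extChartAt (𝓡 2) p).injOn (hp hy.2) (hp hz.2) hyz
    exact (extChartAt (𝓡 2) q).symm.injOn hy.1 hz.1 h1
  have hdiff : ∀ y ∈ A, DifferentiableAt ℝ (transition p q) y := fun y hy =>
    ((contDiffOn_transition p q).contDiffAt
      ((isOpen_transitionDomain p q).mem_nhds (hAsub hy))).differentiableAt (by simp)
  have hAm : MeasurableSet A := measurableSet_chart_preimage q hE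
  rw [← himg, lintegral_image_eq_lintegral_abs_det_fderiv_mul volume hAm
    (fun y hy => (hdiff y hy).hasFDerivAt.hasFDerivWithinAt) hinj]
  refine setLIntegral_congr_fun hAm fun y hy => ?_
  rw [det_inChart_transition b (hAsub hy), frameDet_jac_eq_det (hdiff y hy),
    Real.sqrt_mul (sq_nonneg _), Real.sqrt_sq_eq_abs, ENNReal.ofReal_mul (abs_nonneg _)]

/-- The Riemannian volume agrees with the measure of a chart on the source of that chart. -/
theorem riemannianVolume_apply (b : BilinField 2 M) (p : M) {E : Set M}
    (hE : MeasurableSet E) (hp : E ⊆ (extChartAt (𝓡 2) p).source) :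
    riemannianVolume b E = chartVolume b p E := by
  have hS := (isOpen_extChartAt_source (I := 𝓡 2) p).measurableSet
  refine le_antisymm ?_ (Measure.le_iff'.1 (le_iSup (chartVolume b) p) E)
  -- The supremum is a least upper bound among measures, so it is bounded by exhibiting one measure
  -- above every chart measure: `ν` equals the measure of the chart at `p` inside its source and is
  -- infinite on every nonempty set outside.
  set ν : Measure M := chartVolume b p +
    ((⊤ : ℝ≥0∞) • (Measure.count : Measure M)).restrict (extChartAt (𝓡 2) p).sourceᶜ with hν
  have hle : riemannianVolume b ≤ ν := by
    refine iSup_le fun q => Measure.le_iff.2 fun F hF => ?_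
    by_cases hFp : F ⊆ (extChartAt (𝓡 2) p).source
    -- The measure of the chart at `q` lives on the source of that chart, which reduces the
    -- comparison to the overlap.
    · have h1 : chartVolume b q F = chartVolume b q (F ∩ (extChartAt (𝓡 2) q).source) := by
        have hS' := (isOpen_extChartAt_source (I := 𝓡 2) q).measurableSet
        rw [chartVolume_apply b q hF, chartVolume_apply b q (hF.inter hS')]
        congr 2
        ext y
        constructor
        · rintro ⟨h1, h2⟩
          exact ⟨h1, h2, (extChartAt (𝓡 2) q).map_target h1⟩
        · rintro ⟨h1, h2, _⟩
          exact ⟨h1, h2⟩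
      rw [h1, chartVolume_eq_of_subset b p q
        (hF.inter (isOpen_extChartAt_source (I := 𝓡 2) q).measurableSet)
        (Set.inter_subset_left.trans hFp) Set.inter_subset_right]
      exact (measure_mono Set.inter_subset_left).trans
        (Measure.le_iff'.1 (Measure.le_add_right le_rfl) F)
    · obtain ⟨x, hxF, hxp⟩ := Set.not_subset.1 hFp
      have hne : (F ∩ (extChartAt (𝓡 2) p).sourceᶜ).Nonempty := ⟨x, hxF, hxp⟩
      have : ν F = ⊤ := by
        rw [hν, Measure.add_apply, Measure.restrict_apply hF, Measure.smul_apply, smul_eq_mul,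
          ENNReal.top_mul, add_top]
        exact (Measure.count_ne_zero hne)
      rw [this]
      exact le_top
  refine (Measure.le_iff'.1 hle E).trans ?_
  rw [hν, Measure.add_apply, Measure.restrict_apply hE]
  have : E ∩ (extChartAt (𝓡 2) p).sourceᶜ = ∅ :=
    Set.eq_empty_of_forall_notMem fun x hx => hx.2 (hp hx.1)
  rw [this, measure_empty, add_zero]

end Volume

/-! ### The energy in a chart and the reduction of criticality to plane domains -/

section Energy

theorem contDiffOn_scalar {U : Set (EuclideanSpace ℝ (Fin 2))}
    {G : EuclideanSpace ℝ (Fin 2) → Matrix (Fin 2) (Fin 2) ℝ} (hU : IsOpen U)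
    (hG : ∀ i j, ContDiffOn ℝ ∞ (fun z => G z i j) U) (hGs : ∀ z ∈ U, ∀ i j, G z i j = G z j i)
    (hG0 : ∀ z ∈ U, 0 < G z 0 0) (hG1 : ∀ z ∈ U, 0 < (G z).det) :
    ContDiffOn ℝ ∞ (scalar G) U := by
  have he := contDiffOn_cholesky hG hG0 hG1
  have hd : ∀ z ∈ U, frameDet (cholesky G) z ≠ 0 := fun z hz => by
    rw [frameDet_cholesky (hG0 z hz)]; exact (Real.sqrt_pos.2 (hG1 z hz)).ne'
  exact (contDiffOn_const.mul (contDiffOn_frameCurv hU he hd)).congr fun z hz =>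
    scalar_eq_frameCurv hU he hd
      (fun z hz => cholesky_mul_self (hGs z hz 1 0) (hG0 z hz) (hG1 z hz)) hz

variable {M : Type*} [TopologicalSpace M] [ChartedSpace (EuclideanSpace ℝ (Fin 2)) M]

theorem inChart_add_smul (b h : BilinField 2 M) (t : ℝ) (p : M) (y : EuclideanSpace ℝ (Fin 2)) :
    inChart (fun x => b x + t • h x) p y = inChart b p y + t • inChart h p y := rfl

variable [T2Space M] [IsManifold (𝓡 2) ∞ M] [MeasurableSpace M] [BorelSpace M]

/-- The energy on a compact subset of a chart domain, computed in the chart. -/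
theorem scalarEnergyOn_toReal (b : BilinField 2 M) {p : M}
    {G : EuclideanSpace ℝ (Fin 2) → Matrix (Fin 2) (Fin 2) ℝ}
    (hbG : ∀ y ∈ (extChartAt (𝓡 2) p).target, inChart b p y = G y)
    (hG : ∀ i j, ContDiffOn ℝ ∞ (fun z => G z i j) (extChartAt (𝓡 2) p).target)
    (hGs : ∀ z ∈ (extChartAt (𝓡 2) p).target, ∀ i j, G z i j = G z j i)
    (hG0 : ∀ z ∈ (extChartAt (𝓡 2) p).target, 0 < G z 0 0)
    (hG1 : ∀ z ∈ (extChartAt (𝓡 2) p).target, 0 < (G z).det)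
    {K : Set (EuclideanSpace ℝ (Fin 2))} (hK : IsCompact K)
    (hKU : K ⊆ (extChartAt (𝓡 2) p).target) :
    (scalarEnergyOn b ((extChartAt (𝓡 2) p).symm '' K)).toReal =
      ∫ y in K, scalar G y ^ 2 * √(G y).det := by
  set φ := extChartAt (𝓡 2) p with hφ
  have hT : MeasurableSet φ.target := (isOpen_extChartAt_target p).measurableSet
  have hKc : IsCompact (φ.symm '' K) :=
    hK.image_of_continuousOn ((continuousOn_extChartAt_symm p).mono hKU)
  have hKm : MeasurableSet (φ.symm '' K) := hKc.isClosed.measurableSet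
  have hKs : φ.symm '' K ⊆ φ.source := by
    rintro _ ⟨y, hy, rfl⟩
    exact φ.map_target (hKU hy)
  have hpre : φ.target ∩ φ.symm ⁻¹' (φ.symm '' K) = K := by
    ext y
    constructor
    · rintro ⟨h1, z, hz, hzy⟩
      rwa [← φ.symm.injOn (hKU hz) h1 hzy]
    · exact fun hy => ⟨hKU hy, y, hy, rfl⟩
  have hsc : ContinuousOn (scalar G) φ.target :=
    (contDiffOn_scalar (isOpen_extChartAt_target p) hG hGs hG0 hG1).continuousOn
  have hdet : ContinuousOn (fun y => √(G y).det) φ.target := by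
    simp only [Matrix.det_fin_two]
    exact (((hG 0 0).mul (hG 1 1)).sub ((hG 0 1).mul (hG 1 0))).continuousOn.sqrt
  have hvol : (riemannianVolume b).restrict (φ.symm '' K)
      = (chartVolume b p).restrict (φ.symm '' K) := by
    ext E hE
    rw [Measure.restrict_apply hE, Measure.restrict_apply hE]
    exact riemannianVolume_apply b p (hE.inter hKm) (Set.inter_subset_right.trans hKs)
  have hae : AEMeasurable φ.symm
      ((volume.restrict K).withDensity fun y => ENNReal.ofReal (√(G y).det)) :=
    (((continuousOn_extChartAt_symm p).mono hKU).aemeasurable hK.measurableSet).mono_ac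
      (withDensity_absolutelyContinuous _ _)
  have hmap : (chartVolume b p).restrict (φ.symm '' K)
      = ((volume.restrict K).withDensity fun y => ENNReal.ofReal (√(G y).det)).map φ.symm := by
    ext E hE
    rw [Measure.restrict_apply hE, chartVolume_apply b p (hE.inter hKm),
      Measure.map_apply_of_aemeasurable hae hE, ← restrict_withDensity hK.measurableSet,
      Measure.restrict_apply' hK.measurableSet]
    have hset : φ.target ∩ φ.symm ⁻¹' (E ∩ φ.symm '' K) = φ.symm ⁻¹' E ∩ K := by
      rw [Set.preimage_inter, Set.inter_left_comm, hpre]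
    have hm : MeasurableSet (φ.symm ⁻¹' E ∩ K) := by
      rw [← hset]; exact measurableSet_chart_preimage p (hE.inter hKm)
    rw [hset, withDensity_apply _ hm]
    exact setLIntegral_congr_fun hm fun y hy => by rw [hbG y (hKU hy.2)]
  have hcurv : Set.EqOn (fun x => ENNReal.ofReal (scalarCurvature b x ^ 2))
      (fun x => ENNReal.ofReal (scalar G (φ x) ^ 2)) (φ.symm '' K) := fun x hx => by
    dsimp only
    rw [scalarCurvature_eq b hbG hG hGs hG0 hG1 (hKs hx)]
  have hcont : ContinuousOn (fun x => ENNReal.ofReal (scalar G (φ x) ^ 2)) (φ.symm '' K) :=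
    ENNReal.continuous_ofReal.comp_continuousOn ((hsc.comp
      ((continuousOn_extChartAt p).mono hKs) fun x hx => φ.map_source (hKs hx)).pow 2)
  have hd : ContinuousOn (fun y => √(G y).det) K := hdet.mono hKU
  have hs : ContinuousOn (fun y => scalar G y ^ 2) K := (hsc.mono hKU).pow 2
  rw [scalarEnergyOn, setLIntegral_congr_fun hKm hcurv, hvol]
  have hgae := hcont.aemeasurable (μ := chartVolume b p) hKm
  rw [hmap] at hgae ⊢
  have hdae : AEMeasurable (fun y => ENNReal.ofReal (√(G y).det)) (volume.restrict K) :=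
    (ENNReal.continuous_ofReal.comp_continuousOn hd).aemeasurable hK.measurableSet
  have hcae : AEMeasurable (fun y => ENNReal.ofReal (scalar G (φ (φ.symm y)) ^ 2))
      ((volume.restrict K).withDensity fun y => ENNReal.ofReal (√(G y).det)) :=
    hgae.comp_aemeasurable hae
  rw [lintegral_map' hgae hae, lintegral_withDensity_eq_lintegral_mul₀' hdae
    hcae, integral_eq_lintegral_of_nonneg_ae
      (Filter.Eventually.of_forall fun y => mul_nonneg (sq_nonneg _) (Real.sqrt_nonneg _))
      ((hs.mul hd).aestronglyMeasurable_of_isCompact hK hK.measurableSet)]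
  congr 1
  refine setLIntegral_congr_fun hK.measurableSet fun y hy => ?_
  rw [Pi.mul_apply, φ.right_inv (hKU hy), mul_comm, ENNReal.ofReal_mul (sq_nonneg _)]

/-- In every chart, a critical metric is critical on the plane domain. -/
theorem planeCritical_inChart (g : SmoothMetric 2 M) (hg : IsCritical g) (p : M) :
    PlaneCritical (extChartAt (𝓡 2) p).target (inChart g.inner p) := by
  intro H hH hHs K hK hKU hHK
  have hU := isOpen_extChartAt_target (I := 𝓡 2) p
  have hG := contDiffOn_inChart (b := g.inner) g.contMDiff p
  have hGs := fun y i j => inChart_metric_symm g p y i j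
  have hpos := fun y (hy : y ∈ (extChartAt (𝓡 2) p).target) => inChart_metric_pos g hy
  have hcrit := hg (fieldOfMatrix p H) (isSmoothSymmetric_fieldOfMatrix hH hHs hK hKU hHK)
    ((extChartAt (𝓡 2) p).symm '' K)
    (hK.image_of_continuousOn ((continuousOn_extChartAt_symm p).mono hKU))
    (fun x hx => fieldOfMatrix_eq_zero fun hs => hHK _ fun hk =>
      hx ⟨_, hk, (extChartAt (𝓡 2) p).left_inv hs⟩)
  obtain ⟨ε, hε, hcyl⟩ := exists_cylinder (isOpen_positiveSet hU hG hH) hK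
    fun y hy => mem_positiveSet_zero (hKU hy) (hpos y (hKU hy)).1 (hpos y (hKU hy)).2
  refine hcrit.congr_of_eventuallyEq ?_
  filter_upwards [Icc_mem_nhds (show -ε < 0 by linarith) hε] with t ht
  -- The varied metric must be positive on the whole chart target, not only on `K`: on `K` the bound
  -- on `t` ensures this, and elsewhere the metric is unchanged.
  have hpos' : ∀ y ∈ (extChartAt (𝓡 2) p).target,
      0 < (inChart g.inner p y + t • H y) 0 0 ∧ 0 < (inChart g.inner p y + t • H y).det := by
    intro y hy
    by_cases hyK : y ∈ K
    · exact (hcyl t ht y hyK).2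
    · simpa [hHK y hyK] using hpos y hy
  refine (scalarEnergyOn_toReal (fun x => g.inner x + t • fieldOfMatrix p H x) (p := p)
    (G := fun y => inChart g.inner p y + t • H y) (fun y hy => ?_) (fun i j => ?_)
    (fun y hy i j => ?_) (fun y hy => (hpos' y hy).1) (fun y hy => (hpos' y hy).2) hK hKU).symm
  · rw [inChart_add_smul, inChart_fieldOfMatrix hy]
  · exact (hG i j).add (contDiffOn_const.mul (hH i j))
  · simp [hGs y i j, hHs y i j]

/-- In every chart, a critical metric satisfies the Euler-Lagrange equations. -/
theorem eulerLagrange_inChart (g : SmoothMetric 2 M) (hg : IsCritical g) (p : M) :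
    ∀ y ∈ (extChartAt (𝓡 2) p).target, EulerLagrange stdVec (cholesky (inChart g.inner p)) y :=
  eulerLagrange_of_planeCritical (isOpen_extChartAt_target p)
    (contDiffOn_inChart (b := g.inner) g.contMDiff p)
    (fun y _ i j => inChart_metric_symm g p y i j) (fun _ hy => (inChart_metric_pos g hy).1)
    (fun _ hy => (inChart_metric_pos g hy).2) (planeCritical_inChart g hg p)

end Energy

/-! ### A descent principle in complete spaces -/

/-- In a complete space, a nonnegative continuous function on a closed set cannot be decreased at
unit rate from every point of the set. -/
theorem not_forall_exists_descent {X : Type*} [TopologicalSpace X] {d : X → X → ℝ≥0∞}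
    (hself : ∀ x, d x x = 0) (hsymm : ∀ x y, d x y = d y x)
    (htri : ∀ x y z, d x z ≤ d x y + d y z)
    (hnear : ∀ x, ∀ c : ℝ≥0∞, 0 < c → ∀ᶠ y in 𝓝 x, d x y < c)
    (hcomplete : ∀ u : ℕ → X, (∀ ε : ℝ≥0∞, 0 < ε → ∃ N, ∀ i ≥ N, ∀ j ≥ N, d (u i) (u j) < ε) →
      ∃ x, Filter.Tendsto u Filter.atTop (𝓝 x))
    {S : Set X} (hS : IsClosed S) {Φ : X → ℝ} (hΦ : ContinuousOn Φ S) (hΦ0 : ∀ x ∈ S, 0 ≤ Φ x)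
    {x₀ : X} (hx₀ : x₀ ∈ S) :
    ¬ ∀ x ∈ S, ∃ y ∈ S, Φ y < Φ x ∧ d x y ≤ ENNReal.ofReal (Φ x - Φ y) := by
  intro hdesc
  -- `T x` is the set of points below `x` in the Caristi order. The idea is to descend almost
  -- greedily, take the limit, and contradict the descent still available there.
  let T : X → Set X := fun x => {y | y ∈ S ∧ Φ y ≤ Φ x ∧ d x y ≤ ENNReal.ofReal (Φ x - Φ y)}
  have hTtrans : ∀ {x y z}, y ∈ T x → z ∈ T y → z ∈ T x := by
    intro x y z hy hz
    refine ⟨hz.1, hz.2.1.trans hy.2.1, (htri x y z).trans ((add_le_add hy.2.2 hz.2.2).trans ?_)⟩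
    rw [← ENNReal.ofReal_add (sub_nonneg.2 hy.2.1) (sub_nonneg.2 hz.2.1)]
    exact ENNReal.ofReal_le_ofReal (by linarith)
  have hTself : ∀ x ∈ S, x ∈ T x := fun x hx => ⟨hx, le_rfl, by simp [hself]⟩
  have hnext : ∀ x : S, ∃ y : S, (y : X) ∈ T x ∧ ∀ z ∈ T (x : X), 2 * Φ y - Φ x ≤ Φ z := by
    intro x
    have hne : (Φ '' T x).Nonempty := ⟨_, x, hTself x x.2, rfl⟩
    have hbd : BddBelow (Φ '' T x) := ⟨0, by rintro _ ⟨z, hz, rfl⟩; exact hΦ0 z hz.1⟩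
    obtain ⟨y₁, hy₁S, hy₁, hy₁d⟩ := hdesc x x.2
    -- The next point takes at least half of the possible drop, that is `2Φ(y) - Φ(x) ≤ inf Φ` over
    -- `T x`; strictness is available because `hdesc` ensures that `Φ x` is not this infimum.
    have hlt : sInf (Φ '' T x) < (sInf (Φ '' T x) + Φ x) / 2 := by
      have : sInf (Φ '' T x) ≤ Φ y₁ := csInf_le hbd ⟨y₁, ⟨hy₁S, hy₁.le, hy₁d⟩, rfl⟩
      linarith
    obtain ⟨_, ⟨y, hy, rfl⟩, hylt⟩ := exists_lt_of_csInf_lt hne hlt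
    refine ⟨⟨y, hy.1⟩, hy, fun z hz => ?_⟩
    have : sInf (Φ '' T x) ≤ Φ z := csInf_le hbd ⟨z, hz, rfl⟩
    change 2 * Φ y - Φ x ≤ Φ z
    linarith
  choose next hnextT hnextI using hnext
  let u : ℕ → S := fun n => next^[n] ⟨x₀, hx₀⟩
  have husucc : ∀ n, u (n + 1) = next (u n) := fun n => Function.iterate_succ_apply' next n _
  have huT : ∀ i j : ℕ, i ≤ j → (u j : X) ∈ T (u i) := by
    intro i j hij
    induction j, hij using Nat.le_induction with
    | base => exact hTself _ (u i).2
    | succ j _ ih => exact hTtrans ih (husucc j ▸ hnextT (u j))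
  have hanti : Antitone fun n => Φ (u n) := fun i j hij => (huT i j hij).2.1
  have hbdd : BddBelow (Set.range fun n => Φ (u n)) :=
    ⟨0, by rintro _ ⟨n, rfl⟩; exact hΦ0 _ (u n).2⟩
  obtain ⟨L, hL⟩ : ∃ L, Filter.Tendsto (fun n => Φ (u n)) Filter.atTop (𝓝 L) :=
    ⟨_, tendsto_atTop_ciInf hanti hbdd⟩
  have hLle : ∀ n, L ≤ Φ (u n) := fun n => hanti.le_of_tendsto hL n
  have hdist : ∀ i j : ℕ, i ≤ j → d (u i) (u j) ≤ ENNReal.ofReal (Φ (u i) - L) := fun i j hij =>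
    (huT i j hij).2.2.trans (ENNReal.ofReal_le_ofReal (by linarith [hLle j]))
  have hsmall : Filter.Tendsto (fun n => ENNReal.ofReal (Φ (u n) - L)) Filter.atTop (𝓝 0) := by
    have := ENNReal.tendsto_ofReal (hL.sub_const L)
    simpa using this
  obtain ⟨x, hx⟩ := hcomplete (fun n => (u n : X)) fun ε hε => by
    obtain ⟨N, hN⟩ := ((hsmall.eventually (gt_mem_nhds hε))).exists_forall_of_atTop
    refine ⟨N, fun i hi j hj => ?_⟩
    rcases le_total i j with hij | hij
    · exact (hdist i j hij).trans_lt (hN i hi)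
    · rw [hsymm]
      exact (hdist j i hij).trans_lt (hN j hj)
  have hxS : x ∈ S := hS.mem_of_tendsto hx (Filter.Eventually.of_forall fun n => (u n).2)
  have hΦx : Φ x = L := by
    have h1 : Filter.Tendsto (fun n => (u n : X)) Filter.atTop (𝓝[S] x) :=
      tendsto_nhdsWithin_iff.2 ⟨hx, Filter.Eventually.of_forall fun n => (u n).2⟩
    exact tendsto_nhds_unique ((hΦ x hxS).tendsto.comp h1) hL
  have hxT : ∀ n, x ∈ T (u n) := by
    intro n
    refine ⟨hxS, by rw [hΦx]; exact hLle n, ?_⟩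
    rw [hΦx]
    -- The distance to the limit is estimated through a late term of the sequence, using only the
    -- triangle inequality and `hnear`.
    refine ENNReal.le_of_forall_pos_le_add fun ε hε _ => ?_
    have hev := (hx.eventually (hnear x ε (by exact_mod_cast hε))).and (Filter.eventually_ge_atTop n)
    obtain ⟨m, hm, hnm⟩ := hev.exists
    calc d (u n) x ≤ d (u n) (u m) + d (u m) x := htri _ _ _
      _ ≤ ENNReal.ofReal (Φ (u n) - L) + ε := by
        refine add_le_add (hdist n m hnm) ?_
        rw [hsymm]
        exact hm.le
  obtain ⟨y, hyS, hylt, hyd⟩ := hdesc x hxS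
  -- A point below the limit is below every `u n`, so its potential is at least `2Φ(u (n+1)) - Φ(u
  -- n)`, which tends to `L`, the potential of the limit.
  have hyT : ∀ n, y ∈ T (u n) := fun n => hTtrans (hxT n) ⟨hyS, hylt.le, hyd⟩
  have hlim : Filter.Tendsto (fun n => 2 * Φ (u (n + 1)) - Φ (u n)) Filter.atTop
      (𝓝 (2 * L - L)) :=
    (((Filter.tendsto_add_atTop_iff_nat 1).2 hL).const_mul 2).sub hL
  have hle : 2 * L - L ≤ Φ y := le_of_tendsto hlim (Filter.Eventually.of_forall fun n => by
    rw [husucc]; exact hnextI (u n) y (hyT n))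
  rw [hΦx] at hylt
  linarith

/-- A cubic with positive values on a half-line dominates a multiple of the shifted cube. -/
theorem exists_mul_cube_le {C a : ℝ} (h : 0 < C + a ^ 3 / 3) :
    ∃ δ > 0, ∀ s ≥ a, δ * (s - a + 1) ^ 3 ≤ C + s ^ 3 / 3 := by
  set m := C + a ^ 3 / 3 with hm
  set B := 4 * ((2 * |a| + 1) ^ 3 + 3 * |C|) with hB
  have hB0 : 0 ≤ B := by positivity
  -- Write `q = C + s³/3`. For `s ≥ 0`, `(s + c)³ ≤ 4(s³ + c³)` with `c = 2|a| + 1`, and `4s³ = 12(q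
  -- - C)`; this gives `(s - a + 1)³ ≤ B + 12q`. Since `q ≥ m`, the quotient `q / (B + 12q)` is at
  -- least `m / (B + 12m)`.
  refine ⟨m / (B + 12 * m), by positivity, fun s hs => ?_⟩
  have hq : m ≤ C + s ^ 3 / 3 := by
    have : a ^ 3 ≤ s ^ 3 := Odd.strictMono_pow (by decide : Odd 3) |>.monotone hs
    rw [hm]; linarith
  have hden : 0 < B + 12 * m := by positivity
  have hkey : (s - a + 1) ^ 3 ≤ B + 12 * (C + s ^ 3 / 3) := by
    have ha0 := abs_nonneg a
    have hC := neg_abs_le C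
    have haa := neg_abs_le a
    have haa' := le_abs_self a
    by_cases hs0 : 0 ≤ s
    · have h1 : s - a + 1 ≤ s + (2 * |a| + 1) := by linarith
      have h2 : (s - a + 1) ^ 3 ≤ (s + (2 * |a| + 1)) ^ 3 :=
        pow_le_pow_left₀ (by linarith) h1 3
      have h3 : (s + (2 * |a| + 1)) ^ 3 ≤ 4 * (s ^ 3 + (2 * |a| + 1) ^ 3) := by
        have hc : 0 ≤ 2 * |a| + 1 := by linarith
        nlinarith [mul_nonneg (add_nonneg hs0 hc) (sq_nonneg (s - (2 * |a| + 1)))]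
      linarith
    · push Not at hs0
      have h1 : s - a + 1 ≤ 2 * |a| + 1 := by linarith
      have h2 : (s - a + 1) ^ 3 ≤ (2 * |a| + 1) ^ 3 := pow_le_pow_left₀ (by linarith) h1 3
      have h3 : (0 : ℝ) ≤ (2 * |a| + 1) ^ 3 := by positivity
      have h4 : 0 ≤ |C| := abs_nonneg C
      have h5 : 0 ≤ C + s ^ 3 / 3 := h.le.trans hq
      linarith
  rw [div_mul_eq_mul_div, div_le_iff₀ hden]
  calc m * (s - a + 1) ^ 3 ≤ m * (B + 12 * (C + s ^ 3 / 3)) :=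
        mul_le_mul_of_nonneg_left hkey h.le
    _ ≤ (C + s ^ 3 / 3) * (B + 12 * m) := by nlinarith

/-! ### The distance of a metric -/

section Distance

variable {M : Type*} [TopologicalSpace M] [ChartedSpace (EuclideanSpace ℝ (Fin 2)) M]
  [IsManifold (𝓡 2) ∞ M]

theorem riemannianDistance_self (g : SmoothMetric 2 M) (x : M) : riemannianDistance g x x = 0 := by
  let _ : RiemannianBundle (fun x : M => TangentSpace (𝓡 2) x) := ⟨g.toRiemannianMetric⟩
  exact Manifold.riemannianEDist_self

theorem riemannianDistance_comm (g : SmoothMetric 2 M) (x y : M) :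
    riemannianDistance g x y = riemannianDistance g y x := by
  let _ : RiemannianBundle (fun x : M => TangentSpace (𝓡 2) x) := ⟨g.toRiemannianMetric⟩
  exact Manifold.riemannianEDist_comm

theorem riemannianDistance_triangle (g : SmoothMetric 2 M) (x y z : M) :
    riemannianDistance g x z ≤ riemannianDistance g x y + riemannianDistance g y z := by
  let _ : RiemannianBundle (fun x : M => TangentSpace (𝓡 2) x) := ⟨g.toRiemannianMetric⟩
  exact Manifold.riemannianEDist_triangle

theorem eventually_riemannianDistance_lt (g : SmoothMetric 2 M) (x : M) {c : ℝ≥0∞} (hc : 0 < c) :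
    ∀ᶠ y in 𝓝 x, riemannianDistance g x y < c := by
  let _ : RiemannianBundle (fun x : M => TangentSpace (𝓡 2) x) := ⟨g.toRiemannianMetric⟩
  have _ : IsContinuousRiemannianBundle (EuclideanSpace ℝ (Fin 2))
      (fun x : M => TangentSpace (𝓡 2) x) :=
    ⟨g.inner, g.contMDiff.continuous, fun _ _ _ ↦ rfl⟩
  exact eventually_riemannianEDist_lt (𝓡 2) x hc

/-- The norm on the tangent spaces in terms of the metric. -/
theorem enorm_tangent (g : SmoothMetric 2 M) (x : M) (v : TangentSpace (𝓡 2) x) :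
    let _ : RiemannianBundle (fun x : M => TangentSpace (𝓡 2) x) := ⟨g.toRiemannianMetric⟩
    ‖v‖ₑ = ENNReal.ofReal √(evalField g.inner x v v) := by
  let _ : RiemannianBundle (fun x : M => TangentSpace (𝓡 2) x) := ⟨g.toRiemannianMetric⟩
  change ‖v‖ₑ = _
  rw [← ofReal_norm v, norm_eq_sqrt_real_inner v]
  rfl

/-- The velocity of a coordinate line. -/
theorem mfderiv_chart_line {p : M} {y v : EuclideanSpace ℝ (Fin 2)} {s : ℝ}
    (hs : y + s • v ∈ (extChartAt (𝓡 2) p).target) :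
    mfderiv 𝓘(ℝ, ℝ) (𝓡 2) (fun t : ℝ => (extChartAt (𝓡 2) p).symm (y + t • v)) s (1 : ℝ)
      = chartVec p (y + s • v) v := by
  have h1 : MDifferentiableAt 𝓘(ℝ, EuclideanSpace ℝ (Fin 2)) (𝓡 2) (extChartAt (𝓡 2) p).symm
      (y + s • v) := (contMDiffAt_extChartAt_symm hs).mdifferentiableAt (by simp)
  have h2 : HasFDerivAt (fun t : ℝ => y + t • v) ((ContinuousLinearMap.id ℝ ℝ).smulRight v) s :=
    ((hasFDerivAt_id s).smul_const v).const_add y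
  have h3 := mfderiv_comp s h1 h2.differentiableAt.mdifferentiableAt
  rw [mfderiv_eq_fderiv, h2.fderiv] at h3
  have h4 := congrArg (fun f : ℝ →L[ℝ] EuclideanSpace ℝ (Fin 2) => f 1) h3
  refine h4.trans ?_
  change chartVec p (y + s • v) ((1 : ℝ) • v) = _
  rw [one_smul]

/-- Length bound for coordinate lines. -/
theorem eventually_riemannianDistance_line_le (g : SmoothMetric 2 M) {p : M}
    {y v : EuclideanSpace ℝ (Fin 2)} (hy : y ∈ (extChartAt (𝓡 2) p).target) {c : ℝ}
    (hc : √(evalField g.inner ((extChartAt (𝓡 2) p).symm y) (chartVec p y v)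
      (chartVec p y v)) < c) :
    ∀ᶠ t in 𝓝[>] (0 : ℝ), riemannianDistance g ((extChartAt (𝓡 2) p).symm y)
      ((extChartAt (𝓡 2) p).symm (y + t • v)) ≤ ENNReal.ofReal (c * t) := by
  have hU := isOpen_extChartAt_target (I := 𝓡 2) p
  have hline : Continuous fun t : ℝ => y + t • v := by fun_prop
  have hG := contDiffOn_inChart (b := g.inner) g.contMDiff p
  -- The speed of the coordinate line, written in components so that its continuity in `t` follows
  -- from that of the metric coefficients.
  let q : ℝ → ℝ := fun t => √(∑ k, ∑ l, v k * inChart g.inner p (y + t • v) k l * v l)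
  have hq : ∀ t, √(evalField g.inner ((extChartAt (𝓡 2) p).symm (y + t • v))
      (chartVec p (y + t • v) v) (chartVec p (y + t • v) v)) = q t := by
    intro t
    rw [evalField_expand]
    rfl
  have hy0 : y + (0 : ℝ) • v ∈ (extChartAt (𝓡 2) p).target := by simpa using hy
  have hqc : ContinuousAt q 0 := by
    have hent : ∀ k l, ContinuousAt (fun t : ℝ => inChart g.inner p (y + t • v) k l) 0 :=
      fun k l => ContinuousAt.comp (f := fun t : ℝ => y + t • v)
        ((hG k l).continuousOn.continuousAt (hU.mem_nhds hy0)) hline.continuousAt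
    have : ContinuousAt
        (fun t : ℝ => ∑ k, ∑ l, v k * inChart g.inner p (y + t • v) k l * v l) 0 := by
      simp only [Fin.sum_univ_two]
      have := hent 0 0; have := hent 0 1; have := hent 1 0; have := hent 1 1
      fun_prop
    exact this.sqrt
  have hq0 : q 0 < c := by
    rw [← hq 0]; simpa using hc
  have hev : ∀ᶠ t in 𝓝 (0 : ℝ), y + t • v ∈ (extChartAt (𝓡 2) p).target ∧ q t < c :=
    (hline.continuousAt.eventually_mem (hU.mem_nhds hy0)).and (hqc.eventually (gt_mem_nhds hq0))
  obtain ⟨ε, hε, hball⟩ := Metric.eventually_nhds_iff.1 hev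
  filter_upwards [Ioo_mem_nhdsGT hε] with t ht
  have hmem : ∀ s ∈ Set.Icc 0 t, y + s • v ∈ (extChartAt (𝓡 2) p).target ∧ q s < c := fun s hs =>
    hball (by rw [Real.dist_eq, sub_zero, abs_of_nonneg hs.1]; exact hs.2.trans_lt ht.2)
  have hγ : ContMDiffOn 𝓘(ℝ, ℝ) (𝓡 2) 1
      (fun s : ℝ => (extChartAt (𝓡 2) p).symm (y + s • v)) (Set.Icc 0 t) := by
    refine ((contMDiffOn_extChartAt_symm (n := 1) p).comp (f := fun s : ℝ => y + s • v) ?_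
      fun s hs => (hmem s hs).1)
    rw [contMDiffOn_iff_contDiffOn]
    exact (contDiff_const.add (contDiff_id.smul contDiff_const)).contDiffOn
  let _ : RiemannianBundle (fun x : M => TangentSpace (𝓡 2) x) := ⟨g.toRiemannianMetric⟩
  have h1 := Manifold.riemannianEDist_le_pathELength (I := 𝓡 2)
    (x := (extChartAt (𝓡 2) p).symm y) hγ (by rw [zero_smul, add_zero]) rfl ht.1.le
  refine h1.trans ?_
  rw [Manifold.pathELength_eq_lintegral_mfderiv_Icc]
  calc _ ≤ ∫⁻ s in Set.Icc 0 t, ENNReal.ofReal c := by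
        refine setLIntegral_mono measurable_const fun s hs => ?_
        refine (enorm_tangent g _ _).trans_le (ENNReal.ofReal_le_ofReal ?_)
        have hv := congrArg (fun w : EuclideanSpace ℝ (Fin 2) => √(evalField g.inner
          ((extChartAt (𝓡 2) p).symm (y + s • v)) w w)) (mfderiv_chart_line (hmem s hs).1)
        exact (hv.trans (hq s)).trans_le (hmem s hs).2.le
    _ = ENNReal.ofReal (c * t) := by
        rw [setLIntegral_const, Real.volume_Icc, sub_zero, ENNReal.ofReal_mul]
        exact (Real.sqrt_nonneg _).trans hc.le

end Distance

/-! ### The curvature function and its gradient on the surface -/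

section Global

variable {M : Type*} [TopologicalSpace M] [ChartedSpace (EuclideanSpace ℝ (Fin 2)) M]

/-- Functions that are continuous in all charts are continuous. -/
theorem continuous_of_inChart {f : M → ℝ} (F : M → EuclideanSpace ℝ (Fin 2) → ℝ)
    (hF : ∀ p, ContDiffOn ℝ ∞ (F p) (extChartAt (𝓡 2) p).target)
    (hf : ∀ p, ∀ x ∈ (extChartAt (𝓡 2) p).source, f x = F p (extChartAt (𝓡 2) p x)) :
    Continuous f := by
  refine continuous_iff_continuousAt.2 fun x => ?_
  have h : ContinuousOn f (extChartAt (𝓡 2) x).source :=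
    ((hF x).continuousOn.comp (continuousOn_extChartAt x) fun _ hz =>
      (extChartAt (𝓡 2) x).map_source hz).congr (hf x)
  exact h.continuousAt (extChartAt_source_mem_nhds x)

variable [IsManifold (𝓡 2) ∞ M]

/-- The orthonormal coframe of a metric in the chart at `p`. -/
def chartFrame (g : SmoothMetric 2 M) (p : M) :
    Fin 2 → Fin 2 → EuclideanSpace ℝ (Fin 2) → ℝ :=
  cholesky (inChart g.inner p)

/-- Half of the scalar curvature, with the opposite sign. -/
def negCurv (g : SmoothMetric 2 M) (x : M) : ℝ := -scalarCurvature g.inner x / 2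

/-- The squared norm of the gradient of the curvature. -/
def gradSq (g : SmoothMetric 2 M) (x : M) : ℝ :=
  curvGradSq stdVec (chartFrame g x) (extChartAt (𝓡 2) x x)

variable (g : SmoothMetric 2 M) {p q x : M} {y : EuclideanSpace ℝ (Fin 2)}

theorem contDiffOn_chartFrame (p : M) (k i : Fin 2) :
    ContDiffOn ℝ ∞ (chartFrame g p k i) (extChartAt (𝓡 2) p).target :=
  contDiffOn_cholesky (contDiffOn_inChart (b := g.inner) g.contMDiff p)
    (fun _ hy => (inChart_metric_pos g hy).1) (fun _ hy => (inChart_metric_pos g hy).2) k i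

theorem chartFrame_zero_zero_ne_zero (hy : y ∈ (extChartAt (𝓡 2) p).target) :
    chartFrame g p 0 0 y ≠ 0 :=
  (cholesky_zero_zero_pos (inChart_metric_pos g hy).1).ne'

theorem chartFrame_one_one_ne_zero (hy : y ∈ (extChartAt (𝓡 2) p).target) :
    chartFrame g p 1 1 y ≠ 0 :=
  (cholesky_one_one_pos (inChart_metric_pos g hy).1 (inChart_metric_pos g hy).2).ne'

theorem frameDet_chartFrame_ne_zero (hy : y ∈ (extChartAt (𝓡 2) p).target) :
    frameDet (chartFrame g p) y ≠ 0 := by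
  rw [chartFrame, frameDet_cholesky (inChart_metric_pos g hy).1]
  exact (Real.sqrt_pos.2 (inChart_metric_pos g hy).2).ne'

theorem inChart_eq_chartFrame (hy : y ∈ (extChartAt (𝓡 2) p).target) (i j : Fin 2) :
    inChart g.inner p y i j = chartFrame g p 0 i y * chartFrame g p 0 j y
      + chartFrame g p 1 i y * chartFrame g p 1 j y :=
  cholesky_mul_self (inChart_metric_symm g p y 1 0) (inChart_metric_pos g hy).1
    (inChart_metric_pos g hy).2 i j

theorem scalar_inChart (hy : y ∈ (extChartAt (𝓡 2) p).target) :
    scalar (inChart g.inner p) y = -2 * frameCurv stdVec (chartFrame g p) y :=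
  scalar_eq_frameCurv (isOpen_extChartAt_target p) (contDiffOn_chartFrame g p)
    (fun _ hz => frameDet_chartFrame_ne_zero g hz) (fun _ hz => inChart_eq_chartFrame g hz) hy

theorem negCurv_eq (hx : x ∈ (extChartAt (𝓡 2) p).source) :
    negCurv g x = frameCurv stdVec (chartFrame g p) (extChartAt (𝓡 2) p x) := by
  rw [negCurv, scalarCurvature_eq g.inner (fun _ _ => rfl)
    (contDiffOn_inChart (b := g.inner) g.contMDiff p)
    (fun y _ i j => inChart_metric_symm g p y i j) (fun _ hy => (inChart_metric_pos g hy).1)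
    (fun _ hy => (inChart_metric_pos g hy).2) hx,
    scalar_inChart g ((extChartAt (𝓡 2) p).map_source hx)]
  ring

theorem negCurv_symm (hy : y ∈ (extChartAt (𝓡 2) p).target) :
    negCurv g ((extChartAt (𝓡 2) p).symm y) = frameCurv stdVec (chartFrame g p) y := by
  rw [negCurv_eq g ((extChartAt (𝓡 2) p).map_target hy), (extChartAt (𝓡 2) p).right_inv hy]

theorem contDiffOn_frameCurv_chartFrame (p : M) :
    ContDiffOn ℝ ∞ (frameCurv stdVec (chartFrame g p)) (extChartAt (𝓡 2) p).target :=
  contDiffOn_frameCurv (isOpen_extChartAt_target p) (contDiffOn_chartFrame g p)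
    (fun _ hz => frameDet_chartFrame_ne_zero g hz)

theorem contDiffOn_curvGradSq_chartFrame (p : M) :
    ContDiffOn ℝ ∞ (curvGradSq stdVec (chartFrame g p)) (extChartAt (𝓡 2) p).target :=
  ((contDiffOn_curvGradP (isOpen_extChartAt_target p) (contDiffOn_chartFrame g p)
    (fun _ hz => frameDet_chartFrame_ne_zero g hz)
    (fun _ hz => chartFrame_zero_zero_ne_zero g hz)).pow 2).add
  ((contDiffOn_curvGradQ (isOpen_extChartAt_target p) (contDiffOn_chartFrame g p)
    (fun _ hz => frameDet_chartFrame_ne_zero g hz)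
    (fun _ hz => chartFrame_zero_zero_ne_zero g hz)
    (fun _ hz => chartFrame_one_one_ne_zero g hz)).pow 2)

theorem curvGradSq_nonneg {W : Type*} [NormedAddCommGroup W] [NormedSpace ℝ W] (v : Fin 2 → W)
    (e : Fin 2 → Fin 2 → W → ℝ) (z : W) : 0 ≤ curvGradSq v e z := by
  rw [curvGradSq]; positivity

/-- Take the gradient vector in the chart at `q` and push it forward by the Jacobian. Both its
squared length and its pairing with `du` are preserved and equal `|∇u|²` as computed at `q`;
Cauchy-Schwarz in the chart at `p` then gives the inequality. Exchanging the charts yields equality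
in `gradSq_eq`. -/
theorem curvGradSq_le_transition (hy : y ∈ transitionDomain p q) :
    curvGradSq stdVec (chartFrame g q) y ≤
      curvGradSq stdVec (chartFrame g p) (transition p q y) := by
  have hyp := mapsTo_transition p q hy
  have hJ : DifferentiableAt ℝ (transition p q) y :=
    ((contDiffOn_transition p q).contDiffAt
      ((isOpen_transitionDomain p q).mem_nhds hy)).differentiableAt (by simp)
  have hu := differentiableAt_of_contDiffOn (contDiffOn_frameCurv_chartFrame g p)
    (isOpen_extChartAt_target p) hyp
  have hcomp : Set.EqOn (frameCurv stdVec (chartFrame g q))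
      (fun z => frameCurv stdVec (chartFrame g p) (transition p q z)) (transitionDomain p q) := by
    intro z hz
    dsimp only
    rw [← negCurv_symm g hz.1, negCurv_eq g hz.2]
    rfl
  have hD : ∀ i, dirDeriv (stdVec i) (frameCurv stdVec (chartFrame g q)) y = _ := fun i =>
    (dirDeriv_congr (isOpen_transitionDomain p q) hcomp hy).trans (dirDeriv_comp hJ hu i)
  obtain ⟨a, b, h1, h2⟩ := exists_gradient (v := stdVec) (chartFrame_zero_zero_ne_zero g hy.1)
    (chartFrame_one_one_ne_zero g hy.1)
  have hle := dirDeriv_frameCurv_sq_le (v := stdVec) (chartFrame_zero_zero_ne_zero g hyp)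
    (chartFrame_one_one_ne_zero g hyp)
    (a * jac (transition p q) 0 0 y + b * jac (transition p q) 0 1 y)
    (a * jac (transition p q) 1 0 y + b * jac (transition p q) 1 1 y)
  have hG : ∀ i j, _ := fun i j => (inChart_transition g.inner hy i j).symm.trans
    (inChart_eq_chartFrame g hy.1 i j)
  have h10 : ∀ (p : M) (z : EuclideanSpace ℝ (Fin 2)), chartFrame g p 1 0 z = 0 :=
    fun p z => cholesky_one_zero z
  simp only [Fin.sum_univ_two, inChart_eq_chartFrame g hyp] at hG
  have g00 := hG 0 0
  have g01 := hG 0 1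
  have g11 := hG 1 1
  simp only [h10] at g00 g01 g11
  have hnum : (a * jac (transition p q) 0 0 y + b * jac (transition p q) 0 1 y)
        * dirDeriv (stdVec 0) (frameCurv stdVec (chartFrame g p)) (transition p q y)
      + (a * jac (transition p q) 1 0 y + b * jac (transition p q) 1 1 y)
        * dirDeriv (stdVec 1) (frameCurv stdVec (chartFrame g p)) (transition p q y)
      = curvGradSq stdVec (chartFrame g q) y := by
    rw [← h1, hD 0, hD 1]
    ring
  have hden : (chartFrame g p 0 0 (transition p q y)
          * (a * jac (transition p q) 0 0 y + b * jac (transition p q) 0 1 y)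
        + chartFrame g p 0 1 (transition p q y)
          * (a * jac (transition p q) 1 0 y + b * jac (transition p q) 1 1 y)) ^ 2
      + (chartFrame g p 1 1 (transition p q y)
          * (a * jac (transition p q) 1 0 y + b * jac (transition p q) 1 1 y)) ^ 2
      = curvGradSq stdVec (chartFrame g q) y := by
    rw [← h2]
    linear_combination a ^ 2 * g00 + 2 * a * b * g01 + b ^ 2 * g11
  rw [hnum, hden] at hle
  rcases (curvGradSq_nonneg stdVec (chartFrame g q) y).eq_or_lt with h0 | h0
  · rw [← h0]
    exact curvGradSq_nonneg _ _ _
  · exact le_of_mul_le_mul_right (by linarith) h0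

/-- The norm of the gradient of the curvature can be computed in any chart. -/
theorem gradSq_eq (hx : x ∈ (extChartAt (𝓡 2) p).source) :
    gradSq g x = curvGradSq stdVec (chartFrame g p) (extChartAt (𝓡 2) p x) := by
  have hxx := mem_extChartAt_source (I := 𝓡 2) x
  have h1 : extChartAt (𝓡 2) x x ∈ transitionDomain p x := by
    refine ⟨(extChartAt (𝓡 2) x).map_source hxx, ?_⟩
    rwa [Set.mem_preimage, (extChartAt (𝓡 2) x).left_inv hxx]
  have h2 : extChartAt (𝓡 2) p x ∈ transitionDomain x p := by
    refine ⟨(extChartAt (𝓡 2) p).map_source hx, ?_⟩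
    rwa [Set.mem_preimage, (extChartAt (𝓡 2) p).left_inv hx]
  have h3 := curvGradSq_le_transition g h1
  have h4 := curvGradSq_le_transition g h2
  rw [transition, (extChartAt (𝓡 2) x).left_inv hxx] at h3
  rw [transition, (extChartAt (𝓡 2) p).left_inv hx] at h4
  exact le_antisymm h3 h4

theorem gradSq_symm (hy : y ∈ (extChartAt (𝓡 2) p).target) :
    gradSq g ((extChartAt (𝓡 2) p).symm y) = curvGradSq stdVec (chartFrame g p) y := by
  rw [gradSq_eq g ((extChartAt (𝓡 2) p).map_target hy), (extChartAt (𝓡 2) p).right_inv hy]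

theorem continuous_negCurv : Continuous (negCurv g) :=
  continuous_of_inChart _ (contDiffOn_frameCurv_chartFrame g) fun _ _ hx => negCurv_eq g hx

theorem continuous_gradSq : Continuous (gradSq g) :=
  continuous_of_inChart _ (contDiffOn_curvGradSq_chartFrame g) fun _ _ hx => gradSq_eq g hx

theorem gradSq_nonneg (x : M) : 0 ≤ gradSq g x := curvGradSq_nonneg _ _ _

end Global

/-! ### Critical metrics are flat -/

section Flat

variable {M : Type*} [TopologicalSpace M] [ChartedSpace (EuclideanSpace ℝ (Fin 2)) M]
  [IsManifold (𝓡 2) ∞ M]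

theorem isFlat_of_negCurv_eq_zero {g : SmoothMetric 2 M} (h : ∀ x, negCurv g x = 0) :
    IsFlat g.inner := by
  intro p y hy l k i j
  refine riemann_eq_zero (isOpen_extChartAt_target p) (contDiffOn_chartFrame g p)
    (fun _ hz => frameDet_chartFrame_ne_zero g hz) (fun _ hz => inChart_eq_chartFrame g hz) hy ?_
    l k i j
  rw [scalar_inChart g hy, ← negCurv_symm g hy, h, mul_zero]

theorem scalarEnergy_eq_zero [MeasurableSpace M] {g : SmoothMetric 2 M} (h : ∀ x, negCurv g x = 0) :
    scalarEnergy g.inner = 0 := by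
  have h0 : ∀ x, scalarCurvature g.inner x = 0 := fun x => by
    have := h x
    rw [negCurv] at this
    linarith
  simp [scalarEnergy, scalarEnergyOn, h0]

variable [T2Space M] [MeasurableSpace M] [BorelSpace M]

/-- The first integral `|∇u|² - u³ / 3` is locally constant. -/
theorem eventually_firstIntegral_eq {g : SmoothMetric 2 M} (hg : IsCritical g) (x : M) :
    ∀ᶠ z in 𝓝 x, gradSq g z - negCurv g z ^ 3 / 3 = gradSq g x - negCurv g x ^ 3 / 3 := by
  have hU := isOpen_extChartAt_target (I := 𝓡 2) x
  have hxs := mem_extChartAt_source (I := 𝓡 2) x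
  set F : EuclideanSpace ℝ (Fin 2) → ℝ := fun z =>
    curvGradSq stdVec (chartFrame g x) z - frameCurv stdVec (chartFrame g x) z ^ 3 / 3 with hFdef
  have hF : ContDiffOn ℝ ∞ F (extChartAt (𝓡 2) x).target :=
    (contDiffOn_curvGradSq_chartFrame g x).sub
      (((contDiffOn_frameCurv_chartFrame g x).pow 3).div_const 3)
  have hF0 : ∀ z ∈ (extChartAt (𝓡 2) x).target, fderiv ℝ F z = 0 := by
    intro z hz
    have hi : ∀ i, dirDeriv (stdVec i) F z = 0 := fun i =>
      EulerLagrange.dirDeriv_firstIntegral hU (contDiffOn_chartFrame g x)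
        (fun y => cholesky_one_zero y) (fun _ hy => chartFrame_zero_zero_ne_zero g hy)
        (fun _ hy => chartFrame_one_one_ne_zero g hy) hz (eulerLagrange_inChart g hg x z hz) i
    ext w
    rw [eq_sum_stdVec w, map_add, map_smul, map_smul]
    change w 0 • dirDeriv (stdVec 0) F z + w 1 • dirDeriv (stdVec 1) F z = 0
    rw [hi, hi]
    simp
  obtain ⟨r, hr, hball⟩ := Metric.isOpen_iff.1 hU _ ((extChartAt (𝓡 2) x).map_source hxs)
  have hnear : ∀ᶠ z in 𝓝 x, extChartAt (𝓡 2) x z ∈ Metric.ball (extChartAt (𝓡 2) x x) r :=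
    (continuousAt_extChartAt x).eventually_mem (Metric.ball_mem_nhds _ hr)
  filter_upwards [hnear, extChartAt_source_mem_nhds (I := 𝓡 2) x] with z hz hzs
  rw [gradSq_eq g hzs, negCurv_eq g hzs, gradSq_eq g hxs, negCurv_eq g hxs]
  exact Metric.isOpen_ball.is_const_of_fderiv_eq_zero (convex_ball _ r).isPreconnected
    ((hF.differentiableOn (by simp)).mono hball) (fun z hz => hF0 z (hball hz)) hz
    (Metric.mem_ball_self hr)

/-- A function with derivative below `c` stays below its linear bound for a short time. -/
theorem eventually_lt_of_hasDerivAt_lt {f : ℝ → ℝ} {f' c : ℝ} (hf : HasDerivAt f f' 0)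
    (hc : f' < c) : ∀ᶠ t in 𝓝[>] (0 : ℝ), f t < f 0 + c * t := by
  have h := (hasDerivAt_iff_tendsto_slope.1 hf).mono_left
    (nhdsWithin_mono 0 fun t (ht : 0 < t) => ht.ne')
  filter_upwards [h.eventually (gt_mem_nhds hc), self_mem_nhdsWithin] with t ht ht0
  have ht0 : 0 < t := ht0
  rw [slope_def_field, sub_zero, div_lt_iff₀ ht0] at ht
  linarith

/-- The potential whose descent has finite length. -/
theorem hasDerivAt_potential {κ a s : ℝ} (hs : a ≤ s) :
    HasDerivAt (fun s => κ / √(s - a + 1)) (-(κ / (2 * √(s - a + 1) ^ 3))) s := by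
  have h0 : 0 < s - a + 1 := by linarith
  have hr := Real.sqrt_pos.2 h0
  have h1 : HasDerivAt (fun s : ℝ => s - a + 1) 1 s := ((hasDerivAt_id s).sub_const a).add_const 1
  have h2 := (hasDerivAt_const s κ).div (h1.sqrt h0.ne') hr.ne'
  refine h2.congr_deriv ?_
  set r := √(s - a + 1)
  field_simp
  ring

/-- The finite-length blow-up argument, in descent form. The potential is a multiple of the
remaining length in the comparison equation `u' = √δ (u - a + 1)^{3/2}`. -/
theorem gradSq_eq_zero {g : SmoothMetric 2 M} (hcomplete : IsComplete g) (hg : IsCritical g)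
    (x₀ : M) : gradSq g x₀ = 0 := by
  by_contra hne
  have hpos : 0 < gradSq g x₀ := lt_of_le_of_ne (gradSq_nonneg g x₀) (Ne.symm hne)
  set a := negCurv g x₀ with ha
  set C := gradSq g x₀ - a ^ 3 / 3 with hC
  -- At `x₀` the cubic `C + a³/3` is `|∇u|²`, which is positive by assumption.
  obtain ⟨δ, hδ, hcube⟩ := exists_mul_cube_le (C := C) (a := a) (by rw [hC]; linarith)
  -- The factor `4` makes the potential fall at rate at least `2|∇u|` along the gradient, strictly
  -- faster than the speed `|∇u|`. The intermediate value `3/2 |∇u|` below bounds both for small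
  -- times.
  set κ := 4 / √δ with hκ
  have hδ' := Real.sqrt_pos.2 hδ
  have hκ0 : 0 < κ := by positivity
  set S : Set M := {x | gradSq g x - negCurv g x ^ 3 / 3 = C} ∩ {x | a ≤ negCurv g x} with hS
  have hcu := continuous_negCurv g
  have hcN := continuous_gradSq g
  have hSc : IsClosed S := (isClosed_eq (by fun_prop) continuous_const).inter
    (isClosed_le continuous_const hcu)
  refine not_forall_exists_descent (d := riemannianDistance g) (riemannianDistance_self g)
    (riemannianDistance_comm g) (riemannianDistance_triangle g)
    (fun x c hc => eventually_riemannianDistance_lt g x hc) hcomplete hSc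
    (Φ := fun x => κ / √(negCurv g x - a + 1)) ?_ (fun x _ => by positivity)
    (x₀ := x₀) ⟨hC.symm, le_refl a⟩ ?_
  · refine ContinuousOn.div continuousOn_const (by fun_prop) fun x hx => ?_
    have : a ≤ negCurv g x := hx.2
    exact (Real.sqrt_pos.2 (by linarith)).ne'
  intro x hx
  have hxa : a ≤ negCurv g x := hx.2
  have hxC : gradSq g x - negCurv g x ^ 3 / 3 = C := hx.1
  set N := gradSq g x with hN
  have hNge : δ * (negCurv g x - a + 1) ^ 3 ≤ N := by linarith [hcube _ hxa]
  have hw : 0 < negCurv g x - a + 1 := by linarith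
  have hNpos : 0 < N := lt_of_lt_of_le (by positivity) hNge
  set r := √(negCurv g x - a + 1) with hr
  have hr0 : 0 < r := Real.sqrt_pos.2 hw
  have hr2 : r ^ 2 = negCurv g x - a + 1 := Real.sq_sqrt hw.le
  have hn0 : 0 < √N := Real.sqrt_pos.2 hNpos
  have hn2 : √N ^ 2 = N := Real.sq_sqrt hNpos.le
  have hd2 : √δ ^ 2 = δ := Real.sq_sqrt hδ.le
  have hnr : √δ * r ^ 3 ≤ √N := by
    refine abs_le_of_sq_le_sq' ?_ hn0.le |>.2
    rw [hn2, mul_pow, hd2, ← pow_mul, mul_comm 3 2, pow_mul, hr2]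
    exact hNge
  have hxs := mem_extChartAt_source (I := 𝓡 2) x
  set y := extChartAt (𝓡 2) x x with hy
  have hyt : y ∈ (extChartAt (𝓡 2) x).target := (extChartAt (𝓡 2) x).map_source hxs
  have hsy : (extChartAt (𝓡 2) x).symm y = x := (extChartAt (𝓡 2) x).left_inv hxs
  obtain ⟨b₀, b₁, h1, h2⟩ := exists_gradient (v := stdVec) (chartFrame_zero_zero_ne_zero g hyt)
    (chartFrame_one_one_ne_zero g hyt)
  set v : EuclideanSpace ℝ (Fin 2) := b₀ • stdVec 0 + b₁ • stdVec 1 with hv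
  have hv0 : v 0 = b₀ := by simp [hv, stdVec]
  have hv1 : v 1 = b₁ := by simp [hv, stdVec]
  have hvN : evalField g.inner ((extChartAt (𝓡 2) x).symm y) (chartVec x y v) (chartVec x y v)
      = N := by
    rw [evalField_expand, hN, gradSq, ← h2]
    simp only [← inChart_apply, Fin.sum_univ_two, hv0, hv1, inChart_eq_chartFrame g hyt]
    rw [show chartFrame g x 1 0 y = 0 from cholesky_one_zero y]
    ring
  let γ : ℝ → M := fun t => (extChartAt (𝓡 2) x).symm (y + t • v)
  have hline : Continuous fun t : ℝ => y + t • v := by fun_prop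
  have hy0 : y + (0 : ℝ) • v = y := by simp
  have hγ0 : γ 0 = x := by simp only [γ, hy0, hsy]
  have hmem : ∀ᶠ t in 𝓝 (0 : ℝ), y + t • v ∈ (extChartAt (𝓡 2) x).target :=
    hline.continuousAt.eventually_mem
      ((isOpen_extChartAt_target x).mem_nhds (by rw [hy0]; exact hyt))
  have hγc : ContinuousAt γ 0 :=
    ContinuousAt.comp (f := fun t : ℝ => y + t • v) (by
      rw [hy0]; exact (contMDiffAt_extChartAt_symm hyt).continuousAt) hline.continuousAt
  have hu : HasDerivAt (fun t => negCurv g (γ t)) N 0 := by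
    have hl : HasDerivAt (fun t : ℝ => y + t • v) v 0 := by
      simpa using ((hasDerivAt_id (0 : ℝ)).smul_const v).const_add y
    have hf := (differentiableAt_of_contDiffOn (contDiffOn_frameCurv_chartFrame g x)
      (isOpen_extChartAt_target x) hyt).hasFDerivAt
    have h3 := HasFDerivAt.comp_hasDerivAt_of_eq (0 : ℝ) hf hl hy0.symm
    have h4 : fderiv ℝ (frameCurv stdVec (chartFrame g x)) y v = N := by
      rw [hv, map_add, map_smul, map_smul, hN, gradSq, ← h1]
      rfl
    rw [h4] at h3
    refine h3.congr_of_eventuallyEq ?_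
    filter_upwards [hmem] with t ht
    exact negCurv_symm g ht
  have hΦ : HasDerivAt (fun t => κ / √(negCurv g (γ t) - a + 1)) (-(κ / (2 * r ^ 3)) * N) 0 :=
    HasDerivAt.comp_of_eq (h₂ := fun s => κ / √(s - a + 1)) (0 : ℝ) (hasDerivAt_potential hxa) hu
      (by rw [hγ0])
  have hslope : -(κ / (2 * r ^ 3)) * N < -(3 / 2 * √N) := by
    have : 2 * √N ≤ κ / (2 * r ^ 3) * N := by
      rw [hκ, div_div, div_mul_eq_mul_div, le_div_iff₀ (by positivity)]
      nlinarith
    linarith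
  have hlen := eventually_riemannianDistance_line_le g hyt (v := v) (c := 3 / 2 * √N)
    (by rw [hvN]; linarith)
  -- With slope bound zero for `-u`, this says that `u` increases, so the segment stays in `u ≥ a`.
  have hinc := eventually_lt_of_hasDerivAt_lt hu.neg (neg_lt_zero.2 hNpos)
  have hdec := eventually_lt_of_hasDerivAt_lt hΦ hslope
  have hfirst : ∀ᶠ t in 𝓝[>] (0 : ℝ), gradSq g (γ t) - negCurv g (γ t) ^ 3 / 3 = C := by
    have := hγc.eventually (hγ0.symm ▸ eventually_firstIntegral_eq hg x)
    filter_upwards [nhdsWithin_le_nhds this] with t ht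
    rw [ht, hγ0, ← hxC]
  obtain ⟨t, ht1, ht2, ht3, ht4, ht0⟩ :=
    (hlen.and (hinc.and (hdec.and (hfirst.and self_mem_nhdsWithin)))).exists
  have ht0 : 0 < t := ht0
  rw [hsy] at ht1
  simp only [Pi.neg_apply, hγ0, zero_mul, add_zero] at ht2 ht3
  have hst : 0 < 3 / 2 * √N * t := by positivity
  refine ⟨γ t, ⟨ht4, ?_⟩, ?_, ht1.trans (ENNReal.ofReal_le_ofReal ?_)⟩
  · change a ≤ negCurv g (γ t)
    linarith
  · linarith
  · linarith

theorem negCurv_eq_zero {g : SmoothMetric 2 M} (hcomplete : IsComplete g) (hg : IsCritical g)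
    (x : M) : negCurv g x = 0 := by
  have hxs := mem_extChartAt_source (I := 𝓡 2) x
  have hy := (extChartAt (𝓡 2) x).map_source hxs
  rw [negCurv_eq g hxs]
  exact frameCurv_eq_zero_of_curvGradSq_eq_zero (isOpen_extChartAt_target x)
    (chartFrame_zero_zero_ne_zero g hy) (eulerLagrange_inChart g hg x _ hy)
    (fun z hz => by rw [← gradSq_symm g hz, gradSq_eq_zero hcomplete hg]) hy

end Flat

end

end QuadraticCurvature

theorem theorem1p1 {M : Type*} [TopologicalSpace M] [T2Space M] [SecondCountableTopology M]
    [ChartedSpace (EuclideanSpace ℝ (Fin 2)) M] [IsManifold (𝓡 2) ∞ M]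
    [MeasurableSpace M] [BorelSpace M]
    (g : QuadraticCurvature.SmoothMetric 2 M)
    (hcomplete : QuadraticCurvature.IsComplete g)
    (hcritical : QuadraticCurvature.IsCritical g) :
    QuadraticCurvature.IsFlat g.inner ∧
      ∀ g' : QuadraticCurvature.SmoothMetric 2 M,
        QuadraticCurvature.scalarEnergy g.inner ≤ QuadraticCurvature.scalarEnergy g'.inner := by
  have h := QuadraticCurvature.negCurv_eq_zero hcomplete hcritical
  refine ⟨QuadraticCurvature.isFlat_of_negCurv_eq_zero h, fun g' => ?_⟩
  rw [QuadraticCurvature.scalarEnergy_eq_zero h]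
  exact zero_le
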